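/- Let $(M,g)$ be a smooth $4$-dimensional pseudo-Riemannian manifold of signature $(2,2)$, let $f\in C^\infty(M)$ and $\mu\in\mathbb{R}$ with $\mu\neq-\tfrac12$. Assume that $(M,g,f,\mu)$ is a generalized quasi-Einstein manifold, i.e. $$\operatorname{Hes}_f+\rho-\mu\, df\otimes df=\lambda\, g\quad\text{for some }\lambda\in C^\infty(M),$$ where $\rho$ is the Ricci tensor of $g$ (with the sign for which round spheres have positive Ricci tensor) and $\operatorname{Hes}_f$ is the Hessian of $f$ with respect to the Levi-Civita connection. Assume moreover that $(M,g)$ is half conformally flat, i.e. $M$ admits an orientation for which the Weyl tensor satisfies $W^-=0$ or $W^+=0$, where $W^{\pm}$ is the (anti-)self-dual part of $W$ with respect to the Hodge star on $2$-forms, and that $g(\nabla f,\nabla f)\neq0$ at every point of $M$. Then: (a) $(M,g)$ is locally conformally flat: every point of $M$ has an open neighbourhood $U$ and a function $\sigma\in C^\infty(U)$ such that the metric $e^{2\sigma}g$ is flat on $U$; (b) $(M,g)$ is locally isometric to a warped product $I\times_\varphi N$ whose fibre has constant sectional curvature: every point of $M$ has an open neighbourhood isometric to $I\times N$ with metric $\pm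 dt^2+\varphi(t)^2h$, where $I\subset\mathbb{R}$ is an open interval, $\varphi:I\to(0,\infty)$ is smooth, and $(N,h)$ is a connected $3$-dimensional pseudo-Riemannian manifold of constant sectional curvature. -/

import Mathlib

open scoped Manifold ContDiff

noncomputable section

namespace PseudoRiem

/-! ### Pseudo-Riemannian geometry in local coordinates

A metric on an open subset of `ℝⁿ` is given by its matrix of coefficients `G x = (g_ij(x))`. -/

/-- The partial derivative `∂_i F` at `x`. -/
def pd {n : ℕ} (i : Fin n) (F : EuclideanSpace ℝ (Fin n) → ℝ) (x : EuclideanSpace ℝ (Fin n)) : ℝ :=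
  fderiv ℝ F x (EuclideanSpace.single i 1)

/-- `G` is a smooth pseudo-Riemannian metric (of some signature) on the set `V`. -/
structure IsMetricOn {n : ℕ} (G : EuclideanSpace ℝ (Fin n) → Matrix (Fin n) (Fin n) ℝ)
    (V : Set (EuclideanSpace ℝ (Fin n))) : Prop where
  smooth : ∀ i j, ContDiffOn ℝ ∞ (fun x => G x i j) V
  symm : ∀ x ∈ V, (G x).IsSymm
  nondeg : ∀ x ∈ V, (G x).det ≠ 0

/-- The Christoffel symbol `Γ_ij^k` of the Levi-Civita connection, `∇_{∂_i} ∂_j = Γ_ij^k ∂_k`. -/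
def christoffel {n : ℕ} (G : EuclideanSpace ℝ (Fin n) → Matrix (Fin n) (Fin n) ℝ)
    (i j k : Fin n) (x : EuclideanSpace ℝ (Fin n)) : ℝ :=
  (1 / 2) * ∑ l, (G x)⁻¹ k l *
    (pd i (fun y => G y j l) x + pd j (fun y => G y i l) x - pd l (fun y => G y i j) x)

/-- The component `l` of the curvature operator `R(∂_i, ∂_j) ∂_k`, with the sign convention
`R(X,Y)Z = ∇_{[X,Y]} Z - [∇_X, ∇_Y] Z`. -/
def curvOp {n : ℕ} (G : EuclideanSpace ℝ (Fin n) → Matrix (Fin n) (Fin n) ℝ)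
    (i j k l : Fin n) (x : EuclideanSpace ℝ (Fin n)) : ℝ :=
  pd j (christoffel G i k l) x - pd i (christoffel G j k l) x
    + ∑ m, (christoffel G i k m x * christoffel G j m l x
      - christoffel G j k m x * christoffel G i m l x)

/-- The curvature tensor `R(∂_i, ∂_j, ∂_k, ∂_l) = g(R(∂_i, ∂_j) ∂_k, ∂_l)`. -/
def riemann {n : ℕ} (G : EuclideanSpace ℝ (Fin n) → Matrix (Fin n) (Fin n) ℝ)
    (i j k l : Fin n) (x : EuclideanSpace ℝ (Fin n)) : ℝ :=
  ∑ m, curvOp G i j k m x * G x m l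

/-- The Ricci tensor `ρ(X,Y) = Tr {Z ↦ R(X,Z)Y}`. -/
def ricci {n : ℕ} (G : EuclideanSpace ℝ (Fin n) → Matrix (Fin n) (Fin n) ℝ)
    (i j : Fin n) (x : EuclideanSpace ℝ (Fin n)) : ℝ :=
  ∑ k, curvOp G i k j k x

/-- The scalar curvature `τ`, the `g`-trace of the Ricci tensor. -/
def scalar {n : ℕ} (G : EuclideanSpace ℝ (Fin n) → Matrix (Fin n) (Fin n) ℝ)
    (x : EuclideanSpace ℝ (Fin n)) : ℝ :=
  ∑ i, ∑ j, (G x)⁻¹ i j * ricci G i j x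

/-- The Weyl tensor (in dimension `n ≥ 3`). -/
def weyl {n : ℕ} (G : EuclideanSpace ℝ (Fin n) → Matrix (Fin n) (Fin n) ℝ)
    (i j k l : Fin n) (x : EuclideanSpace ℝ (Fin n)) : ℝ :=
  riemann G i j k l x
    + scalar G x / (((n : ℝ) - 1) * ((n : ℝ) - 2)) * (G x i k * G x j l - G x i l * G x j k)
    + 1 / ((n : ℝ) - 2) * (ricci G i l x * G x j k - ricci G i k x * G x j l
      + ricci G j k x * G x i l - ricci G j l x * G x i k)

/-- The Hessian tensor `Hes_F(X,Y) = XY(F) - (∇_X Y)(F)`. -/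
def hessian {n : ℕ} (G : EuclideanSpace ℝ (Fin n) → Matrix (Fin n) (Fin n) ℝ)
    (F : EuclideanSpace ℝ (Fin n) → ℝ) (i j : Fin n) (x : EuclideanSpace ℝ (Fin n)) : ℝ :=
  pd i (pd j F) x - ∑ k, christoffel G i j k x * pd k F x

/-- `g(∇F, ∇F) = g^{ij} ∂_i F ∂_j F`. -/
def gradNormSq {n : ℕ} (G : EuclideanSpace ℝ (Fin n) → Matrix (Fin n) (Fin n) ℝ)
    (F : EuclideanSpace ℝ (Fin n) → ℝ) (x : EuclideanSpace ℝ (Fin n)) : ℝ :=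
  ∑ i, ∑ j, (G x)⁻¹ i j * pd i F x * pd j F x

/-- The inner product of two tangent vectors at `x`, given by their components. -/
def pair {n : ℕ} (G : EuclideanSpace ℝ (Fin n) → Matrix (Fin n) (Fin n) ℝ)
    (x : EuclideanSpace ℝ (Fin n)) (v w : Fin n → ℝ) : ℝ :=
  ∑ i, ∑ j, G x i j * v i * w j

/-- The sectional curvature of the plane spanned by `v, w` at `x` (meaningful if the plane is
nondegenerate). In the present sign convention the numerator is `R(v,w,v,w)`. -/
def sectional {n : ℕ} (G : EuclideanSpace ℝ (Fin n) → Matrix (Fin n) (Fin n) ℝ)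
    (x : EuclideanSpace ℝ (Fin n)) (v w : Fin n → ℝ) : ℝ :=
  (∑ i, ∑ j, ∑ k, ∑ l, riemann G i j k l x * v i * w j * v k * w l) /
    (pair G x v v * pair G x w w - pair G x v w ^ 2)

/-- All nondegenerate planes tangent to `V` have the same sectional curvature. -/
def HasConstSectional {n : ℕ} (G : EuclideanSpace ℝ (Fin n) → Matrix (Fin n) (Fin n) ℝ)
    (V : Set (EuclideanSpace ℝ (Fin n))) : Prop :=
  ∃ c : ℝ, ∀ x ∈ V, ∀ v w : Fin n → ℝ,
    pair G x v v * pair G x w w - pair G x v w ^ 2 ≠ 0 → sectional G x v w = c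

/-- The Levi-Civita symbol on four indices. -/
def leviCivita (i j k l : Fin 4) : ℝ :=
  Matrix.det (Matrix.of fun a b : Fin 4 => if ![i, j, k, l] a = b then (1 : ℝ) else 0)

/-- The Hodge star of a 2-form `β`, for the orientation of the coordinates:
`(⋆β)_ij = 1/2 √|det g| ε_ijkl g^{ka} g^{lb} β_ab`. -/
def hodge (G : EuclideanSpace ℝ (Fin 4) → Matrix (Fin 4) (Fin 4) ℝ)
    (x : EuclideanSpace ℝ (Fin 4)) (β : Fin 4 → Fin 4 → ℝ) (i j : Fin 4) : ℝ :=
  (1 / 2) * √|(G x).det| *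
    ∑ k, ∑ l, ∑ a, ∑ b, leviCivita i j k l * (G x)⁻¹ k a * (G x)⁻¹ l b * β a b

/-- The self-dual part `W⁺ = (W + ⋆W)/2` of the Weyl tensor, for the orientation of the
coordinates. -/
def weylPlus (G : EuclideanSpace ℝ (Fin 4) → Matrix (Fin 4) (Fin 4) ℝ)
    (i j k l : Fin 4) (x : EuclideanSpace ℝ (Fin 4)) : ℝ :=
  (weyl G i j k l x + hodge G x (fun a b => weyl G a b k l x) i j) / 2

/-- The anti-self-dual part `W⁻ = (W - ⋆W)/2` of the Weyl tensor, for the orientation of the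
coordinates. -/
def weylMinus (G : EuclideanSpace ℝ (Fin 4) → Matrix (Fin 4) (Fin 4) ℝ)
    (i j k l : Fin 4) (x : EuclideanSpace ℝ (Fin 4)) : ℝ :=
  (weyl G i j k l x - hodge G x (fun a b => weyl G a b k l x) i j) / 2

/-- The projection `(t, y) ↦ y` of `ℝⁿ⁺¹ = ℝ × ℝⁿ`. -/
def tail {n : ℕ} (x : EuclideanSpace ℝ (Fin (n + 1))) : EuclideanSpace ℝ (Fin n) :=
  WithLp.toLp 2 fun i => x i.succ

/-- The warped product metric `ε dt² + φ(t)² h` on (an open subset of) `ℝ × ℝⁿ`, the first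
coordinate being `t`. -/
def warped {n : ℕ} (ε : ℝ) (φ : ℝ → ℝ) (h : EuclideanSpace ℝ (Fin n) → Matrix (Fin n) (Fin n) ℝ)
    (x : EuclideanSpace ℝ (Fin (n + 1))) : Matrix (Fin (n + 1)) (Fin (n + 1)) ℝ :=
  Matrix.of (Fin.cons (Fin.cons ε fun _ => 0)
    fun i => Fin.cons 0 fun j => φ (x 0) ^ 2 * h (tail x) i j)

/-! ### Pseudo-Riemannian manifolds -/

/-- A smooth pseudo-Riemannian metric on a smooth `n`-manifold: a smooth field of
nondegenerate symmetric bilinear forms on the tangent spaces. -/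
structure Metric (n : ℕ) (M : Type*) [TopologicalSpace M]
    [ChartedSpace (EuclideanSpace ℝ (Fin n)) M] [IsManifold (𝓡 n) ∞ M] where
  inner : ∀ p : M, TangentSpace (𝓡 n) p →L[ℝ] TangentSpace (𝓡 n) p →L[ℝ] ℝ
  symm : ∀ (p : M) (v w : TangentSpace (𝓡 n) p), inner p v w = inner p w v
  nondeg : ∀ (p : M) (v : TangentSpace (𝓡 n) p), (∀ w, inner p v w = 0) → v = 0
  contMDiff : ContMDiff (𝓡 n)
    ((𝓡 n).prod 𝓘(ℝ, EuclideanSpace ℝ (Fin n) →L[ℝ] EuclideanSpace ℝ (Fin n) →L[ℝ] ℝ)) ∞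
    (fun p => Bundle.TotalSpace.mk' (EuclideanSpace ℝ (Fin n) →L[ℝ] EuclideanSpace ℝ (Fin n) →L[ℝ] ℝ)
      (E := fun p : M => TangentSpace (𝓡 n) p →L[ℝ] TangentSpace (𝓡 n) p →L[ℝ] ℝ) p (inner p))

variable {n : ℕ} {M : Type*} [TopologicalSpace M] [ChartedSpace (EuclideanSpace ℝ (Fin n)) M]
  [IsManifold (𝓡 n) ∞ M]

/-- The matrix `g(∂_i, ∂_j)` of the metric in the coordinate system `e`, as a function on
`e.target`. -/
def Metric.coeff (g : Metric n M) (e : OpenPartialHomeomorph M (EuclideanSpace ℝ (Fin n)))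
    (x : EuclideanSpace ℝ (Fin n)) : Matrix (Fin n) (Fin n) ℝ :=
  Matrix.of fun i j => g.inner (e.symm x)
    (mfderiv (𝓡 n) (𝓡 n) e.symm x (EuclideanSpace.single i (1 : ℝ)))
    (mfderiv (𝓡 n) (𝓡 n) e.symm x (EuclideanSpace.single j (1 : ℝ)))

/-- Neutral signature: every tangent space has an orthonormal basis with two timelike and
two spacelike vectors. -/
def Metric.IsNeutral {M : Type*} [TopologicalSpace M] [ChartedSpace (EuclideanSpace ℝ (Fin 4)) M]
    [IsManifold (𝓡 4) ∞ M] (g : Metric 4 M) : Prop :=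
  ∀ p : M, ∃ b : Module.Basis (Fin 4) ℝ (TangentSpace (𝓡 4) p), ∀ i j,
    g.inner p (b i) (b j) = Matrix.diagonal ![-1, -1, 1, 1] i j

/-- The generalized quasi-Einstein equation `Hes_f + ρ - μ df ⊗ df = λ g` for some smooth `λ`,
written in arbitrary local coordinates. -/
def Metric.IsGenQuasiEinstein (g : Metric n M) (f : M → ℝ) (μ : ℝ) : Prop :=
  ∃ lam : M → ℝ, ContMDiff (𝓡 n) 𝓘(ℝ, ℝ) ∞ lam ∧
    ∀ e ∈ IsManifold.maximalAtlas (𝓡 n) ∞ M, ∀ x ∈ e.target, ∀ i j,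
      hessian (g.coeff e) (f ∘ e.symm) i j x + ricci (g.coeff e) i j x
        - μ * (pd i (f ∘ e.symm) x * pd j (f ∘ e.symm) x) = lam (e.symm x) * g.coeff e x i j

/-- `‖∇f‖ ≠ 0` at every point. -/
def Metric.IsNonIsotropic (g : Metric n M) (f : M → ℝ) : Prop :=
  ∀ e ∈ IsManifold.maximalAtlas (𝓡 n) ∞ M, ∀ x ∈ e.target,
    gradNormSq (g.coeff e) (f ∘ e.symm) x ≠ 0

/-- The change of coordinates from `e` to `e'` preserves the orientation. -/
def SameOrientation (e e' : OpenPartialHomeomorph M (EuclideanSpace ℝ (Fin n))) : Prop :=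
  ∀ x ∈ (e.symm.trans e').source, 0 < (fderiv ℝ (e.symm.trans e') x).det

/-- An oriented atlas of `M`; it determines an orientation of `M`. -/
structure IsOrientedAtlas (A : Set (OpenPartialHomeomorph M (EuclideanSpace ℝ (Fin n)))) :
    Prop where
  subset : A ⊆ IsManifold.maximalAtlas (𝓡 n) ∞ M
  cover : ∀ p : M, ∃ e ∈ A, p ∈ e.source
  compatible : ∀ e ∈ A, ∀ e' ∈ A, SameOrientation e e'

/-- `e` is a positively oriented coordinate system for the orientation given by the oriented
atlas `A`. -/
def IsPositiveChart (A : Set (OpenPartialHomeomorph M (EuclideanSpace ℝ (Fin n))))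
    (e : OpenPartialHomeomorph M (EuclideanSpace ℝ (Fin n))) : Prop :=
  e ∈ IsManifold.maximalAtlas (𝓡 n) ∞ M ∧ ∀ e' ∈ A, SameOrientation e e'

/-- Locally conformally flat: every point has a (coordinate) neighbourhood with a smooth function
`σ` on it such that the metric `e^{2σ} g` is flat, that is, has vanishing curvature. -/
def Metric.IsLocallyConformallyFlat (g : Metric n M) : Prop :=
  ∀ p : M, ∃ e ∈ IsManifold.maximalAtlas (𝓡 n) ∞ M, p ∈ e.source ∧
    ∃ σ : EuclideanSpace ℝ (Fin n) → ℝ, ContDiffOn ℝ ∞ σ e.target ∧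
      ∀ x ∈ e.target, ∀ i j k l,
        riemann (fun y => Real.exp (2 * σ y) • g.coeff e y) i j k l x = 0

section Four

variable {M : Type*} [TopologicalSpace M] [ChartedSpace (EuclideanSpace ℝ (Fin 4)) M]
  [IsManifold (𝓡 4) ∞ M]

/-- Self-duality, `W⁻ = 0`, for the orientation given by `A`. -/
def Metric.IsSelfDual (g : Metric 4 M)
    (A : Set (OpenPartialHomeomorph M (EuclideanSpace ℝ (Fin 4)))) : Prop :=
  ∀ e, IsPositiveChart A e → ∀ x ∈ e.target, ∀ i j k l, weylMinus (g.coeff e) i j k l x = 0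

/-- Anti-self-duality, `W⁺ = 0`, for the orientation given by `A`. -/
def Metric.IsAntiSelfDual (g : Metric 4 M)
    (A : Set (OpenPartialHomeomorph M (EuclideanSpace ℝ (Fin 4)))) : Prop :=
  ∀ e, IsPositiveChart A e → ∀ x ∈ e.target, ∀ i j k l, weylPlus (g.coeff e) i j k l x = 0

/-- Half conformally flat: self-dual or anti-self-dual for some orientation. -/
def Metric.IsHalfConformallyFlat (g : Metric 4 M) : Prop :=
  ∃ A : Set (OpenPartialHomeomorph M (EuclideanSpace ℝ (Fin 4))),
    IsOrientedAtlas A ∧ (g.IsSelfDual A ∨ g.IsAntiSelfDual A)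

/-- Every point of `M` has an open neighbourhood `e.source` and a diffeomorphism `e` from it onto
`I × N`, with `I = (a, b)` an open interval and `N` a connected open subset of `ℝ³`,
which is an isometry onto a warped product `I ×_φ N` with metric `± dt² + φ(t)² h`,
where `φ > 0` and `(N, h)` is a pseudo-Riemannian manifold of constant sectional curvature. -/
def Metric.IsLocallyWarpedConstCurv (g : Metric 4 M) : Prop :=
  ∀ p : M, ∃ e ∈ IsManifold.maximalAtlas (𝓡 4) ∞ M, p ∈ e.source ∧
    ∃ (a b : ℝ) (N : Set (EuclideanSpace ℝ (Fin 3))) (ε : ℝ) (φ : ℝ → ℝ)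
      (h : EuclideanSpace ℝ (Fin 3) → Matrix (Fin 3) (Fin 3) ℝ),
      IsOpen N ∧ IsConnected N ∧ IsMetricOn h N ∧ HasConstSectional h N ∧
      (ε = 1 ∨ ε = -1) ∧
      ContDiffOn ℝ ∞ φ (Set.Ioo a b) ∧ (∀ t ∈ Set.Ioo a b, 0 < φ t) ∧
      e.target = {x | x 0 ∈ Set.Ioo a b ∧ tail x ∈ N} ∧
      ∀ x ∈ e.target, g.coeff e x = warped ε φ h x

end Four

end PseudoRiem

end

/-! Fix a point and use coordinates that are normal and orthonormal there, the first axis pointing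
along ∇f. Differentiating the quasi-Einstein equation, antisymmetrising and applying the Ricci
identity to df expresses the antisymmetrised derivative of ρ through μ, the Hessian h of f, dλ and
R(·,·,·,∇f). Together with the contracted Bianchi identities this says that E = 2 div W −
W(·,·,·,∇f) equals (μ + 1/2)(fᵢ hⱼₖ − fⱼ hᵢₖ) + gⱼₖ vᵢ − gᵢₖ vⱼ for some covector v
(`weyl_contraction`).

Half conformal flatness enters through one algebraic fact: an (anti-)self-dual 2-form that vanishes
on a nondegenerate hyperplane is zero. The hyperplane is ∇f^⊥, nondegenerate because ∇f is not null.
In its first two slots E is (anti-)self-dual, and it is trace-free because W is. The formula shows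
that E(·,·,∇f) vanishes on the hyperplane, hence everywhere. The trace then kills v on the
hyperplane, so E(·,·,k) vanishes there for every k, and E is zero in the directions that matter. As
μ + 1/2 ≠ 0, this forces Hes_f = α g + β df ⊗ df (`frame_hessian`).

The Ricci and Bianchi identities now show that dα, dβ, dλ and d‖∇f‖² are multiples of df
(`IsNormalAt.pd_eq_zero_of_hessian_eq`, `IsQEOn.exists_pd_gradNormSq_eq`). Hence the gradient flow,
reparametrised by arc length, carries level sets of f to level sets and the metric becomes ε dt² +
g_ab(t, y) (`IsQEOn.exists_gauss_chart`). The Hessian equation reads ∂ₜ g_ab = 2(εα/∂ₜf) g_ab with a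
factor depending on t alone, so the metric is a warped product. The quasi-Einstein equation
restricted to the fibre makes it Einstein (`exists_warped`), and an Einstein metric in dimension
three has constant curvature (`riemann_of_ricci`). This is (b).

For (a), g/φ² is the product of a line with a space of constant curvature. The linear system
`prolong`, for functions whose Hessian is −(κᵢ w + σ) g, is integrable on such a product, and its
solutions carry a conserved bilinear form. If w' is a null solution and the w_a are orthogonal to
it, the quotients w_a/w' have vanishing Hessian for w'⁻² g. Taking n independent ones makes that
metric flat (`exists_conformal_factor`).

The analytic input is local flows and a linear Frobenius theorem. Both follow from one
smooth-dependence statement (`exists_radial_solution`), proved by the implicit function theorem on a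
Banach space of curves. -/

noncomputable section

namespace PseudoRiem

open Set Filter Topology

/-! ### Smoothness of superposition operators on spaces of continuous functions -/

section Nemytskii

universe u
variable {K : Type*} [TopologicalSpace K] [CompactSpace K]

/-- Superposition by a continuous map, as a map between spaces of continuous functions. -/
def superpose {E F : Type*} [TopologicalSpace E] [TopologicalSpace F] (v : E → F)
    (hv : Continuous v) (γ : C(K, E)) : C(K, F) := (⟨v, hv⟩ : C(E, F)).comp γ

variable {E : Type u} [NormedAddCommGroup E] [NormedSpace ℝ E]

/-- Pointwise application of a function with values in continuous linear maps. -/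
def applyPointwise {F : Type*} [NormedAddCommGroup F] [NormedSpace ℝ F] :
    C(K, E →L[ℝ] F) →L[ℝ] C(K, E) →L[ℝ] C(K, F) :=
  LinearMap.mkContinuous₂
    (LinearMap.mk₂ ℝ (fun (a : C(K, E →L[ℝ] F)) (h : C(K, E)) =>
        (⟨fun s => a s (h s), a.continuous.clm_apply h.continuous⟩ : C(K, F)))
      (fun a b h => by ext s; simp) (fun c a h => by ext s; simp)
      (fun a h k => by ext s; simp) (fun c a h => by ext s; simp)) 1
    (fun a h => by
      rw [one_mul, ContinuousMap.norm_le _ (by positivity)]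
      intro s
      exact ((a s).le_opNorm _).trans (mul_le_mul (a.norm_coe_le_norm s) (h.norm_coe_le_norm s)
        (norm_nonneg _) (norm_nonneg a)))

theorem contDiff_applyPointwise {F : Type*} [NormedAddCommGroup F] [NormedSpace ℝ F]
    {n : WithTop ℕ∞} :
    ContDiff ℝ n fun a : C(K, E →L[ℝ] F) => applyPointwise (K := K) (E := E) (F := F) a := by
  exact ContinuousLinearMap.contDiff (n := n) (𝕜 := ℝ) (E := C(K, E →L[ℝ] F))
    (F := C(K, E) →L[ℝ] C(K, F)) (applyPointwise (K := K) (E := E) (F := F))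

/-- Compactness of `K` makes superposition by v' continuous in the sup norm, so v' varies by at most
c, uniformly in s, on a tube around γ. The mean value inequality on each ball around γ(s) then
bounds the remainder by c‖h‖. -/
theorem hasFDerivAt_superpose {F : Type*} [NormedAddCommGroup F] [NormedSpace ℝ F] {v : E → F}
    (hv : ContDiff ℝ 1 v) (γ : C(K, E)) :
    HasFDerivAt (superpose v hv.continuous)
      (applyPointwise (superpose (fderiv ℝ v) (hv.continuous_fderiv one_ne_zero) γ)) γ := by
  have hc : Continuous (superpose (K := K) (fderiv ℝ v) (hv.continuous_fderiv one_ne_zero)) :=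
    ContinuousMap.continuous_postcomp _
  rw [hasFDerivAt_iff_isLittleO_nhds_zero, Asymptotics.isLittleO_iff]
  intro c hcpos
  have hcγ : Tendsto _ (𝓝 γ) (𝓝 _) := hc.continuousAt
  obtain ⟨δ, hδ, hball⟩ := Metric.tendsto_nhds_nhds (α := C(K, E)) (β := C(K, E →L[ℝ] F)).1 hcγ c hcpos
  filter_upwards [Metric.ball_mem_nhds (0 : C(K, E)) hδ] with h hh
  rw [mem_ball_zero_iff] at hh
  rw [ContinuousMap.norm_le _ (by positivity)]
  intro s
  have key := (convex_ball (γ s) δ).norm_image_sub_le_of_norm_hasFDerivWithin_le' (𝕜 := ℝ)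
    (f := v) (f' := fderiv ℝ v) (φ := fderiv ℝ v (γ s)) (C := c) (x := γ s) (y := γ s + h s)
    (fun x _ => ((hv.differentiable one_ne_zero) x).hasFDerivAt.hasFDerivWithinAt)
    (fun x hx => by
      rw [Metric.mem_ball, dist_eq_norm] at hx
      -- The translate of γ by a constant passes through x at time s. This turns the estimate
      -- between curves into an estimate at the single point x.
      have hx' : dist (γ + ContinuousMap.const K (x - γ s)) γ < δ := by
        rw [dist_eq_norm, add_sub_cancel_left]
        exact (ContinuousMap.norm_lt_iff _ hδ).2 fun _ => by simpa using hx
      have := ContinuousMap.dist_apply_le_dist (f := superpose (fderiv ℝ v)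
        (hv.continuous_fderiv one_ne_zero) (γ + ContinuousMap.const K (x - γ s)))
        (g := superpose (fderiv ℝ v) (hv.continuous_fderiv one_ne_zero) γ) s
      have h2 := (this.trans_lt (hball hx')).le
      rw [dist_eq_norm] at h2
      simpa [superpose] using h2)
    (Metric.mem_ball_self hδ)
    (by rw [Metric.mem_ball, dist_eq_norm, add_sub_cancel_left]
        exact (h.norm_coe_le_norm s).trans_lt hh)
  rw [add_sub_cancel_left] at key
  refine le_trans (le_of_eq ?_) (key.trans (mul_le_mul_of_nonneg_left (h.norm_coe_le_norm s) hcpos.le))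
  rfl

/-- The derivative is superposition by v' followed by the fixed continuous linear map
`applyPointwise`, so smoothness follows by induction on the order. The target is generalised because
the induction passes from `F` to `E →L[ℝ] F`, which must live in the same universe. -/
theorem contDiff_superpose_nat (n : ℕ) : ∀ {F : Type u} [NormedAddCommGroup F] [NormedSpace ℝ F]
    {v : E → F} (hv : ContDiff ℝ ∞ v), ContDiff ℝ n (superpose (K := K) v hv.continuous) := by
  induction n with
  | zero =>
    intro F _ _ v hv
    rw [Nat.cast_zero, contDiff_zero]
    exact ContinuousMap.continuous_postcomp _
  | succ n ih =>
    intro F _ _ v hv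
    have h1 : ContDiff ℝ 1 v := hv.of_le (by exact_mod_cast le_top)
    have h2 : ContDiff ℝ ∞ (fderiv ℝ v) := hv.fderiv_right (m := ∞) (by simp)
    push_cast
    rw [contDiff_succ_iff_hasFDerivAt]
    exact ⟨fun γ => applyPointwise (superpose (fderiv ℝ v) h2.continuous γ),
      contDiff_applyPointwise.comp (ih h2), fun γ => hasFDerivAt_superpose h1 γ⟩

theorem contDiff_superpose {F : Type u} [NormedAddCommGroup F] [NormedSpace ℝ F]
    {v : E → F} (hv : ContDiff ℝ ∞ v) : ContDiff ℝ ∞ (superpose (K := K) v hv.continuous) :=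
  contDiff_infty.2 fun n => contDiff_superpose_nat n hv

end Nemytskii

/-! ### Smooth dependence of radial solutions of differential equations, by the implicit function
theorem -/

section Radial

universe u
variable {E Y : Type u} [NormedAddCommGroup E] [NormedSpace ℝ E]
  [NormedAddCommGroup Y] [NormedSpace ℝ Y]

/-- The interval on which integral curves are constructed. -/
abbrev TimeInterval : Type := Icc (-1 : ℝ) 1

theorem timeInterval_le : (-1 : ℝ) ≤ 1 := by norm_num

/-- Integration from `0` as an operator on continuous functions on `[-1, 1]`. -/
def primitive : C(TimeInterval, E) →L[ℝ] C(TimeInterval, E) :=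
  LinearMap.mkContinuous
    { toFun := fun η => ⟨fun s => ∫ τ in (0 : ℝ)..s, IccExtend timeInterval_le η τ, by
          have : Continuous (IccExtend timeInterval_le η) := η.continuous.Icc_extend'
          exact (intervalIntegral.continuous_primitive
            (fun a b => this.intervalIntegrable a b) 0).comp continuous_subtype_val⟩
      map_add' := fun η ζ => by
        ext s
        have h1 : Continuous (IccExtend timeInterval_le η) := η.continuous.Icc_extend'
        have h2 : Continuous (IccExtend timeInterval_le ζ) := ζ.continuous.Icc_extend'
        exact intervalIntegral.integral_add (h1.intervalIntegrable _ _) (h2.intervalIntegrable _ _)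
      map_smul' := fun c η => by
        ext s
        exact intervalIntegral.integral_smul c _ } 1
    (fun η => by
      rw [one_mul, ContinuousMap.norm_le _ (norm_nonneg _)]
      intro s
      refine (intervalIntegral.norm_integral_le_of_norm_le_const (C := ‖η‖) fun x _ =>
        η.norm_coe_le_norm _).trans ?_
      have : |(s : ℝ) - 0| ≤ 1 := by rw [sub_zero, abs_le]; exact s.2
      nlinarith [norm_nonneg η])

theorem primitive_apply (η : C(TimeInterval, E)) (s : TimeInterval) :
    primitive η s = ∫ τ in (0 : ℝ)..s, IccExtend timeInterval_le η τ := rfl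

/-- Curves with a constant first component. -/
def withConst : Y × C(TimeInterval, E) →L[ℝ] C(TimeInterval, Y × E) :=
  ((ContinuousLinearMap.inl ℝ Y E).compLeftContinuous ℝ TimeInterval ∘L
      ContinuousLinearMap.const ℝ TimeInterval).coprod
    ((ContinuousLinearMap.inr ℝ Y E).compLeftContinuous ℝ TimeInterval)

theorem withConst_apply (y : Y) (γ : C(TimeInterval, E)) (s : TimeInterval) :
    withConst (y, γ) s = (y, γ s) := by
  simp [withConst]

/-- The operator whose zeros `((y, x), γ)` are the solutions of `γ' = v(γ) y`, `γ(0) = x`. -/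
def radialOp (v : E → Y →L[ℝ] E) (hv : ContDiff ℝ ∞ v) (p : (Y × E) × C(TimeInterval, E)) :
    C(TimeInterval, E) :=
  p.2 - ContinuousLinearMap.const ℝ TimeInterval p.1.2 -
    primitive (superpose (fun z : Y × E => v z.2 z.1)
      (by have := hv.continuous; fun_prop) (withConst (p.1.1, p.2)))

theorem contDiff_radialOp (v : E → Y →L[ℝ] E) (hv : ContDiff ℝ ∞ v) :
    ContDiff ℝ ∞ (radialOp v hv) := by
  have h : ContDiff ℝ ∞ (fun z : Y × E => v z.2 z.1) :=
    (hv.comp contDiff_snd).clm_apply contDiff_fst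
  have h2 := contDiff_superpose (K := TimeInterval) h
  unfold radialOp
  have h3 : ContDiff ℝ ∞ fun p : (Y × E) × C(TimeInterval, E) => withConst (p.1.1, p.2) :=
    ContDiff.comp (g := fun p => withConst p)
      (ContinuousLinearMap.contDiff (E := Y × C(TimeInterval, E)) withConst) ((contDiff_fst.comp contDiff_fst).prodMk contDiff_snd)
  refine ContDiff.sub (ContDiff.sub contDiff_snd ?_) ?_
  · exact (ContinuousLinearMap.const ℝ TimeInterval (M := E)).contDiff.comp
      (contDiff_snd.comp contDiff_fst)
  · exact primitive.contDiff.comp (h2.comp h3)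

theorem radialOp_apply (v : E → Y →L[ℝ] E) (hv : ContDiff ℝ ∞ v) (y : Y) (x : E)
    (γ : C(TimeInterval, E)) (s : TimeInterval) :
    radialOp v hv ((y, x), γ) s =
      γ s - x - ∫ τ in (0 : ℝ)..s, v (γ (projIcc (-1) 1 timeInterval_le τ)) y := by
  simp only [radialOp, ContinuousMap.sub_apply, primitive_apply]
  congr 1
  apply intervalIntegral.integral_congr
  intro τ _
  simp only [IccExtend, Function.comp, superpose, ContinuousMap.comp_apply, withConst_apply]
  rfl

/-- The differential of the operator in the curve at `y = 0` is the identity. -/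
theorem fderiv_radialOp_inr (v : E → Y →L[ℝ] E) (hv : ContDiff ℝ ∞ v) (x : E)
    (γ : C(TimeInterval, E)) :
    fderiv ℝ (radialOp v hv) ((0, x), γ) ∘L ContinuousLinearMap.inr ℝ (Y × E) _ =
      ContinuousLinearMap.id ℝ _ := by
  have h1 : HasFDerivAt (radialOp v hv) (fderiv ℝ (radialOp v hv) ((0, x), γ)) ((0, x), γ) :=
    ((contDiff_radialOp v hv).differentiable (by simp) _).hasFDerivAt
  have h2 : HasFDerivAt (fun η : C(TimeInterval, E) => (((0 : Y), x), η))
      (ContinuousLinearMap.inr ℝ (Y × E) _) γ := hasFDerivAt_prodMk_right _ _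
  have h3 := h1.comp γ h2
  -- At y = 0 the integrand vanishes, so the operator is a translation in the curve.
  have h4 : (radialOp v hv ∘ fun η : C(TimeInterval, E) => (((0 : Y), x), η)) =
      fun η => η - ContinuousLinearMap.const ℝ TimeInterval x := by
    funext η
    ext s
    rw [Function.comp, radialOp_apply]
    simp
  rw [h4] at h3
  exact h3.unique ((hasFDerivAt_id γ).sub_const _)

theorem hasDerivAt_of_radialOp_eq_zero [CompleteSpace E] {v : E → Y →L[ℝ] E} (hv : ContDiff ℝ ∞ v) {y : Y} {x : E}
    {γ : C(TimeInterval, E)} (h : radialOp v hv ((y, x), γ) = 0) {s : ℝ} (hs : s ∈ Ioo (-1 : ℝ) 1) :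
    HasDerivAt (fun τ => γ (projIcc (-1) 1 timeInterval_le τ))
      (v (γ (projIcc (-1) 1 timeInterval_le s)) y) s := by
  have hcont : Continuous fun τ : ℝ => v (γ (projIcc (-1) 1 timeInterval_le τ)) y := by
    have := hv.continuous
    have h2 : Continuous fun τ : ℝ => γ (projIcc (-1) 1 timeInterval_le τ) :=
      γ.continuous.comp continuous_projIcc
    exact (this.comp h2).clm_apply continuous_const
  have h1 : HasDerivAt (fun t : ℝ => x + ∫ τ in (0 : ℝ)..t, v (γ (projIcc (-1) 1 timeInterval_le τ)) y)
      (v (γ (projIcc (-1) 1 timeInterval_le s)) y) s :=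
    (intervalIntegral.integral_hasDerivAt_right (hcont.intervalIntegrable _ _)
      (hcont.stronglyMeasurableAtFilter _ _) hcont.continuousAt).const_add x
  refine h1.congr_of_eventuallyEq ?_
  filter_upwards [isOpen_Ioo.mem_nhds hs] with t ht
  have h2 := congrArg (fun f : C(TimeInterval, E) => f (projIcc (-1) 1 timeInterval_le t)) h
  simp only [radialOp_apply, ContinuousMap.zero_apply] at h2
  rw [projIcc_of_mem (by norm_num) (Ioo_subset_Icc_self ht)] at h2 ⊢
  rw [sub_sub, sub_eq_zero] at h2
  exact h2

/-- Reparametrisation `γ(c ·)` of a curve, for `|c| ≤ 1`. -/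
def rescale (c : ℝ) (γ : C(TimeInterval, E)) : C(TimeInterval, E) :=
  ⟨fun s => γ (projIcc (-1) 1 timeInterval_le (c * s)),
    γ.continuous.comp ((continuous_projIcc (h := timeInterval_le)).comp
      (continuous_const.mul continuous_subtype_val))⟩

/-- The substitution τ ↦ cτ in the integral: slowing a solution down by c divides out as c • y. It
lets the time-one value, as a function of y, encode the whole solution curve. -/
theorem radialOp_rescale {v : E → Y →L[ℝ] E} (hv : ContDiff ℝ ∞ v) {y : Y} {x : E}
    {γ : C(TimeInterval, E)} (h : radialOp v hv ((y, x), γ) = 0) {c : ℝ} (hc : |c| ≤ 1) :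
    radialOp v hv ((c • y, x), rescale c γ) = 0 := by
  have key : ∀ s : ℝ, |s| ≤ 1 → c * s ∈ Icc (-1 : ℝ) 1 := fun s hs => by
    rw [mem_Icc, ← abs_le, abs_mul]
    exact mul_le_one₀ hc (abs_nonneg _) hs
  ext s
  rw [radialOp_apply, ContinuousMap.zero_apply]
  have h2 := congrArg (fun f : C(TimeInterval, E) => f ⟨c * s, key s (abs_le.2 s.2)⟩) h
  simp only [radialOp_apply, ContinuousMap.zero_apply] at h2
  have h3 : (∫ τ in (0 : ℝ)..s, v (rescale c γ (projIcc (-1) 1 timeInterval_le τ)) (c • y)) =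
      ∫ τ in (0 : ℝ)..(c * s), v (γ (projIcc (-1) 1 timeInterval_le τ)) y := by
    have := intervalIntegral.smul_integral_comp_mul_left (a := (0 : ℝ)) (b := s)
      (fun τ => v (γ (projIcc (-1) 1 timeInterval_le τ)) y) c
    rw [mul_zero] at this
    rw [← this, ← intervalIntegral.integral_smul]
    apply intervalIntegral.integral_congr
    intro τ hτ
    have hτ' : τ ∈ Icc (-1 : ℝ) 1 := by
      have h0 : (0 : ℝ) ∈ Icc (-1 : ℝ) 1 := by norm_num
      exact (uIcc_subset_Icc h0 s.2) hτ
    simp only [rescale, ContinuousMap.coe_mk, map_smul]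
    rw [projIcc_of_mem (by norm_num) hτ']
  rw [h3]
  have h4 : rescale c γ s = γ ⟨c * s, key s (abs_le.2 s.2)⟩ := by
    simp only [rescale, ContinuousMap.coe_mk]
    rw [projIcc_of_mem]
  rw [h4]
  exact h2

/-- Solutions of `γ' = v(γ) y`, `γ(0) = x` depend smoothly on `(y, x)`; `u (y, x)` is the value of
the solution at time `1`. -/
theorem exists_radial_solution [CompleteSpace E] [CompleteSpace Y] {v : E → Y →L[ℝ] E} (hv : ContDiff ℝ ∞ v) (x₀ : E) :
    ∃ δ > 0, ∃ u : Y × E → E, (∀ y ∈ Metric.ball (0 : Y) δ, ∀ x ∈ Metric.ball x₀ δ,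
      ContDiffAt ℝ ∞ u (y, x) ∧ u (0, x) = x ∧ ∀ s ∈ Ioo (-1 : ℝ) 1,
        HasDerivAt (fun τ : ℝ => u (τ • y, x)) (v (u (s • y, x)) y) s) := by
  set Ω := C(TimeInterval, E)
  set γ₀ : Ω := ContinuousLinearMap.const ℝ TimeInterval x₀
  set Φ := radialOp v hv
  have hΦ : ContDiff ℝ ∞ Φ := contDiff_radialOp v hv
  have hinv : (fderiv ℝ Φ (((0 : Y), x₀), γ₀) ∘L ContinuousLinearMap.inr ℝ (Y × E) Ω).IsInvertible := by
    rw [fderiv_radialOp_inr]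
    exact ContinuousLinearMap.isInvertible_equiv (f := ContinuousLinearEquiv.refl ℝ Ω)
  have hΦ₀ : Φ (((0 : Y), x₀), γ₀) = 0 := by
    ext s
    rw [radialOp_apply]
    simp [γ₀]
  have hcd : ContDiffAt ℝ ∞ Φ (((0 : Y), x₀), γ₀) := hΦ.contDiffAt
  have hne : (∞ : WithTop ℕ∞) ≠ 0 := by simp
  set ψ := hcd.implicitFunction hne hinv
  have e1 := hcd.eventually_apply_eq_iff_implicitFunction hne hinv
  rw [hΦ₀] at e1
  obtain ⟨δ₁, hδ₁, hu⟩ := Metric.eventually_nhds_iff_ball.1 e1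
  have hψ₀ : ψ ((0 : Y), x₀) = γ₀ := hcd.implicitFunction_apply_self hne hinv
  have hψc : ContinuousAt ψ ((0 : Y), x₀) := (hcd.contDiffAt_implicitFunction hne hinv).continuousAt
  have e2 : ∀ᶠ p in 𝓝 ((0 : Y), x₀), dist (ψ p) γ₀ < δ₁ := by
    have := Metric.tendsto_nhds.1 hψc δ₁ hδ₁
    rwa [hψ₀] at this
  -- the implicit function is smooth on a neighbourhood
  have e3 : ∀ᶠ p in 𝓝 ((0 : Y), x₀), ContDiffAt ℝ ∞ ψ p := by
    -- Invertible operators form an open set, so the implicit function theorem also applies at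
    -- nearby zeros of Φ.
    have hopen : ∀ᶠ q in 𝓝 (((0 : Y), x₀), γ₀),
        (fderiv ℝ Φ q ∘L ContinuousLinearMap.inr ℝ (Y × E) Ω).IsInvertible := by
      have hc : Continuous fun q => fderiv ℝ Φ q ∘L ContinuousLinearMap.inr ℝ (Y × E) Ω := by
        have := hΦ.continuous_fderiv (by simp)
        fun_prop
      obtain ⟨e, he⟩ := hinv
      have := (hc.continuousAt (x := (((0 : Y), x₀), γ₀))).eventually
        (he ▸ ContinuousLinearEquiv.nhds e)
      filter_upwards [this] with q hq
      obtain ⟨e', he'⟩ := hq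
      exact ⟨e', he'⟩
    have hcont2 : Tendsto (fun p => (p, ψ p)) (𝓝 ((0 : Y), x₀)) (𝓝 (((0 : Y), x₀), γ₀)) := by
      have := continuousAt_id.prodMk hψc
      rwa [ContinuousAt, hψ₀] at this
    have e4 := (hcont2.eventually hopen).and ((hcont2.eventually e1.eventually_nhds).and
      (eventually_eventually_nhds.2 (hcd.eventually_apply_implicitFunction hne hinv)))
    have e5 : ∀ᶠ p in 𝓝 ((0 : Y), x₀), ContinuousAt ψ p := by
      have hC1 : ContDiffAt ℝ 1 ψ ((0 : Y), x₀) :=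
        (hcd.contDiffAt_implicitFunction hne hinv).of_le (by exact_mod_cast le_top)
      exact (hC1.eventually (by simp)).mono fun p hp => hp.continuousAt
    filter_upwards [e4, e5] with p hp hpc
    have hcd' : ContDiffAt ℝ ∞ Φ (p, ψ p) := hΦ.contDiffAt
    -- The theorem is applied afresh at (p, ψ p). Local uniqueness identifies the new implicit
    -- function with ψ near p, and so transfers its smoothness to ψ.
    have h6 := hcd'.contDiffAt_implicitFunction hne hp.1
    refine h6.congr_of_eventuallyEq ?_
    have h7 := hcd'.eventually_apply_eq_iff_implicitFunction hne hp.1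
    have hcont3 : Tendsto (fun p => (p, ψ p)) (𝓝 p) (𝓝 (p, ψ p)) :=
      continuousAt_id.prodMk hpc
    filter_upwards [hcont3.eventually h7, hp.2.2] with q hq hq2
    have h8 : Φ (p, ψ p) = 0 := by
      have := hp.2.2.self_of_nhds
      rwa [hΦ₀] at this
    rw [hΦ₀] at hq2
    rw [h8] at hq
    exact (hq.1 hq2).symm
  have e6 : ∀ᶠ p in 𝓝 ((0 : Y), x₀), dist p ((0 : Y), x₀) < δ₁ := Metric.ball_mem_nhds _ hδ₁
  obtain ⟨δ, hδ, hall⟩ := Metric.eventually_nhds_iff_ball.1 (e2.and (e3.and e6))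
  have one_mem : (1 : ℝ) ∈ Icc (-1 : ℝ) 1 := by norm_num
  have hin : ∀ y ∈ Metric.ball (0 : Y) δ, ∀ x ∈ Metric.ball x₀ δ,
      (y, x) ∈ Metric.ball ((0 : Y), x₀) δ := fun y hy x hx => by
    rw [← ball_prod_same]; exact ⟨hy, hx⟩
  have hsol : ∀ y ∈ Metric.ball (0 : Y) δ, ∀ x ∈ Metric.ball x₀ δ, Φ ((y, x), ψ (y, x)) = 0 := by
    intro y hy x hx
    obtain ⟨a1, -, a3⟩ := hall _ (hin y hy x hx)
    exact (hu ((y, x), ψ (y, x)) (by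
      rw [← ball_prod_same]; exact ⟨a3, a1⟩)).2 rfl
  -- Uniqueness of the implicit function: the rescaled curve is a zero of Φ, and it stays in the
  -- δ₁-ball because rescaling only reparametrises values that are already close to x₀.
  have hresc : ∀ y ∈ Metric.ball (0 : Y) δ, ∀ x ∈ Metric.ball x₀ δ, ∀ c : ℝ, |c| ≤ 1 →
      ψ (c • y, x) = rescale c (ψ (y, x)) := by
    intro y hy x hx c hc
    have hcy : c • y ∈ Metric.ball (0 : Y) δ := by
      rw [mem_ball_zero_iff, norm_smul] at *
      exact (mul_le_of_le_one_left (norm_nonneg _) hc).trans_lt hy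
    obtain ⟨-, -, a3⟩ := hall _ (hin _ hcy x hx)
    obtain ⟨a1, -, -⟩ := hall _ (hin y hy x hx)
    refine (hu ((c • y, x), rescale c (ψ (y, x))) ?_).1 (radialOp_rescale hv (hsol y hy x hx) hc)
    rw [← ball_prod_same]
    refine ⟨a3, ?_⟩
    rw [Metric.mem_ball, ContinuousMap.dist_lt_iff hδ₁]
    intro s
    exact (ContinuousMap.dist_apply_le_dist (f := ψ (y, x)) (g := γ₀)
      (projIcc (-1) 1 timeInterval_le (c * s))).trans_lt a1
  refine ⟨δ, hδ, fun p => ψ p ⟨1, one_mem⟩, fun y hy x hx => ⟨?_, ?_, ?_⟩⟩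
  · have hev : ContDiff ℝ ∞ fun f : Ω => f ⟨1, one_mem⟩ :=
      ContinuousLinearMap.contDiff (E := C(TimeInterval, E))
        (ContinuousMap.evalCLM ℝ (⟨1, one_mem⟩ : TimeInterval))
    exact hev.contDiffAt.comp _ (hall _ (hin y hy x hx)).2.1
  · have h0 : (0 : Y) ∈ Metric.ball (0 : Y) δ := Metric.mem_ball_self hδ
    have := congrArg (fun f : Ω => f ⟨0, by norm_num⟩) (hsol 0 h0 x hx)
    simp only [Φ] at this
    rw [radialOp_apply] at this
    -- With c = 0 the solution for y = 0 equals its own constant reparametrisation, so its value at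
    -- time 1 is its value at time 0.
    have h1 := hresc 0 h0 x hx 0 (by simp)
    rw [smul_zero] at h1
    show ψ (0, x) ⟨1, one_mem⟩ = x
    rw [h1]
    simp only [rescale, ContinuousMap.coe_mk, zero_mul]
    rw [projIcc_of_mem (by norm_num) (by norm_num : (0 : ℝ) ∈ Icc (-1 : ℝ) 1)]
    rw [intervalIntegral.integral_same, sub_zero, ContinuousMap.zero_apply, sub_eq_zero] at this
    exact this
  · intro s hs
    have hval : ∀ τ ∈ Icc (-1 : ℝ) 1,
        ψ (τ • y, x) ⟨1, one_mem⟩ = ψ (y, x) (projIcc (-1) 1 timeInterval_le τ) := by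
      intro τ hτ
      rw [hresc y hy x hx τ (abs_le.2 hτ)]
      simp [rescale]
    have h1 := hasDerivAt_of_radialOp_eq_zero hv (hsol y hy x hx) hs
    rw [← hval s (Ioo_subset_Icc_self hs)] at h1
    refine h1.congr_of_eventuallyEq ?_
    filter_upwards [isOpen_Ioo.mem_nhds hs] with τ hτ
    exact hval τ (Ioo_subset_Icc_self hτ)

end Radial

/-! ### Local flows and linear total differential equations -/

/-- A smooth map on an open set agrees near each point with a globally smooth map. -/
theorem exists_contDiff_eventuallyEq {Z F : Type*} [NormedAddCommGroup Z] [NormedSpace ℝ Z]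
    [FiniteDimensional ℝ Z] [NormedAddCommGroup F] [NormedSpace ℝ F] {v : Z → F} {U : Set Z}
    (hU : IsOpen U) (hv : ContDiffOn ℝ ∞ v U) {x₀ : Z} (hx : x₀ ∈ U) :
    ∃ v' : Z → F, ContDiff ℝ ∞ v' ∧ v' =ᶠ[𝓝 x₀] v := by
  obtain ⟨r, hr, hball⟩ := Metric.isOpen_iff.1 hU x₀ hx
  -- The outer radius r/2 is smaller than r, so the cut-off vanishes near every point outside U.
  let χ : ContDiffBump x₀ := ⟨r / 3, r / 2, by positivity, by linarith⟩
  refine ⟨fun x => χ x • v x, contDiff_iff_contDiffAt.2 fun x => ?_, ?_⟩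
  · by_cases h : x ∈ U
    · exact χ.contDiff.contDiffAt.smul (hv.contDiffAt (hU.mem_nhds h))
    · have h0 : (fun x => χ x • v x) =ᶠ[𝓝 x] fun _ => 0 := by
        have hx' : x ∈ (Metric.closedBall x₀ (r / 2))ᶜ := fun hc =>
          h (hball (Metric.closedBall_subset_ball (by linarith) hc))
        filter_upwards [Metric.isClosed_closedBall.isOpen_compl.mem_nhds hx'] with y hy
        have : χ y = 0 := χ.zero_of_le_dist (by
          have : ¬ dist y x₀ ≤ r / 2 := hy
          exact (not_le.1 this).le)
        rw [this, zero_smul]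
      exact contDiffAt_const.congr_of_eventuallyEq h0
  · filter_upwards [χ.eventuallyEq_one] with y hy
    rw [hy]
    simp

/-- Local flows of smooth vector fields. -/
theorem exists_flow {E : Type} [NormedAddCommGroup E] [NormedSpace ℝ E] [FiniteDimensional ℝ E]
    {X : E → E} {U : Set E} (hU : IsOpen U) (hX : ContDiffOn ℝ ∞ X U) {x₀ : E} (hx : x₀ ∈ U) :
    ∃ δ > 0, ∃ fl : ℝ × E → E, ∀ r ∈ Metric.ball (0 : ℝ) δ, ∀ x ∈ Metric.ball x₀ δ,
      ContDiffAt ℝ ∞ fl (r, x) ∧ fl (0, x) = x ∧ fl (r, x) ∈ U ∧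
        HasDerivAt (fun τ => fl (τ, x)) (X (fl (r, x))) r := by
  have := FiniteDimensional.complete ℝ E
  obtain ⟨X', hX', he⟩ := exists_contDiff_eventuallyEq hU hX hx
  -- With parameter space ℝ and v(x) = (r ↦ r X'(x)), the time-one value for the parameter r is the
  -- flow of X' at time r.
  obtain ⟨δ, hδ, u, hu⟩ := exists_radial_solution (Y := ℝ)
    (v := fun x => ContinuousLinearMap.smulRight (1 : ℝ →L[ℝ] ℝ) (X' x))
    (contDiff_const.smulRight hX') x₀
  have hu0 := hu 0 (Metric.mem_ball_self hδ) x₀ (Metric.mem_ball_self hδ)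
  have hc : Tendsto u (𝓝 (0, x₀)) (𝓝 x₀) := by
    have := hu0.1.continuousAt
    rwa [ContinuousAt, hu0.2.1] at this
  obtain ⟨δ', hδ', h2⟩ := Metric.eventually_nhds_iff_ball.1
    (hc.eventually (he.and (hU.mem_nhds hx)))
  refine ⟨min (δ / 2) δ', by positivity, u, fun r hr x hx' => ?_⟩
  have hr1 : r ∈ Metric.ball (0 : ℝ) (δ / 2) := Metric.ball_subset_ball (min_le_left _ _) hr
  have hx1 : x ∈ Metric.ball x₀ δ :=
    Metric.ball_subset_ball ((min_le_left _ _).trans (by linarith)) hx'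
  have hr2 : r ∈ Metric.ball (0 : ℝ) δ := Metric.ball_subset_ball (by linarith) hr1
  have h3 := h2 (r, x) (by
    rw [← ball_prod_same]
    exact ⟨Metric.ball_subset_ball (min_le_right _ _) hr,
      Metric.ball_subset_ball (min_le_right _ _) hx'⟩)
  obtain ⟨a1, a2, -⟩ := hu r hr2 x hx1
  refine ⟨a1, a2, h3.2, ?_⟩
  -- All small times r are put on the single ray through δ/2, at parameter r/(δ/2), which lies in
  -- the open interval (−1, 1) where the derivative is known.
  have hmem : δ / 2 ∈ Metric.ball (0 : ℝ) δ := by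
    rw [mem_ball_zero_iff, Real.norm_eq_abs, abs_of_pos (by positivity)]; linarith
  obtain ⟨-, -, a3⟩ := hu (δ / 2) hmem x hx1
  have hs : r / (δ / 2) ∈ Ioo (-1 : ℝ) 1 := by
    rw [mem_ball_zero_iff, Real.norm_eq_abs, abs_lt] at hr1
    have : 0 < δ / 2 := by positivity
    constructor
    · rw [lt_div_iff₀ this]; linarith [hr1.1]
    · rw [div_lt_iff₀ this]; linarith [hr1.2]
  have a4 := (a3 _ hs).scomp r ((hasDerivAt_id r).div_const (δ / 2))
  have hne : δ / 2 ≠ 0 := by positivity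
  have e1 : (fun τ => u (τ, x)) = (fun τ : ℝ => u (τ • (δ / 2), x)) ∘ fun y => id y / (δ / 2) := by
    funext τ
    simp only [Function.comp, id, smul_eq_mul, div_mul_cancel₀ _ hne]
  rw [e1]
  convert a4 using 1
  simp only [smul_eq_mul, div_mul_cancel₀ _ hne, ContinuousLinearMap.smulRight_apply,
    one_apply_eq_self, smul_smul, one_div, inv_mul_cancel₀ hne, one_smul]
  exact h3.1.symm

/-- A linear total differential equation `du = A u` whose integrability condition holds has
a local solution with any prescribed value at a point. -/
theorem exists_linear_total_solution {B E : Type} [NormedAddCommGroup B] [NormedSpace ℝ B]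
    [FiniteDimensional ℝ B] [NormedAddCommGroup E] [NormedSpace ℝ E] [FiniteDimensional ℝ E]
    {A : B → B →L[ℝ] E →L[ℝ] E} {U : Set B} (hU : IsOpen U) (hA : ContDiffOn ℝ ∞ A U)
    (hint : ∀ b ∈ U, ∀ y w : B, ∀ e : E,
      fderiv ℝ A b w y e + A b y (A b w e) = fderiv ℝ A b y w e + A b w (A b y e))
    {b₀ : B} (hb : b₀ ∈ U) (e₀ : E) :
    ∃ u : B → E, u b₀ = e₀ ∧ ∀ᶠ b in 𝓝 b₀, ContDiffAt ℝ ∞ u b ∧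
      ∀ w, fderiv ℝ u b w = A b w (u b) := by
  have := FiniteDimensional.complete ℝ E
  have := FiniteDimensional.complete ℝ B
  obtain ⟨A', hA', he⟩ := exists_contDiff_eventuallyEq hU hA hb
  obtain ⟨ρ, hρ, hball⟩ := Metric.eventually_nhds_iff_ball.1
    (he.eventually_nhds.and (hU.mem_nhds hb))
  have hloc : ∀ b ∈ Metric.ball b₀ ρ, A' =ᶠ[𝓝 b] A := fun b hb => (hball b hb).1
  have hint' : ∀ b ∈ Metric.ball b₀ ρ, ∀ y w : B, ∀ e : E,
      fderiv ℝ A' b w y e + A' b y (A' b w e) = fderiv ℝ A' b y w e + A' b w (A' b y e) := by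
    intro b hb y w e
    rw [(hloc b hb).fderiv_eq, (hloc b hb).eq_of_nhds]
    exact hint b (hball b hb).2 y w e
  -- The equation is solved along rays by the augmented field (b, e) ↦ (y, A'(b) y e). Its first
  -- component is b₀ + s y, and its second is the candidate for u there.
  have hv : ContDiff ℝ ∞ fun z : B × E =>
      (ContinuousLinearMap.id ℝ B).prod ((A' z.1).flip z.2) := by
    have h1 : ContDiff ℝ ∞ fun z : B × E => (A' z.1).flip z.2 :=
      ContDiff.clm_apply (ContDiff.comp (g := fun L => ContinuousLinearMap.flipₗᵢ ℝ B E E L)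
        (LinearIsometryEquiv.contDiff _) (hA'.comp contDiff_fst)) contDiff_snd
    have h2 : (fun z : B × E => (ContinuousLinearMap.id ℝ B).prod ((A' z.1).flip z.2)) =
        fun z => ContinuousLinearMap.inl ℝ B E + ContinuousLinearMap.inr ℝ B E ∘L
          ((A' z.1).flip z.2) := by
      funext z
      ext <;> simp
    rw [h2]
    exact contDiff_const.add (contDiff_const.clm_comp h1)
  obtain ⟨δ, hδ, u₂, hu₂⟩ := exists_radial_solution hv (b₀, e₀)
  have hself : (b₀, e₀) ∈ Metric.ball (b₀, e₀) δ := Metric.mem_ball_self hδ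
  set U₂ : B → B × E := fun y => u₂ (y, (b₀, e₀))
  have hU0 : U₂ 0 = (b₀, e₀) := (hu₂ 0 (Metric.mem_ball_self hδ) _ hself).2.1
  have hUs : ∀ y ∈ Metric.ball (0 : B) δ, ContDiffAt ℝ ∞ U₂ y := fun y hy =>
    (hu₂ y hy _ hself).1.comp y (contDiffAt_id.prodMk contDiffAt_const)
  -- the first component is `b₀ + y`
  have hfst : ∀ y ∈ Metric.ball (0 : B) δ, ∀ s ∈ Ioo (-1 : ℝ) 1, (U₂ (s • y)).1 = b₀ + s • y := by
    intro y hy s hs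
    have hd : ∀ s ∈ Ioo (-1 : ℝ) 1,
        HasDerivAt (fun τ : ℝ => (U₂ (τ • y)).1 - τ • y) 0 s := fun s hs => by
      have h1 := ((hu₂ y hy _ hself).2.2 s hs)
      have h2 := (ContinuousLinearMap.fst ℝ B E).hasFDerivAt.comp_hasDerivAt s h1
      have h3 := h2.sub ((hasDerivAt_id s).smul_const y)
      have h4 : ContinuousLinearMap.fst ℝ B E (((ContinuousLinearMap.id ℝ B).prod
          ((A' (u₂ (s • y, (b₀, e₀))).1).flip (u₂ (s • y, (b₀, e₀))).2)) y) - (1 : ℝ) • y = 0 := by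
        rw [one_smul, sub_eq_zero]
        rfl
      rw [h4] at h3
      exact h3
    have hconst := isOpen_Ioo.is_const_of_deriv_eq_zero isPreconnected_Ioo
      (f := fun τ : ℝ => (U₂ (τ • y)).1 - τ • y)
      (fun s hs => (hd s hs).differentiableAt.differentiableWithinAt)
      (fun s hs => (hd s hs).deriv) hs (by norm_num : (0 : ℝ) ∈ Ioo (-1 : ℝ) 1)
    simp only [zero_smul, hU0, sub_zero] at hconst
    rw [sub_eq_iff_eq_add] at hconst
    exact hconst
  set u : B → E := fun b => (U₂ (b - b₀)).2
  set R := min (δ / 2) ρ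
  have hR : 0 < R := by positivity
  have hmemδ : ∀ b ∈ Metric.ball b₀ R, b - b₀ ∈ Metric.ball (0 : B) (δ / 2) := fun b hb => by
    rw [mem_ball_zero_iff, ← dist_eq_norm]
    exact hb.trans_le (min_le_left _ _)
  have hus : ∀ b ∈ Metric.ball b₀ R, ContDiffAt ℝ ∞ u b := fun b hb =>
    contDiffAt_snd.comp b (ContDiffAt.comp (f := fun b => b - b₀) b
      (hUs _ (Metric.ball_subset_ball (by linarith) (hmemδ b hb)))
      (contDiffAt_id.sub contDiffAt_const))
  -- The equation holds in the radial direction by construction. The direction is doubled and read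
  -- at time 1/2 because derivatives are available only at interior times; this is why R ≤ δ/2.
  have hrad : ∀ b ∈ Metric.ball b₀ R, fderiv ℝ u b (b - b₀) = A' b (b - b₀) (u b) := by
    intro b hb
    have hy : (2 : ℝ) • (b - b₀) ∈ Metric.ball (0 : B) δ := by
      have := hmemδ b hb
      rw [mem_ball_zero_iff] at this ⊢
      rw [norm_smul, Real.norm_eq_abs, abs_of_pos (by norm_num)]
      linarith
    have hs : (1 / 2 : ℝ) ∈ Ioo (-1 : ℝ) 1 := by norm_num
    have h1 := (hu₂ _ hy _ hself).2.2 _ hs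
    have h2 := (ContinuousLinearMap.snd ℝ B E).hasFDerivAt.comp_hasDerivAt _ h1
    have e1 : (1 / 2 : ℝ) • (2 : ℝ) • (b - b₀) = b - b₀ := by
      rw [smul_smul]; norm_num
    have hf := hfst _ hy _ hs
    rw [e1] at hf
    have h3 : HasDerivAt (fun τ : ℝ => u (b₀ + τ • (2 : ℝ) • (b - b₀)))
        (fderiv ℝ u b ((2 : ℝ) • (b - b₀))) (1 / 2) := by
      have h4 : HasFDerivAt u (fderiv ℝ u b) (b₀ + (1 / 2 : ℝ) • (2 : ℝ) • (b - b₀)) := by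
        rw [e1, add_sub_cancel]
        exact ((hus b hb).differentiableAt (by simp)).hasFDerivAt
      have h5 := h4.comp_hasDerivAt _
        (((hasDerivAt_id (1 / 2 : ℝ)).smul_const ((2 : ℝ) • (b - b₀))).const_add b₀)
      rw [one_smul] at h5
      exact h5
    have h6 : (fun τ : ℝ => u (b₀ + τ • (2 : ℝ) • (b - b₀))) =
        (ContinuousLinearMap.snd ℝ B E) ∘ fun τ : ℝ => u₂ (τ • (2 : ℝ) • (b - b₀), (b₀, e₀)) := by
      funext τ
      simp [u, U₂]
    rw [h6] at h3
    have h7 := h3.unique h2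
    rw [e1] at h7
    change _ = A' (U₂ (b - b₀)).1 ((2 : ℝ) • (b - b₀)) (U₂ (b - b₀)).2 at h7
    rw [hf, add_sub_cancel, map_smul, map_smul, smul_apply] at h7
    exact smul_right_injective E (two_ne_zero (α := ℝ)) h7
  refine ⟨u, by simp only [u, sub_self, hU0], ?_⟩
  filter_upwards [Metric.ball_mem_nhds b₀ hR] with b hb
  refine ⟨hus b hb, fun w => ?_⟩
  have hA'eq : A b = A' b := by
    have := Metric.ball_subset_ball (min_le_right (δ / 2) ρ) hb
    exact (hloc b this).eq_of_nhds.symm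
  rw [hA'eq]
  set y := b - b₀
  have hseg : ∀ s ∈ Icc (0 : ℝ) 1, b₀ + s • y ∈ Metric.ball b₀ R := fun s hs => by
    rw [Metric.mem_ball, dist_eq_norm, add_sub_cancel_left, norm_smul, Real.norm_eq_abs,
      abs_of_nonneg hs.1]
    have : ‖y‖ < R := by rwa [← dist_eq_norm]
    nlinarith [norm_nonneg y, hs.2]
  -- the defect of the equation
  set D : B → E := fun b => fderiv ℝ u b w - A' b w (u b)
  have hdu : ∀ c ∈ Metric.ball b₀ R, HasFDerivAt (fderiv ℝ u) (fderiv ℝ (fderiv ℝ u) c) c :=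
    fun c hc => (((hus c hc).fderiv_right (m := 1) (WithTop.coe_le_coe.2 le_top)).differentiableAt
      (by simp)).hasFDerivAt
  have hu1 : ∀ c ∈ Metric.ball b₀ R, HasFDerivAt u (fderiv ℝ u c) c :=
    fun c hc => ((hus c hc).differentiableAt (by simp)).hasFDerivAt
  have hA1 : ∀ c, HasFDerivAt A' (fderiv ℝ A' c) c :=
    fun c => (hA'.differentiable (by simp) c).hasFDerivAt
  -- Differentiating the radial equation in the direction w, then using symmetry of the second
  -- derivative of u and the integrability condition, gives a homogeneous linear equation along the
  -- ray for s times the defect.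
  have hD : ∀ s ∈ Icc (0 : ℝ) 1, HasDerivAt (fun s : ℝ => s • D (b₀ + s • y))
      (A' (b₀ + s • y) y (s • D (b₀ + s • y))) s := by
    intro s hs
    set c := b₀ + s • y
    have hc := hseg s hs
    have hline : HasDerivAt (fun s : ℝ => b₀ + s • y) y s := by
      simpa using ((hasDerivAt_id s).smul_const y).const_add b₀
    have h1 : HasFDerivAt D _ c := ((hdu c hc).clm_apply (hasFDerivAt_const w c)).sub
      (((hA1 c).clm_apply (hasFDerivAt_const w c)).clm_apply (hu1 c hc))
    have h2 := (hasDerivAt_id s).smul (h1.comp_hasDerivAt s hline)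
    -- the differentiated radial equation
    have h3 : HasFDerivAt (fun c => fderiv ℝ u c (c - b₀) - A' c (c - b₀) (u c)) _ c :=
      ((hdu c hc).clm_apply ((hasFDerivAt_id c).sub_const b₀)).sub
      (((hA1 c).clm_apply ((hasFDerivAt_id c).sub_const b₀)).clm_apply (hu1 c hc))
    have h4 : (fun c => fderiv ℝ u c (c - b₀) - A' c (c - b₀) (u c)) =ᶠ[𝓝 c] fun _ => 0 := by
      filter_upwards [Metric.isOpen_ball.mem_nhds hc] with d hd
      rw [hrad d hd, sub_self]
    have h5 := congrArg (fun L : B →L[ℝ] E => L w)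
      (h3.unique ((hasFDerivAt_const (0 : E) c).congr_of_eventuallyEq h4))
    have h6 := hrad c hc
    have hsy : c - b₀ = s • y := add_sub_cancel_left _ _
    have h7 : fderiv ℝ (fderiv ℝ u) c w y = fderiv ℝ (fderiv ℝ u) c y w :=
      ((hus c hc).isSymmSndFDerivAt (by
        rw [minSmoothness_of_isRCLikeNormedField]; exact WithTop.coe_le_coe.2 le_top)) w y
    have h8 := hint' c (Metric.ball_subset_ball (min_le_right _ _) hc) y w (u c)
    simp only [id] at h5
    rw [hsy] at h5 h6
    simp only [map_smul, smul_apply, add_apply,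
      sub_apply, ContinuousLinearMap.comp_apply,
      ContinuousLinearMap.flip_apply, zero_apply,
      ContinuousLinearMap.id_apply] at h5 h6
    have h2' : HasDerivAt (fun s : ℝ => s • D (b₀ + s • y)) _ s := h2
    refine h2'.congr_deriv ?_
    simp only [add_apply,
      sub_apply, ContinuousLinearMap.comp_apply,
      ContinuousLinearMap.flip_apply, zero_apply, map_zero, zero_add,
      id, one_smul, Function.comp]
    change _ = A' c y (s • (fderiv ℝ u c w - A' c w (u c)))
    rw [map_smul]
    change _ + (fderiv ℝ u c w - A' c w (u c)) = _
    have h9 := congrArg (A' c w) h6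
    simp only [map_smul] at h9
    have h10 := congrArg (fun e => s • e) h8
    simp only [smul_add] at h10
    rw [h7] at h5
    simp only [map_sub, smul_sub, smul_add]
    linear_combination (norm := module) h5 + h10 - h9
  obtain ⟨K, hK⟩ := (isCompact_Icc (a := (0 : ℝ)) (b := 1)).exists_bound_of_continuousOn
    (f := fun s : ℝ => A' (b₀ + s • y) y) (by
      have := hA'.continuous
      have h2 : Continuous fun s : ℝ => b₀ + s • y := by fun_prop
      exact ((this.comp h2).clm_apply continuous_const).continuousOn)
  -- Grönwall: a solution of a linear equation that starts at zero is zero. The factor s supplies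
  -- the zero initial value without any knowledge of D at b₀.
  have hzero := eq_zero_of_abs_deriv_le_mul_abs_self_of_eq_zero_right (K := K)
    (f := fun s : ℝ => s • D (b₀ + s • y)) (a := 0) (b := 1)
    (fun s hs => (hD s hs).continuousAt.continuousWithinAt)
    (fun s hs => (hD s (Ico_subset_Icc_self hs)).hasDerivWithinAt) (by simp)
    (fun s hs => (ContinuousLinearMap.le_opNorm _ _).trans (mul_le_mul_of_nonneg_right
      (hK s (Ico_subset_Icc_self hs)) (norm_nonneg _))) 1 (by norm_num)
  simp only [one_smul, y, add_sub_cancel] at hzero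
  exact sub_eq_zero.1 hzero

/-! ### Calculus with partial derivatives -/

section Partial

variable {n : ℕ} {F F' : EuclideanSpace ℝ (Fin n) → ℝ} {x : EuclideanSpace ℝ (Fin n)}

theorem pd_congr (h : F =ᶠ[𝓝 x] F') (i : Fin n) : pd i F x = pd i F' x := by
  rw [pd, pd, h.fderiv_eq]

@[simp] theorem pd_const (c : ℝ) (i : Fin n) : pd i (fun _ => c) x = 0 := by
  simp [pd]

theorem pd_add (hF : DifferentiableAt ℝ F x) (hF' : DifferentiableAt ℝ F' x) (i : Fin n) :
    pd i (fun y => F y + F' y) x = pd i F x + pd i F' x := by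
  simp [pd, fderiv_fun_add hF hF']

theorem pd_sub (hF : DifferentiableAt ℝ F x) (hF' : DifferentiableAt ℝ F' x) (i : Fin n) :
    pd i (fun y => F y - F' y) x = pd i F x - pd i F' x := by
  simp [pd, fderiv_fun_sub hF hF']

theorem pd_mul (hF : DifferentiableAt ℝ F x) (hF' : DifferentiableAt ℝ F' x) (i : Fin n) :
    pd i (fun y => F y * F' y) x = pd i F x * F' x + F x * pd i F' x := by
  simp [pd, fderiv_fun_mul hF hF']
  ring

theorem pd_const_mul (hF : DifferentiableAt ℝ F x) (c : ℝ) (i : Fin n) :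
    pd i (fun y => c * F y) x = c * pd i F x := by
  simp [pd, fderiv_const_mul hF]

theorem pd_sum {ι : Type*} {s : Finset ι} {A : ι → EuclideanSpace ℝ (Fin n) → ℝ}
    (h : ∀ a ∈ s, DifferentiableAt ℝ (A a) x) (i : Fin n) :
    pd i (fun y => ∑ a ∈ s, A a y) x = ∑ a ∈ s, pd i (A a) x := by
  simp [pd, fderiv_fun_sum h]

theorem contDiffAt_pd (hF : ContDiffAt ℝ ∞ F x) (i : Fin n) : ContDiffAt ℝ ∞ (pd i F) x :=
  (hF.fderiv_right (m := ∞) (by simp)).clm_apply contDiffAt_const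

theorem _root_.ContDiffAt.diff {E E' : Type*} [NormedAddCommGroup E] [NormedSpace ℝ E]
    [NormedAddCommGroup E'] [NormedSpace ℝ E'] {f : E → E'} {a : E} (hf : ContDiffAt ℝ ∞ f a) :
    DifferentiableAt ℝ f a :=
  hf.differentiableAt (by simp)

theorem pd_comm (hF : ContDiffAt ℝ ∞ F x) (i j : Fin n) : pd i (pd j F) x = pd j (pd i F) x := by
  have h1 : DifferentiableAt ℝ (fderiv ℝ F) x :=
    ((hF.fderiv_right (m := ∞) (by simp)).differentiableAt (by simp))
  have h2 : ∀ v w, fderiv ℝ (fderiv ℝ F) x v w = fderiv ℝ (fderiv ℝ F) x w v :=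
    (hF.isSymmSndFDerivAt (by
      rw [minSmoothness_of_isRCLikeNormedField]; exact WithTop.coe_le_coe.2 le_top))
  have h3 : ∀ i j : Fin n, pd i (pd j F) x =
      fderiv ℝ (fderiv ℝ F) x (EuclideanSpace.single i 1) (EuclideanSpace.single j 1) := by
    intro i j
    have := (h1.hasFDerivAt.clm_apply (hasFDerivAt_const (EuclideanSpace.single j (1 : ℝ)) x)).fderiv
    unfold pd
    rw [this]
    simp
  rw [h3, h3, h2]

theorem fderiv_apply_eq_sum (v : EuclideanSpace ℝ (Fin n)) :
    fderiv ℝ F x v = ∑ i, v i * pd i F x := by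
  have hv : v = ∑ i, v i • EuclideanSpace.single i (1 : ℝ) := by
    ext j
    simp [Finset.sum_apply, Pi.single_apply]
  conv_lhs => rw [hv]
  rw [map_sum]
  simp [pd]

theorem contDiffAt_coord {m : ℕ} {φ : EuclideanSpace ℝ (Fin m) → EuclideanSpace ℝ (Fin n)}
    {y : EuclideanSpace ℝ (Fin m)} (hφ : ContDiffAt ℝ ∞ φ y) (a : Fin n) :
    ContDiffAt ℝ ∞ (fun z => φ z a) y :=
  (contDiffAt_euclidean.1 hφ) a

theorem fderiv_coord {m : ℕ} {φ : EuclideanSpace ℝ (Fin m) → EuclideanSpace ℝ (Fin n)}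
    {y : EuclideanSpace ℝ (Fin m)} (hφ : DifferentiableAt ℝ φ y) (a : Fin n)
    (v : EuclideanSpace ℝ (Fin m)) : fderiv ℝ (fun z => φ z a) y v = (fderiv ℝ φ y v) a := by
  have h := ((EuclideanSpace.proj (𝕜 := ℝ) a :
    EuclideanSpace ℝ (Fin n) →L[ℝ] ℝ).hasFDerivAt.comp y hφ.hasFDerivAt).fderiv
  have h2 : (⇑(EuclideanSpace.proj (𝕜 := ℝ) a : EuclideanSpace ℝ (Fin n) →L[ℝ] ℝ) ∘ φ) =
    fun z => φ z a := rfl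
  rw [h2] at h
  rw [h]
  rfl

/-- The chain rule. -/
theorem pd_comp {m : ℕ} {φ : EuclideanSpace ℝ (Fin m) → EuclideanSpace ℝ (Fin n)}
    {y : EuclideanSpace ℝ (Fin m)} (hF : DifferentiableAt ℝ F (φ y)) (hφ : DifferentiableAt ℝ φ y)
    (i : Fin m) :
    pd i (fun z => F (φ z)) y = ∑ a, pd a F (φ y) * pd i (fun z => φ z a) y := by
  have h := (hF.hasFDerivAt.comp y hφ.hasFDerivAt).fderiv
  have h2 : (F ∘ φ) = fun z => F (φ z) := rfl
  rw [h2] at h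
  rw [pd, h, ContinuousLinearMap.comp_apply, fderiv_apply_eq_sum]
  refine Finset.sum_congr rfl fun a _ => ?_
  change _ = _ * fderiv ℝ (fun z => φ z a) y _
  rw [fderiv_coord hφ, mul_comm]

end Partial

/-! ### Pseudo-Riemannian metrics near a point -/

section Metric

variable {n : ℕ} {G G' : EuclideanSpace ℝ (Fin n) → Matrix (Fin n) (Fin n) ℝ}
  {x : EuclideanSpace ℝ (Fin n)}

/-- `G` is a smooth pseudo-Riemannian metric near `x`. -/
structure IsMetricAt (G : EuclideanSpace ℝ (Fin n) → Matrix (Fin n) (Fin n) ℝ)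
    (x : EuclideanSpace ℝ (Fin n)) : Prop where
  smooth : ∀ i j, ContDiffAt ℝ ∞ (fun y => G y i j) x
  symm : ∀ᶠ y in 𝓝 x, (G y).IsSymm
  nondeg : (G x).det ≠ 0

theorem IsMetricOn.isMetricAt {V : Set (EuclideanSpace ℝ (Fin n))} (h : IsMetricOn G V)
    (hV : IsOpen V) (hx : x ∈ V) : IsMetricAt G x :=
  ⟨fun i j => (h.smooth i j).contDiffAt (hV.mem_nhds hx),
    (hV.eventually_mem hx).mono fun _ hy => h.symm _ hy, h.nondeg x hx⟩

theorem contDiffAt_det {m : ℕ} {A : EuclideanSpace ℝ (Fin n) → Matrix (Fin m) (Fin m) ℝ}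
    (h : ∀ i j, ContDiffAt ℝ ∞ (fun y => A y i j) x) :
    ContDiffAt ℝ ∞ (fun y => (A y).det) x := by
  simp only [Matrix.det_apply]
  exact ContDiffAt.sum fun σ _ => (contDiffAt_prod fun i _ => h _ _).const_smul _

namespace IsMetricAt

theorem inv_smooth (h : IsMetricAt G x) (i j : Fin n) :
    ContDiffAt ℝ ∞ (fun y => (G y)⁻¹ i j) x := by
  have h1 : ContDiffAt ℝ ∞ (fun y => ((G y).det)⁻¹ * (G y).adjugate i j) x := by
    refine ((contDiffAt_det h.smooth).inv h.nondeg).mul ?_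
    simp only [Matrix.adjugate_apply]
    refine contDiffAt_det fun a b => ?_
    by_cases hab : a = j
    · subst hab
      simp only [Matrix.updateRow_self]
      exact contDiffAt_const
    · simp only [Matrix.updateRow_ne hab]
      exact h.smooth a b
  refine h1.congr_of_eventuallyEq (Eventually.of_forall fun _ => ?_)
  simp [Matrix.inv_def]

theorem symm_apply (h : IsMetricAt G x) (i j : Fin n) : G x i j = G x j i :=
  (h.symm.self_of_nhds.apply j i)

theorem symm_eventually (h : IsMetricAt G x) (i j : Fin n) :
    (fun y => G y i j) =ᶠ[𝓝 x] fun y => G y j i :=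
  h.symm.mono fun _ hy => hy.apply j i

theorem pd_symm (h : IsMetricAt G x) (k i j : Fin n) :
    pd k (fun y => G y i j) x = pd k (fun y => G y j i) x :=
  pd_congr (h.symm_eventually i j) k

theorem inv_symm (h : IsMetricAt G x) (i j : Fin n) : (G x)⁻¹ i j = (G x)⁻¹ j i := by
  have : ((G x)⁻¹).IsSymm := by
    rw [Matrix.IsSymm, Matrix.transpose_nonsing_inv, h.symm.self_of_nhds.eq]
  exact this.apply j i

theorem sum_inv_mul (h : IsMetricAt G x) (i j : Fin n) :
    ∑ k, (G x)⁻¹ i k * G x k j = if i = j then 1 else 0 := by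
  have := Matrix.nonsing_inv_mul (G x) (isUnit_iff_ne_zero.2 h.nondeg)
  have h2 := congrFun (congrFun this i) j
  rw [Matrix.mul_apply, Matrix.one_apply] at h2
  exact h2

theorem sum_mul_inv (h : IsMetricAt G x) (i j : Fin n) :
    ∑ k, G x i k * (G x)⁻¹ k j = if i = j then 1 else 0 := by
  have := Matrix.mul_nonsing_inv (G x) (isUnit_iff_ne_zero.2 h.nondeg)
  have h2 := congrFun (congrFun this i) j
  rw [Matrix.mul_apply, Matrix.one_apply] at h2
  exact h2

end IsMetricAt

/-- The Christoffel symbol of the first kind `Γ_ij,k = g(∇_{∂_i} ∂_j, ∂_k)`. -/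
def christoffelLower (G : EuclideanSpace ℝ (Fin n) → Matrix (Fin n) (Fin n) ℝ)
    (i j k : Fin n) (x : EuclideanSpace ℝ (Fin n)) : ℝ :=
  (1 / 2) * (pd i (fun y => G y j k) x + pd j (fun y => G y i k) x - pd k (fun y => G y i j) x)

theorem christoffel_eq (i j k : Fin n) :
    christoffel G i j k x = ∑ l, (G x)⁻¹ k l * christoffelLower G i j l x := by
  simp only [christoffel, christoffelLower, Finset.mul_sum]
  exact Finset.sum_congr rfl fun l _ => by ring

namespace IsMetricAt

theorem christoffel_symm (h : IsMetricAt G x) (i j k : Fin n) :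
    christoffel G i j k x = christoffel G j i k x := by
  simp only [christoffel]
  congr 1
  refine Finset.sum_congr rfl fun l _ => ?_
  rw [h.pd_symm l i j]
  ring

theorem sum_christoffel_mul (h : IsMetricAt G x) (i j l : Fin n) :
    ∑ k, christoffel G i j k x * G x k l = christoffelLower G i j l x := by
  simp only [christoffel_eq, Finset.sum_mul]
  rw [Finset.sum_comm]
  have : ∀ m, ∑ k, (G x)⁻¹ k m * christoffelLower G i j m x * G x k l =
      (if m = l then 1 else 0) * christoffelLower G i j m x := fun m => by
    rw [← h.sum_inv_mul m l, Finset.sum_mul]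
    exact Finset.sum_congr rfl fun k _ => by rw [h.inv_symm k m]; ring
  simp [this]

theorem christoffelLower_smooth (h : IsMetricAt G x) (i j k : Fin n) :
    ContDiffAt ℝ ∞ (christoffelLower G i j k) x :=
  contDiffAt_const.mul (((contDiffAt_pd (h.smooth _ _) _).add (contDiffAt_pd (h.smooth _ _) _)).sub
    (contDiffAt_pd (h.smooth _ _) _))

theorem christoffel_smooth (h : IsMetricAt G x) (i j k : Fin n) :
    ContDiffAt ℝ ∞ (christoffel G i j k) x :=
  contDiffAt_const.mul (ContDiffAt.sum fun l _ => (h.inv_smooth k l).mul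
    (((contDiffAt_pd (h.smooth _ _) _).add (contDiffAt_pd (h.smooth _ _) _)).sub
    (contDiffAt_pd (h.smooth _ _) _)))

theorem curvOp_smooth (h : IsMetricAt G x) (i j k l : Fin n) :
    ContDiffAt ℝ ∞ (curvOp G i j k l) x := by
  unfold curvOp
  exact ((contDiffAt_pd (h.christoffel_smooth _ _ _) _).sub
    (contDiffAt_pd (h.christoffel_smooth _ _ _) _)).add (ContDiffAt.sum fun m _ =>
      ((h.christoffel_smooth _ _ _).mul (h.christoffel_smooth _ _ _)).sub
      ((h.christoffel_smooth _ _ _).mul (h.christoffel_smooth _ _ _)))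

theorem riemann_smooth (h : IsMetricAt G x) (i j k l : Fin n) :
    ContDiffAt ℝ ∞ (riemann G i j k l) x :=
  ContDiffAt.sum fun _ _ => (h.curvOp_smooth _ _ _ _).mul (h.smooth _ _)

theorem ricci_smooth (h : IsMetricAt G x) (i j : Fin n) : ContDiffAt ℝ ∞ (ricci G i j) x :=
  ContDiffAt.sum fun _ _ => h.curvOp_smooth _ _ _ _

theorem scalar_smooth (h : IsMetricAt G x) : ContDiffAt ℝ ∞ (scalar G) x :=
  ContDiffAt.sum fun _ _ => ContDiffAt.sum fun _ _ => (h.inv_smooth _ _).mul (h.ricci_smooth _ _)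

theorem weyl_smooth (h : IsMetricAt G x) (i j k l : Fin n) : ContDiffAt ℝ ∞ (weyl G i j k l) x := by
  unfold weyl
  have hg := h.smooth
  have hr := h.ricci_smooth
  exact ((h.riemann_smooth i j k l).add ((h.scalar_smooth.div_const _).mul
    (((hg _ _).mul (hg _ _)).sub ((hg _ _).mul (hg _ _))))).add (contDiffAt_const.mul
    (((((hr _ _).mul (hg _ _)).sub ((hr _ _).mul (hg _ _))).add ((hr _ _).mul (hg _ _))).sub
      ((hr _ _).mul (hg _ _))))

theorem hessian_smooth (h : IsMetricAt G x) {F : EuclideanSpace ℝ (Fin n) → ℝ}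
    (hF : ContDiffAt ℝ ∞ F x) (i j : Fin n) : ContDiffAt ℝ ∞ (hessian G F i j) x := by
  unfold hessian
  exact (contDiffAt_pd (contDiffAt_pd hF _) _).sub (ContDiffAt.sum fun k _ =>
    (h.christoffel_smooth _ _ _).mul (contDiffAt_pd hF _))

theorem gradNormSq_smooth (h : IsMetricAt G x) {F : EuclideanSpace ℝ (Fin n) → ℝ}
    (hF : ContDiffAt ℝ ∞ F x) : ContDiffAt ℝ ∞ (gradNormSq G F) x :=
  ContDiffAt.sum fun _ _ => ContDiffAt.sum fun _ _ => ((h.inv_smooth _ _).mul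
    (contDiffAt_pd hF _)).mul (contDiffAt_pd hF _)

/-- The Levi-Civita connection is compatible with the metric. -/
theorem pd_metric (h : IsMetricAt G x) (k i j : Fin n) :
    pd k (fun y => G y i j) x = christoffelLower G k i j x + christoffelLower G k j i x := by
  simp only [christoffelLower]
  rw [h.pd_symm i k j, h.pd_symm j k i, h.pd_symm i j k, h.pd_symm j i k, h.pd_symm k j i]
  ring

end IsMetricAt

theorem curvOp_antisymm (i j k l : Fin n) : curvOp G i j k l x = -curvOp G j i k l x := by
  simp only [curvOp]
  rw [neg_add, ← Finset.sum_neg_distrib]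
  congr 1
  · ring
  · exact Finset.sum_congr rfl fun m _ => by ring

theorem riemann_antisymm_left (i j k l : Fin n) :
    riemann G i j k l x = -riemann G j i k l x := by
  simp only [riemann]
  rw [← Finset.sum_neg_distrib]
  exact Finset.sum_congr rfl fun m _ => by rw [curvOp_antisymm]; ring

/-! The curvature only depends on the germ of the metric. -/

theorem christoffel_congr (h : G =ᶠ[𝓝 x] G') (i j k : Fin n) :
    christoffel G i j k =ᶠ[𝓝 x] christoffel G' i j k := by
  filter_upwards [h.eventuallyEq_nhds] with y hy
  have h1 : ∀ i j, (fun z => G z i j) =ᶠ[𝓝 y] fun z => G' z i j := fun i j =>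
    hy.mono fun z hz => by simp only [hz]
  simp only [christoffel, hy.eq_of_nhds]
  congr 1
  refine Finset.sum_congr rfl fun l _ => ?_
  rw [pd_congr (h1 _ _), pd_congr (h1 _ _), pd_congr (h1 _ _)]

theorem curvOp_congr (h : G =ᶠ[𝓝 x] G') (i j k l : Fin n) :
    curvOp G i j k l x = curvOp G' i j k l x := by
  have hc := fun i j k => (christoffel_congr h i j k)
  simp only [curvOp, pd_congr (hc _ _ _), (hc _ _ _).eq_of_nhds]

theorem riemann_congr (h : G =ᶠ[𝓝 x] G') (i j k l : Fin n) :
    riemann G i j k l x = riemann G' i j k l x := by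
  simp only [riemann, curvOp_congr h, h.eq_of_nhds]

theorem ricci_congr (h : G =ᶠ[𝓝 x] G') (i j : Fin n) : ricci G i j x = ricci G' i j x := by
  simp only [ricci, curvOp_congr h]

/-- The curvature operator is antisymmetric with respect to the metric. -/
theorem IsMetricAt.riemann_antisymm_right (h : IsMetricAt G x)
    (h' : ∀ᶠ y in 𝓝 x, IsMetricAt G y) (i j k l : Fin n) :
    riemann G i j k l x = -riemann G i j l k x := by
  have hd : ∀ i j k, DifferentiableAt ℝ (christoffel G i j k) x :=
    fun i j k => (h.christoffel_smooth i j k).diff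
  have hg : ∀ i j, DifferentiableAt ℝ (fun y => G y i j) x := fun i j => (h.smooth i j).diff
  have hl : ∀ i j k, DifferentiableAt ℝ (christoffelLower G i j k) x :=
    fun i j k => (h.christoffelLower_smooth i j k).diff
  -- the derivative of the lowered Christoffel symbol
  have h1 : ∀ i j k l, pd i (christoffelLower G j k l) x =
      ∑ m, (pd i (christoffel G j k m) x * G x m l +
        christoffel G j k m x * (christoffelLower G i m l x + christoffelLower G i l m x)) := by
    intro i j k l
    have e : christoffelLower G j k l =ᶠ[𝓝 x] fun y => ∑ m, christoffel G j k m y * G y m l :=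
      h'.mono fun y hy => (hy.sum_christoffel_mul j k l).symm
    rw [pd_congr e, pd_sum (fun m _ => (hd _ _ _).fun_mul (hg _ _))]
    refine Finset.sum_congr rfl fun m _ => ?_
    rw [pd_mul (hd _ _ _) (hg _ _), h.pd_metric]
  have h2 : ∀ i j k l, pd i (pd j (fun y => G y k l)) x =
      pd i (christoffelLower G j k l) x + pd i (christoffelLower G j l k) x := by
    intro i j k l
    have e : pd j (fun y => G y k l) =ᶠ[𝓝 x]
        fun y => christoffelLower G j k l y + christoffelLower G j l k y :=
      h'.mono fun y hy => hy.pd_metric j k l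
    rw [pd_congr e, pd_add (hl _ _ _) (hl _ _ _)]
  -- Commuting the second derivatives of g_kl is the whole content. Written with lowered Christoffel
  -- symbols, it becomes R_ijkl + R_ijlk = 0 once the quadratic terms are sorted.
  have h3 := pd_comm (h.smooth k l) i j
  rw [h2, h2] at h3
  -- the quadratic terms
  have h4 : ∀ i j k l, ∑ m, christoffel G j k m x * christoffelLower G i m l x =
      ∑ m, (∑ p, christoffel G j k p x * christoffel G i p m x) * G x m l := by
    intro i j k l
    simp only [← h.sum_christoffel_mul, Finset.mul_sum, Finset.sum_mul]
    rw [Finset.sum_comm]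
    exact Finset.sum_congr rfl fun m _ => Finset.sum_congr rfl fun p _ => by ring
  have h5 : ∀ i j k l, ∑ m, christoffel G j k m x * christoffelLower G i l m x =
      ∑ m, christoffel G i l m x * christoffelLower G j k m x := by
    intro i j k l
    simp only [← h.sum_christoffel_mul, Finset.mul_sum]
    rw [Finset.sum_comm]
    refine Finset.sum_congr rfl fun m _ => Finset.sum_congr rfl fun p _ => ?_
    rw [h.symm_apply m p]
    ring
  have h6 : ∀ i j k l, riemann G i j k l x =
      ∑ m, pd j (christoffel G i k m) x * G x m l - ∑ m, pd i (christoffel G j k m) x * G x m l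
      + (∑ m, christoffel G i k m x * christoffelLower G j m l x -
         ∑ m, christoffel G j k m x * christoffelLower G i m l x) := by
    intro i j k l
    rw [h4, h4]
    simp only [riemann, curvOp, Finset.sum_sub_distrib, add_mul, sub_mul, Finset.sum_add_distrib]
  rw [h6, h6]
  simp only [h1, mul_add, Finset.sum_add_distrib] at h3
  have a1 := h5 i j k l
  have a2 := h5 i j l k
  linarith

/-- The second Bianchi identity at the centre of normal coordinates. -/
theorem IsMetricAt.second_bianchi (h : IsMetricAt G x)
    (h0 : ∀ i j k, christoffel G i j k x = 0) (m i j k l : Fin n) :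
    pd m (curvOp G i j k l) x + pd i (curvOp G j m k l) x + pd j (curvOp G m i k l) x = 0 := by
  have hs := fun i j k => h.christoffel_smooth i j k
  have hd : ∀ i j k, DifferentiableAt ℝ (christoffel G i j k) x := fun i j k => (hs i j k).diff
  have hpd : ∀ m i j k, DifferentiableAt ℝ (pd m (christoffel G i j k)) x :=
    fun m i j k => (contDiffAt_pd (hs i j k) m).diff
  -- Products of Christoffel symbols have vanishing first derivatives where the symbols vanish, so
  -- only second derivatives survive. These cancel in the cyclic sum.
  have h1 : ∀ m i j k l, pd m (curvOp G i j k l) x =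
      pd m (pd j (christoffel G i k l)) x - pd m (pd i (christoffel G j k l)) x := by
    intro m i j k l
    have hq : DifferentiableAt ℝ (fun y => ∑ p, (christoffel G i k p y * christoffel G j p l y -
        christoffel G j k p y * christoffel G i p l y)) x :=
      DifferentiableAt.fun_sum fun p _ => ((hd _ _ _).fun_mul (hd _ _ _)).fun_sub ((hd _ _ _).fun_mul (hd _ _ _))
    unfold curvOp
    rw [pd_add ((hpd _ _ _ _).fun_sub (hpd _ _ _ _)) hq, pd_sub (hpd _ _ _ _) (hpd _ _ _ _),
      pd_sum (fun p _ => ((hd _ _ _).fun_mul (hd _ _ _)).fun_sub ((hd _ _ _).fun_mul (hd _ _ _)))]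
    simp only [pd_sub ((hd _ _ _).fun_mul (hd _ _ _)) ((hd _ _ _).fun_mul (hd _ _ _)),
      pd_mul (hd _ _ _) (hd _ _ _), h0]
    simp
  rw [h1, h1, h1, pd_comm (hs i k l) m j, pd_comm (hs j k l) m i, pd_comm (hs m k l) i j]
  ring

end Metric

/-! ### Change of coordinates -/

section Pullback

variable {n : ℕ} {G : EuclideanSpace ℝ (Fin n) → Matrix (Fin n) (Fin n) ℝ}
  {φ : EuclideanSpace ℝ (Fin n) → EuclideanSpace ℝ (Fin n)} {x : EuclideanSpace ℝ (Fin n)}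

/-- The Jacobian matrix. -/
def jac (φ : EuclideanSpace ℝ (Fin n) → EuclideanSpace ℝ (Fin n)) (x : EuclideanSpace ℝ (Fin n)) :
    Matrix (Fin n) (Fin n) ℝ :=
  Matrix.of fun a i => pd i (fun y => φ y a) x

/-- The coefficients of the pulled back metric `φ^* G`. -/
def pullback (φ : EuclideanSpace ℝ (Fin n) → EuclideanSpace ℝ (Fin n))
    (G : EuclideanSpace ℝ (Fin n) → Matrix (Fin n) (Fin n) ℝ) (x : EuclideanSpace ℝ (Fin n)) :
    Matrix (Fin n) (Fin n) ℝ :=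
  (jac φ x).transpose * G (φ x) * jac φ x

theorem jac_apply (a i : Fin n) : jac φ x a i = pd i (fun y => φ y a) x := rfl

theorem pullback_apply (i j : Fin n) :
    pullback φ G x i j = ∑ a, ∑ b, jac φ x a i * jac φ x b j * G (φ x) a b := by
  simp only [pullback, Matrix.mul_apply, Matrix.transpose_apply, Finset.sum_mul]
  rw [Finset.sum_comm]
  exact Finset.sum_congr rfl fun a _ => Finset.sum_congr rfl fun b _ => by ring

theorem det_pullback : (pullback φ G x).det = (jac φ x).det ^ 2 * (G (φ x)).det := by
  rw [pullback, Matrix.det_mul, Matrix.det_mul, Matrix.det_transpose]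
  ring

theorem contDiffAt_jac (hφ : ContDiffAt ℝ ∞ φ x) (a i : Fin n) :
    ContDiffAt ℝ ∞ (fun y => jac φ y a i) x :=
  contDiffAt_pd (contDiffAt_coord hφ a) i

theorem IsMetricAt.pullback (h : IsMetricAt G (φ x)) (hφ : ContDiffAt ℝ ∞ φ x)
    (hJ : (jac φ x).det ≠ 0) : IsMetricAt (pullback φ G) x where
  smooth i j := by
    simp only [pullback_apply]
    exact ContDiffAt.sum fun a _ => ContDiffAt.sum fun b _ =>
      ((contDiffAt_jac hφ _ _).mul (contDiffAt_jac hφ _ _)).mul ((h.smooth a b).comp x hφ)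
  symm := by
    filter_upwards [hφ.continuousAt.eventually h.symm] with y hy
    rw [Matrix.IsSymm, PseudoRiem.pullback, Matrix.transpose_mul, Matrix.transpose_mul,
      Matrix.transpose_transpose, hy.eq, Matrix.mul_assoc]
  nondeg := by
    rw [det_pullback]
    exact mul_ne_zero (pow_ne_zero _ hJ) h.nondeg

theorem sum_rotate {α : Type*} [Fintype α] (f : α → α → α → ℝ) :
    ∑ a, ∑ b, ∑ c, f b c a = ∑ a, ∑ b, ∑ c, f a b c := by
  rw [Finset.sum_comm]
  exact Finset.sum_congr rfl fun b _ => Finset.sum_comm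

theorem pd_pullback (h : IsMetricAt G (φ x)) (hφ : ContDiffAt ℝ ∞ φ x) (k i j : Fin n) :
    pd k (fun y => pullback φ G y i j) x =
      ∑ a, ∑ b, pd k (fun y => jac φ y a i) x * jac φ x b j * G (φ x) a b +
      ∑ a, ∑ b, pd k (fun y => jac φ y a j) x * jac φ x b i * G (φ x) a b +
      ∑ a, ∑ b, ∑ c, jac φ x a i * jac φ x b j * jac φ x c k * pd c (fun z => G z a b) (φ x) := by
  have hJ : ∀ a i, DifferentiableAt ℝ (fun y => jac φ y a i) x :=
    fun a i => (contDiffAt_jac hφ a i).diff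
  have hG : ∀ a b, DifferentiableAt ℝ (fun y => G (φ y) a b) x :=
    fun a b => ((h.smooth a b).comp x hφ).diff
  simp only [pullback_apply]
  rw [pd_sum (fun a _ => DifferentiableAt.fun_sum fun b _ =>
    ((hJ _ _).fun_mul (hJ _ _)).fun_mul (hG _ _))]
  have h1 : ∀ a, pd k (fun y => ∑ b, jac φ y a i * jac φ y b j * G (φ y) a b) x =
      ∑ b, (pd k (fun y => jac φ y a i) x * jac φ x b j * G (φ x) a b +
        pd k (fun y => jac φ y b j) x * jac φ x a i * G (φ x) b a +
        ∑ c, jac φ x a i * jac φ x b j * jac φ x c k * pd c (fun z => G z a b) (φ x)) := by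
    intro a
    rw [pd_sum (fun b _ => ((hJ _ _).fun_mul (hJ _ _)).fun_mul (hG _ _))]
    refine Finset.sum_congr rfl fun b _ => ?_
    rw [pd_mul ((hJ _ _).fun_mul (hJ _ _)) (hG _ _), pd_mul (hJ _ _) (hJ _ _),
      pd_comp (F := fun z => G z a b) (h.smooth a b).diff hφ.diff, Finset.mul_sum, h.symm_apply b a]
    have : ∀ c, jac φ x a i * jac φ x b j * (pd c (fun z => G z a b) (φ x) *
        pd k (fun z => φ z c) x) = jac φ x a i * jac φ x b j * jac φ x c k *
          pd c (fun z => G z a b) (φ x) := fun c => by rw [jac_apply c k]; ring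
    simp only [this]
    ring
  simp only [h1, Finset.sum_add_distrib]
  congr 2
  rw [Finset.sum_comm]

theorem pd_jac_symm (hφ : ContDiffAt ℝ ∞ φ x) (k i a : Fin n) :
    pd k (fun y => jac φ y a i) x = pd i (fun y => jac φ y a k) x :=
  pd_comm (contDiffAt_coord hφ a) k i

/-- In the Koszul combination the second derivatives of φ, being symmetric in their lower indices,
cancel in pairs except for one term. That term is the inhomogeneous part of the transformation law.
-/
theorem christoffelLower_pullback (h : IsMetricAt G (φ x)) (hφ : ContDiffAt ℝ ∞ φ x)
    (i j k : Fin n) :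
    christoffelLower (pullback φ G) i j k x = ∑ c, jac φ x c k *
      (∑ a, pd i (fun y => jac φ y a j) x * G (φ x) a c +
       ∑ a, ∑ b, jac φ x a i * jac φ x b j * christoffelLower G a b c (φ x)) := by
  have e1 : ∀ i j k, ∑ a, ∑ b, ∑ c, jac φ x a i * jac φ x b j * jac φ x c k *
      pd c (fun z => G z a b) (φ x) = ∑ c, ∑ a, ∑ b, jac φ x a i * jac φ x b j * jac φ x c k *
      pd c (fun z => G z a b) (φ x) := fun i j k =>
    (sum_rotate fun a b c => jac φ x a i * jac φ x b j * jac φ x c k *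
      pd c (fun z => G z a b) (φ x)).symm
  have e2 : ∑ a, ∑ b, ∑ c, jac φ x a j * jac φ x b k * jac φ x c i *
      pd c (fun z => G z a b) (φ x) = ∑ c, ∑ a, ∑ b, jac φ x a i * jac φ x b j * jac φ x c k *
      pd a (fun z => G z b c) (φ x) := by
    refine Eq.trans ?_ (sum_rotate fun c a b => jac φ x a i * jac φ x b j * jac φ x c k *
      pd a (fun z => G z b c) (φ x))
    exact Finset.sum_congr rfl fun a _ => Finset.sum_congr rfl fun b _ =>
      Finset.sum_congr rfl fun c _ => by ring
  have e3 : ∑ a, ∑ b, ∑ c, jac φ x a i * jac φ x b k * jac φ x c j *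
      pd c (fun z => G z a b) (φ x) = ∑ c, ∑ a, ∑ b, jac φ x a i * jac φ x b j * jac φ x c k *
      pd b (fun z => G z a c) (φ x) := by
    rw [Finset.sum_comm]
    exact Finset.sum_congr rfl fun a _ => Finset.sum_congr rfl fun b _ =>
      Finset.sum_congr rfl fun c _ => by ring
  have e4 : ∑ c, jac φ x c k * ∑ a, pd i (fun y => jac φ y a j) x * G (φ x) a c =
      ∑ a, ∑ b, pd i (fun y => jac φ y a j) x * jac φ x b k * G (φ x) a b := by
    rw [Finset.sum_comm]
    simp only [Finset.mul_sum]
    exact Finset.sum_congr rfl fun a _ => Finset.sum_congr rfl fun b _ => by ring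
  have e5 : ∑ c, jac φ x c k * ∑ a, ∑ b, jac φ x a i * jac φ x b j *
      christoffelLower G a b c (φ x) = (1 / 2) *
      (∑ c, ∑ a, ∑ b, jac φ x a i * jac φ x b j * jac φ x c k * pd a (fun z => G z b c) (φ x) +
       ∑ c, ∑ a, ∑ b, jac φ x a i * jac φ x b j * jac φ x c k * pd b (fun z => G z a c) (φ x) -
       ∑ c, ∑ a, ∑ b, jac φ x a i * jac φ x b j * jac φ x c k * pd c (fun z => G z a b) (φ x)) := by
    simp only [christoffelLower, ← Finset.sum_add_distrib, ← Finset.sum_sub_distrib,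
      Finset.mul_sum]
    exact Finset.sum_congr rfl fun c _ => Finset.sum_congr rfl fun a _ =>
      Finset.sum_congr rfl fun b _ => by ring
  simp only [mul_add, Finset.sum_add_distrib]
  rw [e4, e5, christoffelLower, pd_pullback h hφ, pd_pullback h hφ, pd_pullback h hφ, e2, e3, e1 i j k]
  simp only [pd_jac_symm hφ j i, pd_jac_symm hφ k i, pd_jac_symm hφ k j]
  ring

theorem jac_mul_inv_pullback_mul (hJ : (jac φ x).det ≠ 0) :
    jac φ x * (pullback φ G x)⁻¹ * (jac φ x).transpose = (G (φ x))⁻¹ := by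
  have hJu : IsUnit (jac φ x).det := isUnit_iff_ne_zero.2 hJ
  have hJt : IsUnit (jac φ x).transpose.det := by rwa [Matrix.det_transpose]
  rw [pullback, Matrix.mul_inv_rev, Matrix.mul_inv_rev, ← Matrix.mul_assoc,
    Matrix.mul_nonsing_inv _ hJu, Matrix.one_mul, Matrix.mul_assoc, Matrix.nonsing_inv_mul _ hJt,
    Matrix.mul_one]

/-- The transformation law of the Christoffel symbols. -/
theorem sum_jac_mul_christoffel_pullback (h : IsMetricAt G (φ x)) (hφ : ContDiffAt ℝ ∞ φ x)
    (hJ : (jac φ x).det ≠ 0) (i j d : Fin n) :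
    ∑ k, jac φ x d k * christoffel (pullback φ G) i j k x =
      pd i (fun y => jac φ y d j) x +
        ∑ a, ∑ b, jac φ x a i * jac φ x b j * christoffel G a b d (φ x) := by
  set y : Fin n → ℝ := fun c => ∑ a, pd i (fun y => jac φ y a j) x * G (φ x) a c +
       ∑ a, ∑ b, jac φ x a i * jac φ x b j * christoffelLower G a b c (φ x)
  have h1 : (fun k => christoffel (pullback φ G) i j k x) =
      (pullback φ G x)⁻¹.mulVec ((jac φ x).transpose.mulVec y) := by
    funext k
    rw [christoffel_eq]
    refine Finset.sum_congr rfl fun l _ => ?_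
    rw [christoffelLower_pullback h hφ]
    rfl
  have h2 : (jac φ x).mulVec (fun k => christoffel (pullback φ G) i j k x) =
      ((G (φ x))⁻¹).mulVec y := by
    rw [h1, Matrix.mulVec_mulVec, Matrix.mulVec_mulVec,
      jac_mul_inv_pullback_mul hJ]
  refine (congrFun h2 d).trans ?_
  simp only [Matrix.mulVec, dotProduct, y, mul_add, Finset.sum_add_distrib]
  congr 1
  · simp only [Finset.mul_sum]
    rw [Finset.sum_comm]
    have : ∀ a, ∑ c, (G (φ x))⁻¹ d c * (pd i (fun y => jac φ y a j) x * G (φ x) a c) =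
        (if d = a then 1 else 0) * pd i (fun y => jac φ y a j) x := fun a => by
      rw [← h.sum_inv_mul d a, Finset.sum_mul]
      exact Finset.sum_congr rfl fun c _ => by rw [h.symm_apply c a]; ring
    simp [this]
  · simp only [christoffel_eq, Finset.mul_sum]
    rw [Finset.sum_comm]
    refine Finset.sum_congr rfl fun a _ => ?_
    rw [Finset.sum_comm]
    exact Finset.sum_congr rfl fun b _ => Finset.sum_congr rfl fun c _ => by ring

variable {F : EuclideanSpace ℝ (Fin n) → ℝ}

theorem pd_comp_jac (hF : ContDiffAt ℝ ∞ F (φ x)) (hφ : ContDiffAt ℝ ∞ φ x) (i : Fin n) :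
    pd i (fun y => F (φ y)) x = ∑ a, pd a F (φ x) * jac φ x a i :=
  pd_comp hF.diff hφ.diff i

/-- The Hessian is a tensor. -/
theorem hessian_pullback (h : IsMetricAt G (φ x)) (hφ : ContDiffAt ℝ ∞ φ x)
    (hJ : (jac φ x).det ≠ 0) (hF : ContDiffAt ℝ ∞ F (φ x)) (hF' : ∀ᶠ y in 𝓝 (φ x), ContDiffAt ℝ ∞ F y)
    (hφ' : ∀ᶠ y in 𝓝 x, ContDiffAt ℝ ∞ φ y) (i j : Fin n) :
    hessian (pullback φ G) (fun y => F (φ y)) i j x =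
      ∑ a, ∑ b, jac φ x a i * jac φ x b j * hessian G F a b (φ x) := by
  have h1 : pd j (fun y => F (φ y)) =ᶠ[𝓝 x] fun y => ∑ a, pd a F (φ y) * jac φ y a j := by
    filter_upwards [hφ', hφ.continuousAt.eventually hF'] with y hy1 hy2
    exact pd_comp_jac hy2 hy1 j
  have hFa : ∀ a, ContDiffAt ℝ ∞ (pd a F) (φ x) := fun a => contDiffAt_pd hF a
  have h2 : pd i (pd j fun y => F (φ y)) x =
      ∑ a, ∑ b, jac φ x a i * jac φ x b j * pd a (pd b F) (φ x) +
        ∑ d, pd d F (φ x) * pd i (fun y => jac φ y d j) x := by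
    rw [pd_congr h1, pd_sum (fun a _ => DifferentiableAt.fun_mul (a := fun y => pd a F (φ y))
      ((hFa a).comp x hφ).diff (contDiffAt_jac hφ a j).diff),
      Finset.sum_comm, ← Finset.sum_add_distrib]
    refine Finset.sum_congr rfl fun d _ => ?_
    rw [pd_mul (F := fun y => pd d F (φ y)) ((hFa d).comp x hφ).diff (contDiffAt_jac hφ d j).diff, pd_comp_jac (hFa d) hφ,
      Finset.sum_mul]
    congr 1
    exact Finset.sum_congr rfl fun a _ => by ring
  -- The inhomogeneous part of the transformation law reproduces the term with second derivatives of
  -- φ found in `h2`, so that term drops out of the Hessian.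
  have h3 : ∑ k, christoffel (pullback φ G) i j k x * pd k (fun y => F (φ y)) x =
      ∑ d, pd d F (φ x) * pd i (fun y => jac φ y d j) x +
      ∑ a, ∑ b, jac φ x a i * jac φ x b j * ∑ d, christoffel G a b d (φ x) * pd d F (φ x) := by
    have : ∑ k, christoffel (pullback φ G) i j k x * pd k (fun y => F (φ y)) x =
        ∑ d, pd d F (φ x) * ∑ k, jac φ x d k * christoffel (pullback φ G) i j k x := by
      simp only [pd_comp_jac hF hφ, Finset.mul_sum]
      rw [Finset.sum_comm]
      exact Finset.sum_congr rfl fun a _ => Finset.sum_congr rfl fun b _ => by ring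
    rw [this]
    simp only [sum_jac_mul_christoffel_pullback h hφ hJ, mul_add, Finset.sum_add_distrib]
    congr 1
    simp only [Finset.mul_sum]
    refine Eq.trans ?_ (sum_rotate fun a b d => jac φ x a i * jac φ x b j *
      (christoffel G a b d (φ x) * pd d F (φ x)))
    exact Finset.sum_congr rfl fun a _ => Finset.sum_congr rfl fun b _ =>
      Finset.sum_congr rfl fun c _ => by ring
  rw [hessian, h2, h3]
  simp only [hessian, mul_sub, Finset.sum_sub_distrib]
  ring

theorem gradNormSq_eq : gradNormSq G F x =
    (fun i => pd i F x) ⬝ᵥ (G x)⁻¹.mulVec (fun i => pd i F x) := by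
  simp only [gradNormSq, dotProduct, Matrix.mulVec, Finset.mul_sum]
  exact Finset.sum_congr rfl fun a _ => Finset.sum_congr rfl fun b _ => by ring

theorem gradNormSq_pullback (hφ : ContDiffAt ℝ ∞ φ x)
    (hJ : (jac φ x).det ≠ 0) (hF : ContDiffAt ℝ ∞ F (φ x)) :
    gradNormSq (pullback φ G) (fun y => F (φ y)) x = gradNormSq G F (φ x) := by
  have h1 : (fun i => pd i (fun y => F (φ y)) x) =
      (jac φ x).transpose.mulVec fun a => pd a F (φ x) := by
    funext i
    rw [pd_comp_jac hF hφ]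
    exact Finset.sum_congr rfl fun a _ => mul_comm _ _
  rw [gradNormSq_eq, gradNormSq_eq, h1, Matrix.mulVec_mulVec, Matrix.mulVec_transpose,
    ← Matrix.dotProduct_mulVec, Matrix.mulVec_mulVec, ← Matrix.mul_assoc,
    jac_mul_inv_pullback_mul hJ]

end Pullback

/-! ### Curvature tensors in an orthonormal frame -/

section Algebra

/-- The matrix of the metric in an orthonormal frame. -/
def frameMetric (ε : Fin 4 → ℝ) (i j : Fin 4) : ℝ := if i = j then ε i else 0

/-- The Weyl tensor of a curvature tensor in an orthonormal frame. -/
def frameWeyl (ε : Fin 4 → ℝ) (R : Fin 4 → Fin 4 → Fin 4 → Fin 4 → ℝ) (ρ : Fin 4 → Fin 4 → ℝ) (τ : ℝ)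
    (i j k l : Fin 4) : ℝ :=
  R i j k l + τ / 6 * (frameMetric ε i k * frameMetric ε j l - frameMetric ε i l * frameMetric ε j k)
    + 1 / 2 * (ρ i l * frameMetric ε j k - ρ i k * frameMetric ε j l
      + ρ j k * frameMetric ε i l - ρ j l * frameMetric ε i k)

variable {ε : Fin 4 → ℝ}

theorem frameMetric_symm (i j : Fin 4) : frameMetric ε i j = frameMetric ε j i := by
  unfold frameMetric
  split_ifs with h1 h2 h2
  · rw [h1]
  · exact absurd h1.symm h2
  · exact absurd h2.symm h1
  · rfl

theorem frameMetric_self (i : Fin 4) : frameMetric ε i i = ε i := if_pos rfl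

theorem frameMetric_ne {i j : Fin 4} (h : i ≠ j) : frameMetric ε i j = 0 := if_neg h

theorem sum_frameMetric (hε : ∀ i, ε i * ε i = 1) (j : Fin 4) (X : Fin 4 → ℝ) :
    ∑ l, ε l * (frameMetric ε j l * X l) = X j := by
  rw [Finset.sum_eq_single j]
  · rw [frameMetric_self, ← mul_assoc, hε, one_mul]
  · intro b _ hb
    rw [frameMetric_ne hb.symm]; ring
  · simp

theorem sum_frameMetric_self (hε : ∀ i, ε i * ε i = 1) : ∑ j, ε j * frameMetric ε j j = 4 := by
  simp only [frameMetric_self, hε]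
  simp

/-- A curvature tensor in an orthonormal frame, with its Ricci tensor and scalar curvature. -/
structure IsFrameCurvature (ε : Fin 4 → ℝ) (R : Fin 4 → Fin 4 → Fin 4 → Fin 4 → ℝ)
    (ρ : Fin 4 → Fin 4 → ℝ) (τ : ℝ) : Prop where
  left : ∀ i j k l, R i j k l = -R j i k l
  right : ∀ i j k l, R i j k l = -R i j l k
  ricci : ∀ i j, ρ i j = ∑ k, ε k * R i k j k
  scalar : τ = ∑ i, ε i * ρ i i

/-- The Weyl tensor is trace-free. Being linear in (R, ρ, τ), the argument applies equally to W and
to its covariant derivatives, which come from a triple of the same algebraic type. -/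
theorem IsFrameCurvature.sum_frameWeyl {R : Fin 4 → Fin 4 → Fin 4 → Fin 4 → ℝ}
    {ρ : Fin 4 → Fin 4 → ℝ} {τ : ℝ} (h : IsFrameCurvature ε R ρ τ) (hε : ∀ i, ε i * ε i = 1)
    (c l : Fin 4) : ∑ j, ε j * frameWeyl ε R ρ τ c j j l = 0 := by
  have h1 : ∑ j, ε j * frameWeyl ε R ρ τ c j j l = ∑ j, ε j * R c j j l +
      τ / 6 * (∑ j, ε j * (frameMetric ε c j * frameMetric ε j l) -
        frameMetric ε c l * ∑ j, ε j * frameMetric ε j j) +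
      1 / 2 * (ρ c l * ∑ j, ε j * frameMetric ε j j - ∑ j, ε j * (frameMetric ε l j * ρ c j) +
        frameMetric ε c l * ∑ j, ε j * ρ j j - ∑ j, ε j * (frameMetric ε c j * ρ j l)) := by
    simp only [Finset.mul_sum, ← Finset.sum_sub_distrib, ← Finset.sum_add_distrib]
    refine Finset.sum_congr rfl fun j _ => ?_
    rw [frameWeyl, frameMetric_symm l j]
    ring
  have h2 : ∑ j, ε j * R c j j l = -ρ c l := by
    rw [h.ricci, ← Finset.sum_neg_distrib]
    exact Finset.sum_congr rfl fun j _ => by rw [h.right c j j l]; ring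
  rw [h1, h2, sum_frameMetric hε c fun j => frameMetric ε j l, sum_frameMetric_self hε,
    sum_frameMetric hε l fun j => ρ c j, sum_frameMetric hε c fun j => ρ j l, ← h.scalar]
  ring

/-- Self-duality in the first two indices, up to the sign `s`. -/
def IsFrameSelfDual (ε : Fin 4 → ℝ) (s : ℝ) (β : Fin 4 → Fin 4 → ℝ) : Prop :=
  ∀ i j, β i j = s * ((1 / 2) * ∑ k, ∑ l, leviCivita i j k l * ε k * ε l * β k l)

theorem leviCivita_eq_zero_left (j k l : Fin 4) (h : k = 0 ∨ l = 0) : leviCivita 0 j k l = 0 := by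
  rcases h with rfl | rfl
  · exact Matrix.det_zero_of_row_eq (i := 0) (j := 2) (by decide) rfl
  · exact Matrix.det_zero_of_row_eq (i := 0) (j := 3) (by decide) rfl

/-- A self-dual 2-form that vanishes on a nondegenerate hyperplane is zero. -/
theorem IsFrameSelfDual.eq_zero {s : ℝ} {β : Fin 4 → Fin 4 → ℝ} (h : IsFrameSelfDual ε s β)
    (h0 : ∀ a b, a ≠ 0 → b ≠ 0 → β a b = 0) (c : Fin 4) : β 0 c = 0 := by
  rw [h, Finset.sum_eq_zero fun k _ => Finset.sum_eq_zero fun l _ => ?_, mul_zero, mul_zero]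
  by_cases hkl : k = 0 ∨ l = 0
  · rw [leviCivita_eq_zero_left c k l hkl]; ring
  · push Not at hkl
    rw [h0 k l hkl.1 hkl.2, mul_zero]

variable {R : Fin 4 → Fin 4 → Fin 4 → Fin 4 → ℝ} {r : Fin 4 → Fin 4 → Fin 4 → Fin 4 → Fin 4 → ℝ}
  {ρ : Fin 4 → Fin 4 → ℝ} {dρ : Fin 4 → Fin 4 → Fin 4 → ℝ} {τ : ℝ} {dτ : Fin 4 → ℝ}

/-- The once contracted second Bianchi identity. -/
theorem sum_derivative_curvature (hr : ∀ m, IsFrameCurvature ε (r m) (dρ m) (dτ m))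
    (hB : ∀ m i j k l, r m i j k l + r i j m k l + r j m i k l = 0) (i j k : Fin 4) :
    ∑ l, ε l * r l i j k l = dρ j i k - dρ i j k := by
  rw [(hr j).ricci, (hr i).ricci, ← Finset.sum_sub_distrib]
  refine Finset.sum_congr rfl fun l _ => ?_
  have h1 := hB l i j k l
  rw [(hr j).left l i k l] at h1
  linear_combination ε l * h1

/-- The twice contracted second Bianchi identity. -/
theorem two_mul_divergence_ricci (hr : ∀ m, IsFrameCurvature ε (r m) (dρ m) (dτ m))
    (hB : ∀ m i j k l, r m i j k l + r i j m k l + r j m i k l = 0) (j : Fin 4) :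
    2 * ∑ l, ε l * dρ l j l = dτ j := by
  have h1 : ∑ i, ε i * ∑ l, ε l * r l i j i l = ∑ l, ε l * dρ l j l := by
    simp only [(hr _).ricci, Finset.mul_sum]
    rw [Finset.sum_comm]
    refine Finset.sum_congr rfl fun l _ => Finset.sum_congr rfl fun i _ => ?_
    rw [(hr l).left i j i l, (hr l).right j i i l]
    ring
  simp only [sum_derivative_curvature hr hB, mul_sub, Finset.sum_sub_distrib] at h1
  rw [← (hr j).scalar] at h1
  linarith

variable {f dL : Fin 4 → ℝ} {h : Fin 4 → Fin 4 → ℝ} {L μ : ℝ}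

/-- Twice the divergence of the Weyl tensor minus its contraction with the gradient. -/
theorem weyl_contraction (hε : ∀ i, ε i * ε i = 1)
    (hr : ∀ m, IsFrameCurvature ε (r m) (dρ m) (dτ m))
    (hB : ∀ m i j k l, r m i j k l + r i j m k l + r j m i k l = 0)
    (hQE : ∀ i j, ρ i j = L * frameMetric ε i j + μ * (f i * f j) - h i j)
    (hC : ∀ i j k, dρ j i k - dρ i j k = dL j * frameMetric ε i k - dL i * frameMetric ε j k +
      μ * (f i * h j k - f j * h i k) + ∑ l, ε l * (R i j k l * f l)) :
    ∃ v : Fin 4 → ℝ, ∀ i j k,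
      ∑ l, ε l * (2 * frameWeyl ε (r l) (dρ l) (dτ l) i j k l - frameWeyl ε R ρ τ i j k l * f l) =
        (μ + 1 / 2) * (f i * h j k - f j * h i k) +
          (frameMetric ε j k * v i - frameMetric ε i k * v j) := by
  -- The covector collects everything multiplied by a metric factor. The other terms give (μ + 1/2):
  -- μ comes from differentiating μ df ⊗ df, and 1/2 from the Ricci part of W contracted with ∇f,
  -- where ρ contributes −h. The factor 2 on the divergence makes the R(·,·,·,∇f) terms cancel.
  refine ⟨fun i => -dL i + dτ i / 6 + τ * f i / 6 - (∑ l, ε l * (ρ i l * f l)) / 2 - L * f i / 2,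
    fun i j k => ?_⟩
  have h1 : ∑ l, ε l * (2 * frameWeyl ε (r l) (dρ l) (dτ l) i j k l -
      frameWeyl ε R ρ τ i j k l * f l) =
      2 * (∑ l, ε l * r l i j k l + 1 / 6 * (frameMetric ε i k * ∑ l, ε l * (frameMetric ε j l * dτ l) -
        frameMetric ε j k * ∑ l, ε l * (frameMetric ε i l * dτ l)) +
        1 / 2 * (frameMetric ε j k * ∑ l, ε l * dρ l i l - ∑ l, ε l * (frameMetric ε j l * dρ l i k) +
          ∑ l, ε l * (frameMetric ε i l * dρ l j k) - frameMetric ε i k * ∑ l, ε l * dρ l j l)) -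
      (∑ l, ε l * (R i j k l * f l) + τ / 6 * (frameMetric ε i k * ∑ l, ε l * (frameMetric ε j l * f l) -
        frameMetric ε j k * ∑ l, ε l * (frameMetric ε i l * f l)) +
        1 / 2 * (frameMetric ε j k * ∑ l, ε l * (ρ i l * f l) -
          ρ i k * ∑ l, ε l * (frameMetric ε j l * f l) +
          ρ j k * ∑ l, ε l * (frameMetric ε i l * f l) -
          frameMetric ε i k * ∑ l, ε l * (ρ j l * f l))) := by
    simp only [Finset.mul_sum, ← Finset.sum_sub_distrib, ← Finset.sum_add_distrib]
    refine Finset.sum_congr rfl fun l _ => ?_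
    rw [frameWeyl, frameWeyl]
    ring
  have d1 := two_mul_divergence_ricci hr hB i
  have d2 := two_mul_divergence_ricci hr hB j
  rw [h1, sum_derivative_curvature hr hB, sum_frameMetric hε j dτ, sum_frameMetric hε i dτ,
    sum_frameMetric hε j fun l => dρ l i k, sum_frameMetric hε i fun l => dρ l j k,
    sum_frameMetric hε j f, sum_frameMetric hε i f]
  have c1 := hC i j k
  have q1 := hQE i k
  have q2 := hQE j k
  linear_combination c1 + frameMetric ε j k / 2 * d1 - frameMetric ε i k / 2 * d2 +
    f j / 2 * q1 - f i / 2 * q2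

/-- In an orthonormal frame adapted to `∇f`, the Hessian of `f` is diagonal and is a multiple of
the metric on the orthogonal complement of `∇f`. -/
theorem frame_hessian {s : ℝ} (hε : ∀ i, ε i * ε i = 1) (hR : IsFrameCurvature ε R ρ τ)
    (hr : ∀ m, IsFrameCurvature ε (r m) (dρ m) (dτ m))
    (hB : ∀ m i j k l, r m i j k l + r i j m k l + r j m i k l = 0)
    (hQE : ∀ i j, ρ i j = L * frameMetric ε i j + μ * (f i * f j) - h i j)
    (hC : ∀ i j k, dρ j i k - dρ i j k = dL j * frameMetric ε i k - dL i * frameMetric ε j k +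
      μ * (f i * h j k - f j * h i k) + ∑ l, ε l * (R i j k l * f l))
    (hW : ∀ k l, IsFrameSelfDual ε s fun i j => frameWeyl ε R ρ τ i j k l)
    (hw : ∀ m k l, IsFrameSelfDual ε s fun i j => frameWeyl ε (r m) (dρ m) (dτ m) i j k l)
    (hμ : μ ≠ -1 / 2) (hf0 : f 0 ≠ 0) (hf : ∀ a, a ≠ 0 → f a = 0) :
    (∀ a, a ≠ 0 → h a 0 = 0) ∧
      ∃ α, ∀ a b, a ≠ 0 → b ≠ 0 → h a b = α * frameMetric ε a b := by
  obtain ⟨v, hv⟩ := weyl_contraction (τ := τ) hε hr hB hQE hC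
  set E : Fin 4 → Fin 4 → Fin 4 → ℝ := fun i j k => ∑ l, ε l *
    (2 * frameWeyl ε (r l) (dρ l) (dτ l) i j k l - frameWeyl ε R ρ τ i j k l * f l) with hE
  have hc : μ + 1 / 2 ≠ 0 := fun h0 => hμ (by linarith)
  -- The duality operator acts on the first two indices with constant coefficients, so it commutes
  -- with the contraction over the last index.
  have hsd : ∀ k, IsFrameSelfDual ε s fun i j => E i j k := by
    intro k i j
    have : ∀ p q, leviCivita i j p q * ε p * ε q * E p q k =
        ∑ l, ε l * (2 * (leviCivita i j p q * ε p * ε q *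
          frameWeyl ε (r l) (dρ l) (dτ l) p q k l) -
          leviCivita i j p q * ε p * ε q * frameWeyl ε R ρ τ p q k l * f l) := by
      intro p q
      simp only [hE, Finset.mul_sum]
      exact Finset.sum_congr rfl fun l _ => by ring
    simp only [this]
    have e1 : ∀ T : Fin 4 → Fin 4 → Fin 4 → ℝ, ∑ p, ∑ q, ∑ l, T p q l = ∑ l, ∑ p, ∑ q, T p q l :=
      fun T => (sum_rotate fun p q l => T p q l).symm
    rw [e1, Finset.mul_sum, Finset.mul_sum]
    refine Finset.sum_congr rfl fun l _ => ?_
    have a1 := hw l k l i j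
    have a2 := hW k l i j
    simp only at a1 a2
    rw [a1, a2]
    simp only [Finset.mul_sum, Finset.sum_mul, ← Finset.sum_sub_distrib]
    exact Finset.sum_congr rfl fun p _ => Finset.sum_congr rfl fun q _ => by ring
  -- For a, b tangent to the hyperplane and k = 0, every term contains f_a, f_b, g_a0 or g_b0.
  -- Duality then gives E_0c0 = 0 as well.
  have hE0 : ∀ a b, a ≠ 0 → b ≠ 0 → E a b 0 = 0 := by
    intro a b ha hb
    rw [hE]
    simp only [hv, hf a ha, hf b hb, frameMetric_ne ha, frameMetric_ne hb]
    ring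
  have hE0c : ∀ c, c ≠ 0 → E 0 c 0 = 0 := fun c _ => (hsd 0).eq_zero hE0 c
  have htr : ∀ c, ∑ j, ε j * E c j j = 0 := by
    intro c
    have : ∑ j, ε j * E c j j = ∑ l, ε l * (2 * ∑ j, ε j * frameWeyl ε (r l) (dρ l) (dτ l) c j j l -
        (∑ j, ε j * frameWeyl ε R ρ τ c j j l) * f l) := by
      simp only [hE, Finset.mul_sum, Finset.sum_mul, ← Finset.sum_sub_distrib]
      rw [Finset.sum_comm]
      exact Finset.sum_congr rfl fun p _ => Finset.sum_congr rfl fun q _ => by ring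
    rw [this]
    simp [(hr _).sum_frameWeyl hε, hR.sum_frameWeyl hε]
  -- In the trace of E_cjj the term j = 0 vanishes by `hE0c` and the term j = c by antisymmetry.
  -- Each of the two remaining indices contributes v_c, so 2 v_c = 0.
  have hvc : ∀ c, c ≠ 0 → v c = 0 := by
    intro c hcc
    have h1 : ∀ j, ε j * E c j j = if j = 0 ∨ j = c then 0 else v c := by
      intro j
      split_ifs with hj
      · rcases hj with rfl | rfl
        · have h3 := hv c 0 0
          have h4 := hv 0 c 0
          have h5 := hE0c c hcc
          simp only [hE] at h5 ⊢
          rw [h5] at h4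
          rw [h3]
          linear_combination ε 0 * h4
        · simp only [hE, hv]
          ring
      · push Not at hj
        simp only [hE, hv, hf j hj.1, hf c hcc, frameMetric_self, frameMetric_ne hj.2.symm]
        linear_combination v c * hε j
    have h2 := htr c
    simp only [h1, Fin.sum_univ_four] at h2
    fin_cases c
    · simp at hcc
    all_goals
      simp at h2 ⊢
      linarith
  -- With v zero on the hyperplane, E(·,·,k) vanishes there for every k, and duality yields E_0ck =
  -- 0. Solving this for h gives both conclusions.
  have hEab : ∀ k a b, a ≠ 0 → b ≠ 0 → E a b k = 0 := by
    intro k a b ha hb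
    rw [hE]
    simp only [hv, hf a ha, hf b hb, hvc a ha, hvc b hb]
    ring
  have hE0a : ∀ k c, c ≠ 0 → E 0 c k = 0 := fun k c _ => (hsd k).eq_zero (hEab k) c
  have hne : (μ + 1 / 2) * f 0 ≠ 0 := mul_ne_zero hc hf0
  constructor
  · intro a ha
    have h1 := hE0a 0 a ha
    simp only [hE, hv, hf a ha, hvc a ha, frameMetric_ne ha] at h1
    have h2 : (μ + 1 / 2) * f 0 * h a 0 = 0 := by linear_combination h1
    exact (mul_eq_zero.1 h2).resolve_left hne
  · refine ⟨-v 0 / ((μ + 1 / 2) * f 0), fun a b ha hb => ?_⟩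
    have h1 := hE0a b a ha
    simp only [hE, hv, hf a ha, frameMetric_ne hb.symm] at h1
    rw [div_mul_eq_mul_div, eq_div_iff hne]
    linear_combination h1

end Algebra

/-! ### Stationary functions -/

section Stationary

variable {n : ℕ} {x : EuclideanSpace ℝ (Fin n)} {F F' : EuclideanSpace ℝ (Fin n) → ℝ}

theorem hasFDerivAt_zero_of_pd (hF : DifferentiableAt ℝ F x) (h : ∀ i, pd i F x = 0) :
    HasFDerivAt F (0 : EuclideanSpace ℝ (Fin n) →L[ℝ] ℝ) x := by
  have h1 : fderiv ℝ F x = 0 := by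
    ext v
    rw [fderiv_apply_eq_sum]
    simp [h]
  rw [← h1]
  exact hF.hasFDerivAt

theorem pd_eq_zero_of_hasFDerivAt (h : HasFDerivAt F (0 : EuclideanSpace ℝ (Fin n) →L[ℝ] ℝ) x)
    (i : Fin n) : pd i F x = 0 := by
  rw [pd, h.fderiv]; rfl

/-- Functions stationary at a point are closed under products, determinants and composition. At the
centre of normal coordinates, the inverse metric, the volume density and the Hodge star are
therefore constant to first order, and ∂ₘ acts there as the covariant derivative. -/
theorem hasFDerivAt_zero_mul (h : HasFDerivAt F (0 : EuclideanSpace ℝ (Fin n) →L[ℝ] ℝ) x)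
    (h' : HasFDerivAt F' (0 : EuclideanSpace ℝ (Fin n) →L[ℝ] ℝ) x) :
    HasFDerivAt (fun y => F y * F' y) (0 : EuclideanSpace ℝ (Fin n) →L[ℝ] ℝ) x := by
  simpa using h.fun_mul h'

theorem hasFDerivAt_zero_det {m : ℕ} {A : EuclideanSpace ℝ (Fin n) → Matrix (Fin m) (Fin m) ℝ}
    (h : ∀ i j, HasFDerivAt (fun y => A y i j) (0 : EuclideanSpace ℝ (Fin n) →L[ℝ] ℝ) x) :
    HasFDerivAt (fun y => (A y).det) (0 : EuclideanSpace ℝ (Fin n) →L[ℝ] ℝ) x := by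
  have h1 : ∀ σ : Equiv.Perm (Fin m), HasFDerivAt (fun y => ∏ i, A y (σ i) i)
      (0 : EuclideanSpace ℝ (Fin n) →L[ℝ] ℝ) x := by
    intro σ
    have h2 := Finset.prod_induction (s := Finset.univ) (fun i y => A y (σ i) i)
      (fun F => HasFDerivAt F (0 : EuclideanSpace ℝ (Fin n) →L[ℝ] ℝ) x)
      (fun _ _ h h' => hasFDerivAt_zero_mul h h') (hasFDerivAt_const _ _) (fun i _ => h _ _)
    convert h2 using 1
    funext y
    simp
  simp only [Matrix.det_apply]
  have h3 := HasFDerivAt.fun_sum (u := Finset.univ) fun (σ : Equiv.Perm (Fin m)) _ =>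
    (h1 σ).const_smul (Equiv.Perm.sign σ)
  simpa using h3

theorem hasFDerivAt_zero_comp {g : ℝ → ℝ} (hg : DifferentiableAt ℝ g (F x))
    (h : HasFDerivAt F (0 : EuclideanSpace ℝ (Fin n) →L[ℝ] ℝ) x) :
    HasFDerivAt (fun y => g (F y)) (0 : EuclideanSpace ℝ (Fin n) →L[ℝ] ℝ) x := by
  have := hg.hasDerivAt.comp_hasFDerivAt x h
  rwa [smul_zero] at this

end Stationary

/-! ### Normal coordinates -/

/-- At `x` the coordinates are normal and orthonormal for the metric `G`. -/
structure IsNormalAt (ε : Fin 4 → ℝ) (G : EuclideanSpace ℝ (Fin 4) → Matrix (Fin 4) (Fin 4) ℝ)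
    (x : EuclideanSpace ℝ (Fin 4)) : Prop where
  metric : ∀ᶠ y in 𝓝 x, IsMetricAt G y
  unit : ∀ i, ε i * ε i = 1
  eq : ∀ i j, G x i j = frameMetric ε i j
  pd_eq_zero : ∀ k i j, pd k (fun y => G y i j) x = 0

namespace IsNormalAt

variable {ε : Fin 4 → ℝ} {G : EuclideanSpace ℝ (Fin 4) → Matrix (Fin 4) (Fin 4) ℝ}
  {x : EuclideanSpace ℝ (Fin 4)} {F L : EuclideanSpace ℝ (Fin 4) → ℝ} {s μ : ℝ}

theorem isMetricAt (h : IsNormalAt ε G x) : IsMetricAt G x := h.metric.self_of_nhds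

theorem stationary (h : IsNormalAt ε G x) (i j : Fin 4) :
    HasFDerivAt (fun y => G y i j) (0 : EuclideanSpace ℝ (Fin 4) →L[ℝ] ℝ) x :=
  hasFDerivAt_zero_of_pd (h.isMetricAt.smooth i j).diff fun k => h.pd_eq_zero k i j

theorem det_stationary (h : IsNormalAt ε G x) :
    HasFDerivAt (fun y => (G y).det) (0 : EuclideanSpace ℝ (Fin 4) →L[ℝ] ℝ) x :=
  hasFDerivAt_zero_det h.stationary

theorem inv_stationary (h : IsNormalAt ε G x) (i j : Fin 4) :
    HasFDerivAt (fun y => (G y)⁻¹ i j) (0 : EuclideanSpace ℝ (Fin 4) →L[ℝ] ℝ) x := by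
  have h1 : HasFDerivAt (fun y => ((G y).det)⁻¹ * (G y).adjugate i j)
      (0 : EuclideanSpace ℝ (Fin 4) →L[ℝ] ℝ) x := by
    refine hasFDerivAt_zero_mul (hasFDerivAt_zero_comp
      (differentiableAt_inv h.isMetricAt.nondeg) h.det_stationary) ?_
    simp only [Matrix.adjugate_apply]
    refine hasFDerivAt_zero_det fun a b => ?_
    by_cases hab : a = j
    · subst hab
      simp only [Matrix.updateRow_self]
      exact hasFDerivAt_const _ _
    · simp only [Matrix.updateRow_ne hab]
      exact h.stationary a b
  refine h1.congr_of_eventuallyEq (Eventually.of_forall fun _ => ?_)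
  simp [Matrix.inv_def]

theorem sqrt_det_stationary (h : IsNormalAt ε G x) :
    HasFDerivAt (fun y => √|(G y).det|) (0 : EuclideanSpace ℝ (Fin 4) →L[ℝ] ℝ) x :=
  hasFDerivAt_zero_comp (g := fun t => √|t|)
    ((differentiableAt_abs h.isMetricAt.nondeg).sqrt (abs_ne_zero.2 h.isMetricAt.nondeg))
    h.det_stationary

theorem inv_eq (h : IsNormalAt ε G x) (i j : Fin 4) : (G x)⁻¹ i j = frameMetric ε i j := by
  have h1 : (Matrix.of (frameMetric ε)) * G x = 1 := by
    ext i j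
    simp only [Matrix.mul_apply, Matrix.of_apply, h.eq]
    rw [Finset.sum_eq_single i (fun b _ hb => by rw [frameMetric_ne hb.symm, zero_mul]) (by simp)]
    simp only [frameMetric, if_true, Matrix.one_apply]
    split_ifs
    · exact h.unit i
    · ring
  rw [Matrix.inv_eq_left_inv h1]
  rfl

theorem sqrt_det (h : IsNormalAt ε G x) : √|(G x).det| = 1 := by
  have h1 : G x = Matrix.diagonal ε := by
    ext i j
    rw [h.eq, frameMetric, Matrix.diagonal_apply]
  have h2 : |∏ i, ε i| = 1 := by
    rw [Finset.abs_prod]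
    refine Finset.prod_eq_one fun i _ => ?_
    rw [← Real.sqrt_mul_self_eq_abs, h.unit, Real.sqrt_one]
  rw [h1, Matrix.det_diagonal, h2, Real.sqrt_one]

theorem christoffel_eq_zero (h : IsNormalAt ε G x) (i j k : Fin 4) : christoffel G i j k x = 0 := by
  simp [christoffel, h.pd_eq_zero]

theorem sum_frameMetric_mul (i : Fin 4) (X : Fin 4 → ℝ) :
    ∑ j, X j * frameMetric ε j i = X i * ε i := by
  rw [Finset.sum_eq_single i (fun b _ hb => by rw [frameMetric_ne hb, mul_zero]) (by simp),
    frameMetric_self]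

theorem sum_sum_frameMetric_mul (X : Fin 4 → Fin 4 → ℝ) :
    ∑ i, ∑ j, frameMetric ε i j * X i j = ∑ i, ε i * X i i := by
  refine Finset.sum_congr rfl fun i _ => ?_
  rw [Finset.sum_eq_single i (fun b _ hb => by rw [frameMetric_ne hb.symm, zero_mul]) (by simp),
    frameMetric_self]

theorem riemann_eq (h : IsNormalAt ε G x) (i j k l : Fin 4) :
    riemann G i j k l x = curvOp G i j k l x * ε l := by
  simp only [riemann, h.eq, sum_frameMetric_mul]

theorem pd_riemann (h : IsNormalAt ε G x) (m i j k l : Fin 4) :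
    pd m (riemann G i j k l) x = pd m (curvOp G i j k l) x * ε l := by
  have hc : ∀ p, DifferentiableAt ℝ (curvOp G i j k p) x :=
    fun p => (h.isMetricAt.curvOp_smooth i j k p).diff
  have hg : ∀ p, DifferentiableAt ℝ (fun y => G y p l) x :=
    fun p => (h.isMetricAt.smooth p l).diff
  unfold riemann
  rw [pd_sum fun p _ => (hc p).fun_mul (hg p)]
  simp only [pd_mul (hc _) (hg _), h.pd_eq_zero, mul_zero, add_zero, h.eq, sum_frameMetric_mul]

theorem scalar_eq (h : IsNormalAt ε G x) : scalar G x = ∑ i, ε i * ricci G i i x := by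
  simp only [scalar, h.inv_eq, sum_sum_frameMetric_mul]

theorem isFrameCurvature (h : IsNormalAt ε G x) :
    IsFrameCurvature ε (fun i j k l => riemann G i j k l x) (fun i j => ricci G i j x)
      (scalar G x) where
  left := riemann_antisymm_left
  right := h.isMetricAt.riemann_antisymm_right h.metric
  ricci i j := by
    simp only [ricci, h.riemann_eq]
    exact Finset.sum_congr rfl fun k _ => by linear_combination -(curvOp G i k j k x) * h.unit k
  scalar := h.scalar_eq

/-- Because the metric is stationary at the point, ∂ₘ passes through every contraction, and the
derivatives of R, ρ and τ satisfy the same linear relations as the tensors themselves. -/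
theorem isFrameCurvature_pd (h : IsNormalAt ε G x) (m : Fin 4) :
    IsFrameCurvature ε (fun i j k l => pd m (riemann G i j k l) x) (fun i j => pd m (ricci G i j) x)
      (pd m (scalar G) x) where
  left i j k l := by
    have h1 : riemann G i j k l = fun y => (-1) * riemann G j i k l y := by
      funext y
      rw [riemann_antisymm_left, neg_one_mul]
    rw [h1, pd_const_mul (h.isMetricAt.riemann_smooth j i k l).diff, neg_one_mul]
  right i j k l := by
    have h1 : riemann G i j k l =ᶠ[𝓝 x] fun y => (-1) * riemann G i j l k y := by
      filter_upwards [h.metric.eventually_nhds] with y hy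
      rw [hy.self_of_nhds.riemann_antisymm_right hy, neg_one_mul]
    rw [pd_congr h1, pd_const_mul (h.isMetricAt.riemann_smooth i j l k).diff, neg_one_mul]
  ricci i j := by
    unfold ricci
    rw [pd_sum fun k _ => (h.isMetricAt.curvOp_smooth i k j k).diff]
    simp only [h.pd_riemann]
    exact Finset.sum_congr rfl fun k _ => by
      linear_combination -(pd m (curvOp G i k j k) x) * h.unit k
  scalar := by
    have hi : ∀ i j, DifferentiableAt ℝ (fun y => (G y)⁻¹ i j) x :=
      fun i j => (h.isMetricAt.inv_smooth i j).diff
    have hr : ∀ i j, DifferentiableAt ℝ (ricci G i j) x :=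
      fun i j => (h.isMetricAt.ricci_smooth i j).diff
    unfold scalar
    rw [pd_sum fun i _ => DifferentiableAt.fun_sum fun j _ => (hi i j).fun_mul (hr i j)]
    simp only [pd_sum fun j _ => (hi _ j).fun_mul (hr _ j), pd_mul (hi _ _) (hr _ _),
      pd_eq_zero_of_hasFDerivAt (h.inv_stationary _ _), h.inv_eq, zero_mul, zero_add,
      sum_sum_frameMetric_mul]

theorem bianchi (h : IsNormalAt ε G x) (m i j k l : Fin 4) :
    pd m (riemann G i j k l) x + pd i (riemann G j m k l) x + pd j (riemann G m i k l) x = 0 := by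
  simp only [h.pd_riemann]
  linear_combination ε l * h.isMetricAt.second_bianchi h.christoffel_eq_zero m i j k l

theorem weyl_eq (h : IsNormalAt ε G x) (i j k l : Fin 4) :
    weyl G i j k l x = frameWeyl ε (fun i j k l => riemann G i j k l x) (fun i j => ricci G i j x)
      (scalar G x) i j k l := by
  simp only [weyl, frameWeyl, h.eq]
  norm_num

theorem pd_weyl (h : IsNormalAt ε G x) (m i j k l : Fin 4) :
    pd m (weyl G i j k l) x = frameWeyl ε (fun i j k l => pd m (riemann G i j k l) x)
      (fun i j => pd m (ricci G i j) x) (pd m (scalar G) x) i j k l := by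
  have hg := h.isMetricAt
  have d1 : DifferentiableAt ℝ (riemann G i j k l) x := (hg.riemann_smooth i j k l).diff
  have d2 : DifferentiableAt ℝ (scalar G) x := hg.scalar_smooth.diff
  have d3 : ∀ i j, DifferentiableAt ℝ (ricci G i j) x := fun i j => (hg.ricci_smooth i j).diff
  have d4 : ∀ i j, DifferentiableAt ℝ (fun y => G y i j) x := fun i j => (hg.smooth i j).diff
  have h1 : weyl G i j k l = fun y => riemann G i j k l y +
      1 / 6 * (scalar G y * (G y i k * G y j l - G y i l * G y j k)) +
      1 / 2 * (ricci G i l y * G y j k - ricci G i k y * G y j l +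
        (ricci G j k y * G y i l - ricci G j l y * G y i k)) := by
    funext y
    simp only [weyl]
    norm_num
    ring
  have d5 := ((d4 i k).fun_mul (d4 j l)).fun_sub ((d4 i l).fun_mul (d4 j k))
  have d6 := ((d3 i l).fun_mul (d4 j k)).fun_sub ((d3 i k).fun_mul (d4 j l))
  have d7 := ((d3 j k).fun_mul (d4 i l)).fun_sub ((d3 j l).fun_mul (d4 i k))
  rw [h1, pd_add (d1.fun_add ((d2.fun_mul d5).const_mul _)) ((d6.fun_add d7).const_mul _),
    pd_add d1 ((d2.fun_mul d5).const_mul _), pd_const_mul (d2.fun_mul d5),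
    pd_const_mul (d6.fun_add d7), pd_add d6 d7, pd_mul d2 d5,
    pd_sub ((d4 i k).fun_mul (d4 j l)) ((d4 i l).fun_mul (d4 j k)),
    pd_sub ((d3 i l).fun_mul (d4 j k)) ((d3 i k).fun_mul (d4 j l)),
    pd_sub ((d3 j k).fun_mul (d4 i l)) ((d3 j l).fun_mul (d4 i k))]
  simp only [pd_mul (d4 _ _) (d4 _ _), pd_mul (d3 _ _) (d4 _ _), h.pd_eq_zero, h.eq, frameWeyl]
  ring

theorem hodge_eq (h : IsNormalAt ε G x) (β : Fin 4 → Fin 4 → ℝ) (i j : Fin 4) :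
    hodge G x β i j = (1 / 2) * ∑ k, ∑ l, leviCivita i j k l * ε k * ε l * β k l := by
  rw [hodge, h.sqrt_det, mul_one]
  congr 1
  refine Finset.sum_congr rfl fun k _ => Finset.sum_congr rfl fun l _ => ?_
  simp only [h.inv_eq]
  rw [Finset.sum_eq_single k (fun a _ ha => by simp [frameMetric_ne ha.symm]) (by simp),
    Finset.sum_eq_single l (fun a _ ha => by simp [frameMetric_ne ha.symm]) (by simp),
    frameMetric_self, frameMetric_self]

/-- The Hodge star is parallel: its coefficients are stationary at the centre, so only the form is
differentiated. -/
theorem pd_hodge (h : IsNormalAt ε G x) {W : Fin 4 → Fin 4 → EuclideanSpace ℝ (Fin 4) → ℝ}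
    (hW : ∀ a b, DifferentiableAt ℝ (W a b) x) (m i j : Fin 4) :
    pd m (fun y => hodge G y (fun a b => W a b y) i j) x =
      hodge G x (fun a b => pd m (W a b) x) i j := by
  have hc : ∀ k l a b, HasFDerivAt (fun y => (1 / 2 * leviCivita i j k l) *
      (√|(G y).det| * ((G y)⁻¹ k a * (G y)⁻¹ l b))) (0 : EuclideanSpace ℝ (Fin 4) →L[ℝ] ℝ) x :=
    fun k l a b => hasFDerivAt_zero_mul (hasFDerivAt_const _ _) (hasFDerivAt_zero_mul
      h.sqrt_det_stationary (hasFDerivAt_zero_mul (h.inv_stationary k a) (h.inv_stationary l b)))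
  have h1 : ∀ y (β : Fin 4 → Fin 4 → ℝ), hodge G y β i j = ∑ k, ∑ l, ∑ a, ∑ b,
      (1 / 2 * leviCivita i j k l) * (√|(G y).det| * ((G y)⁻¹ k a * (G y)⁻¹ l b)) * β a b := by
    intro y β
    simp only [hodge, Finset.mul_sum]
    exact Finset.sum_congr rfl fun k _ => Finset.sum_congr rfl fun l _ =>
      Finset.sum_congr rfl fun a _ => Finset.sum_congr rfl fun b _ => by ring
  simp only [h1]
  have d : ∀ k l a b, DifferentiableAt ℝ (fun y => (1 / 2 * leviCivita i j k l) *
      (√|(G y).det| * ((G y)⁻¹ k a * (G y)⁻¹ l b)) * W a b y) x :=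
    fun k l a b => (hc k l a b).differentiableAt.fun_mul (hW a b)
  rw [pd_sum fun k _ => DifferentiableAt.fun_sum fun l _ => DifferentiableAt.fun_sum fun a _ =>
    DifferentiableAt.fun_sum fun b _ => d k l a b]
  refine Finset.sum_congr rfl fun k _ => ?_
  rw [pd_sum fun l _ => DifferentiableAt.fun_sum fun a _ =>
    DifferentiableAt.fun_sum fun b _ => d k l a b]
  refine Finset.sum_congr rfl fun l _ => ?_
  rw [pd_sum fun a _ => DifferentiableAt.fun_sum fun b _ => d k l a b]
  refine Finset.sum_congr rfl fun a _ => ?_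
  rw [pd_sum fun b _ => d k l a b]
  refine Finset.sum_congr rfl fun b _ => ?_
  rw [pd_mul (hc k l a b).differentiableAt (hW a b), pd_eq_zero_of_hasFDerivAt (hc k l a b),
    zero_mul, zero_add]

end IsNormalAt

/-! ### The generalized quasi-Einstein equation near a point -/

/-- The generalized quasi-Einstein equation near `x`, with `‖∇F‖ ≠ 0` at `x`. -/
structure IsQEAt (μ : ℝ) (G : EuclideanSpace ℝ (Fin 4) → Matrix (Fin 4) (Fin 4) ℝ)
    (F L : EuclideanSpace ℝ (Fin 4) → ℝ) (x : EuclideanSpace ℝ (Fin 4)) : Prop where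
  metric : ∀ᶠ y in 𝓝 x, IsMetricAt G y
  smooth : ∀ᶠ y in 𝓝 x, ContDiffAt ℝ ∞ F y
  smooth' : ContDiffAt ℝ ∞ L x
  eq : ∀ᶠ y in 𝓝 x, ∀ i j, hessian G F i j y + ricci G i j y - μ * (pd i F y * pd j F y) =
    L y * G y i j
  gradNormSq_ne : gradNormSq G F x ≠ 0

/-- The metric `G` is self-dual (`s = 1`) or anti-self-dual (`s = -1`) near `x`. -/
def IsHalfFlatAt (s : ℝ) (G : EuclideanSpace ℝ (Fin 4) → Matrix (Fin 4) (Fin 4) ℝ)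
    (x : EuclideanSpace ℝ (Fin 4)) : Prop :=
  ∀ᶠ y in 𝓝 x, ∀ i j k l, weyl G i j k l y = s * hodge G y (fun a b => weyl G a b k l y) i j

namespace IsNormalAt

variable {ε : Fin 4 → ℝ} {G : EuclideanSpace ℝ (Fin 4) → Matrix (Fin 4) (Fin 4) ℝ}
  {x : EuclideanSpace ℝ (Fin 4)} {F L : EuclideanSpace ℝ (Fin 4) → ℝ} {s μ : ℝ}

theorem frameSelfDual (h : IsNormalAt ε G x) (hW : IsHalfFlatAt s G x) (k l : Fin 4) :
    IsFrameSelfDual ε s fun i j => frameWeyl ε (fun i j k l => riemann G i j k l x)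
      (fun i j => ricci G i j x) (scalar G x) i j k l := by
  intro i j
  simp only [← h.weyl_eq]
  rw [hW.self_of_nhds i j k l, ← h.hodge_eq]

/-- The duality of W holds in a whole neighbourhood and the star is parallel, so the relation can be
differentiated. This is what makes div W dual in its first pair of indices. -/
theorem frameSelfDual_pd (h : IsNormalAt ε G x) (hW : IsHalfFlatAt s G x) (m k l : Fin 4) :
    IsFrameSelfDual ε s fun i j => frameWeyl ε (fun i j k l => pd m (riemann G i j k l) x)
      (fun i j => pd m (ricci G i j) x) (pd m (scalar G) x) i j k l := by
  intro i j
  have hd : ∀ a b, DifferentiableAt ℝ (weyl G a b k l) x :=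
    fun a b => (h.isMetricAt.weyl_smooth a b k l).diff
  have hdh : DifferentiableAt ℝ (fun y => hodge G y (fun a b => weyl G a b k l y) i j) x := by
    simp only [hodge]
    refine (h.sqrt_det_stationary.differentiableAt.const_mul _).fun_mul ?_
    refine DifferentiableAt.fun_sum fun p _ => DifferentiableAt.fun_sum fun q _ =>
      DifferentiableAt.fun_sum fun a _ => DifferentiableAt.fun_sum fun b _ => ?_
    exact (((h.inv_stationary p a).differentiableAt.const_mul _).fun_mul
      (h.inv_stationary q b).differentiableAt).fun_mul (hd a b)
  have h1 : pd m (weyl G i j k l) x =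
      pd m (fun y => s * hodge G y (fun a b => weyl G a b k l y) i j) x :=
    pd_congr (hW.mono fun y hy => hy i j k l) m
  simp only [← h.pd_weyl]
  rw [h1, pd_const_mul hdh, h.pd_hodge hd, h.hodge_eq]

theorem hessian_eq (h : IsNormalAt ε G x) (i j : Fin 4) : hessian G F i j x = pd i (pd j F) x := by
  simp [hessian, h.christoffel_eq_zero]

/-- The Ricci identity for dF. The third derivatives of F cancel, and the antisymmetrised derivative
of the Christoffel symbols is the curvature in this sign convention. -/
theorem pd_hessian_sub (h : IsNormalAt ε G x) (hF : ContDiffAt ℝ ∞ F x) (i j k : Fin 4) :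
    pd i (hessian G F j k) x - pd j (hessian G F i k) x =
      ∑ l, ε l * (riemann G i j k l x * pd l F x) := by
  have hc : ∀ i j k, DifferentiableAt ℝ (christoffel G i j k) x :=
    fun i j k => (h.isMetricAt.christoffel_smooth i j k).diff
  have hF' : ∀ k, DifferentiableAt ℝ (pd k F) x := fun k => (contDiffAt_pd hF k).diff
  have h1 : ∀ i j k, pd i (hessian G F j k) x =
      pd i (pd j (pd k F)) x - ∑ l, pd i (christoffel G j k l) x * pd l F x := by
    intro i j k
    unfold hessian
    rw [pd_sub (contDiffAt_pd (contDiffAt_pd hF k) j).diff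
      (DifferentiableAt.fun_sum fun l _ => (hc j k l).fun_mul (hF' l)),
      pd_sum fun l _ => (hc j k l).fun_mul (hF' l)]
    simp only [pd_mul (hc _ _ _) (hF' _), h.christoffel_eq_zero, zero_mul, add_zero]
  have h2 : ∀ l, ε l * (riemann G i j k l x * pd l F x) =
      pd j (christoffel G i k l) x * pd l F x - pd i (christoffel G j k l) x * pd l F x := by
    intro l
    rw [h.riemann_eq]
    simp only [curvOp, h.christoffel_eq_zero, mul_zero, sub_zero, Finset.sum_const_zero, add_zero]
    linear_combination ((pd j (christoffel G i k l) x - pd i (christoffel G j k l) x) * pd l F x) *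
      h.unit l
  simp only [h2, Finset.sum_sub_distrib]
  rw [h1, h1, pd_comm (contDiffAt_pd hF k) i j]
  ring

theorem pd_ricci (h : IsNormalAt ε G x) (hQ : IsQEAt μ G F L x) (i j k : Fin 4) :
    pd i (ricci G j k) x = pd i L x * frameMetric ε j k +
      μ * (hessian G F i j x * pd k F x + pd j F x * hessian G F i k x) -
      pd i (hessian G F j k) x := by
  have hF := hQ.smooth.self_of_nhds
  have hF' : ∀ k, DifferentiableAt ℝ (pd k F) x := fun k => (contDiffAt_pd hF k).diff
  have hH : DifferentiableAt ℝ (hessian G F j k) x := (h.isMetricAt.hessian_smooth hF j k).diff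
  have hL := hQ.smooth'.diff
  have hg : DifferentiableAt ℝ (fun y => G y j k) x := (h.isMetricAt.smooth j k).diff
  have h1 : ricci G j k =ᶠ[𝓝 x] fun y => L y * G y j k + μ * (pd j F y * pd k F y) -
      hessian G F j k y := by
    filter_upwards [hQ.eq] with y hy
    linear_combination hy j k
  have d1 := (hF' j).fun_mul (hF' k)
  rw [pd_congr h1, pd_sub ((hL.fun_mul hg).fun_add (d1.const_mul _)) hH,
    pd_add (hL.fun_mul hg) (d1.const_mul _), pd_mul hL hg, pd_const_mul d1,
    pd_mul (hF' j) (hF' k), h.pd_eq_zero, h.eq, h.hessian_eq, h.hessian_eq]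
  ring

/-- The antisymmetrised derivative of the quasi-Einstein equation, combined with the Ricci identity.
It is the differential hypothesis of `frame_hessian`. -/
theorem pd_ricci_sub (h : IsNormalAt ε G x) (hQ : IsQEAt μ G F L x) (i j k : Fin 4) :
    pd j (ricci G i k) x - pd i (ricci G j k) x =
      pd j L x * frameMetric ε i k - pd i L x * frameMetric ε j k +
        μ * (pd i F x * hessian G F j k x - pd j F x * hessian G F i k x) +
        ∑ l, ε l * (riemann G i j k l x * pd l F x) := by
  rw [h.pd_ricci hQ, h.pd_ricci hQ, ← h.pd_hessian_sub hQ.smooth.self_of_nhds]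
  have h1 : hessian G F i j x = hessian G F j i x := by
    rw [h.hessian_eq, h.hessian_eq, pd_comm hQ.smooth.self_of_nhds]
  rw [h1]
  ring

theorem ricci_eq (h : IsNormalAt ε G x) (hQ : IsQEAt μ G F L x) (i j : Fin 4) :
    ricci G i j x = L x * frameMetric ε i j + μ * (pd i F x * pd j F x) - hessian G F i j x := by
  rw [← h.eq]
  linear_combination hQ.eq.self_of_nhds i j

theorem gradNormSq_eq (h : IsNormalAt ε G x) : gradNormSq G F x = ∑ i, ε i * (pd i F x * pd i F x) := by
  simp only [gradNormSq, h.inv_eq, mul_assoc]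
  exact sum_sum_frameMetric_mul fun i j => pd i F x * pd j F x

theorem pd_zero_ne (h : IsNormalAt ε G x) (hQ : IsQEAt μ G F L x)
    (hF : ∀ a, a ≠ 0 → pd a F x = 0) : pd 0 F x ≠ 0 := by
  intro h0
  refine hQ.gradNormSq_ne ?_
  rw [h.gradNormSq_eq]
  refine Finset.sum_eq_zero fun i _ => ?_
  by_cases hi : i = 0
  · rw [hi, h0]; ring
  · rw [hF i hi]; ring

theorem exists_hessian_eq (h : IsNormalAt ε G x) (hQ : IsQEAt μ G F L x) (hW : IsHalfFlatAt s G x)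
    (hμ : μ ≠ -1 / 2) (hF : ∀ a, a ≠ 0 → pd a F x = 0) :
    ∃ α β, ∀ i j, hessian G F i j x = α * G x i j + β * (pd i F x * pd j F x) := by
  have hF0 := h.pd_zero_ne hQ hF
  obtain ⟨h1, α, h2⟩ := frame_hessian h.unit h.isFrameCurvature h.isFrameCurvature_pd
    (fun m i j k l => h.bianchi m i j k l) (h.ricci_eq hQ) (h.pd_ricci_sub hQ) (h.frameSelfDual hW)
    (fun m k l => h.frameSelfDual_pd hW m k l) hμ hF0 hF
  -- The second coefficient is whatever makes the (0,0) component agree, which is possible since ∂₀F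
  -- ≠ 0.
  refine ⟨α, (hessian G F 0 0 x - α * ε 0) / (pd 0 F x * pd 0 F x), fun i j => ?_⟩
  have hs : hessian G F i j x = hessian G F j i x := by
    rw [h.hessian_eq, h.hessian_eq, pd_comm hQ.smooth.self_of_nhds]
  rw [h.eq]
  by_cases hi : i = 0
  · by_cases hj : j = 0
    · subst hi hj
      rw [frameMetric_self]
      field_simp
      ring
    · subst hi
      rw [hs, h1 j hj, hF j hj, frameMetric_ne (Ne.symm hj)]
      ring
  · by_cases hj : j = 0
    · subst hj
      rw [h1 i hi, hF i hi, frameMetric_ne hi]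
      ring
    · rw [h2 i j hi hj, hF i hi]
      ring

theorem pd_gradNormSq (h : IsNormalAt ε G x) (hF : ContDiffAt ℝ ∞ F x) (m : Fin 4) :
    pd m (gradNormSq G F) x = 2 * ∑ i, ε i * (hessian G F m i x * pd i F x) := by
  have hF' : ∀ k, DifferentiableAt ℝ (pd k F) x := fun k => (contDiffAt_pd hF k).diff
  have hi : ∀ i j, DifferentiableAt ℝ (fun y => (G y)⁻¹ i j) x :=
    fun i j => (h.isMetricAt.inv_smooth i j).diff
  unfold gradNormSq
  rw [pd_sum fun i _ => DifferentiableAt.fun_sum fun j _ => ((hi i j).fun_mul (hF' i)).fun_mul (hF' j)]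
  simp only [pd_sum fun j _ => ((hi _ j).fun_mul (hF' _)).fun_mul (hF' j),
    pd_mul ((hi _ _).fun_mul (hF' _)) (hF' _), pd_mul (hi _ _) (hF' _),
    pd_eq_zero_of_hasFDerivAt (h.inv_stationary _ _), h.inv_eq, zero_mul, zero_add, h.hessian_eq]
  have := sum_sum_frameMetric_mul (ε := ε) fun i j =>
    pd m (pd i F) x * pd j F x + pd i F x * pd m (pd j F) x
  simp only [mul_add, ← mul_assoc] at this ⊢
  rw [this, Finset.mul_sum]
  exact Finset.sum_congr rfl fun i _ => by ring

/-- If the Hessian of `F` is `α g + β dF ⊗ dF`, then `dα`, `dβ` and `dL` are multiples of `dF`. -/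
theorem pd_eq_zero_of_hessian_eq (h : IsNormalAt ε G x) (hQ : IsQEAt μ G F L x)
    (hF : ∀ a, a ≠ 0 → pd a F x = 0) {α β : EuclideanSpace ℝ (Fin 4) → ℝ}
    (hα : DifferentiableAt ℝ α x) (hβ : DifferentiableAt ℝ β x)
    (hH : ∀ᶠ y in 𝓝 x, ∀ i j, hessian G F i j y = α y * G y i j + β y * (pd i F y * pd j F y))
    (a : Fin 4) (ha : a ≠ 0) : pd a α x = 0 ∧ pd a β x = 0 ∧ pd a L x = 0 := by
  have hFs := hQ.smooth.self_of_nhds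
  have hF0 := h.pd_zero_ne hQ hF
  have hF' : ∀ k, DifferentiableAt ℝ (pd k F) x := fun k => (contDiffAt_pd hFs k).diff
  have hg : ∀ i j, DifferentiableAt ℝ (fun y => G y i j) x := fun i j => (h.isMetricAt.smooth i j).diff
  have hε0 : ε 0 ≠ 0 := fun h0 => by simpa [h0] using h.unit 0
  have hH0 : ∀ i j, hessian G F i j x = α x * frameMetric ε i j + β x * (pd i F x * pd j F x) := by
    intro i j
    rw [← h.eq]
    exact hH.self_of_nhds i j
  have hda : ∀ j k, pd a (hessian G F j k) x = pd a α x * frameMetric ε j k +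
      pd a β x * (pd j F x * pd k F x) +
      β x * (hessian G F a j x * pd k F x + pd j F x * hessian G F a k x) := by
    intro j k
    have d1 := (hF' j).fun_mul (hF' k)
    rw [pd_congr (hH.mono fun y hy => hy j k), pd_add (hα.fun_mul (hg j k)) (hβ.fun_mul d1),
      pd_mul hα (hg j k), pd_mul hβ d1, pd_mul (hF' j) (hF' k), h.pd_eq_zero, h.eq, h.hessian_eq,
      h.hessian_eq]
    ring
  have hdj : ∀ j k, pd j (hessian G F a k) x = pd j α x * frameMetric ε a k +
      β x * (hessian G F j a x * pd k F x) := by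
    intro j k
    have d1 := (hF' a).fun_mul (hF' k)
    rw [pd_congr (hH.mono fun y hy => hy a k), pd_add (hα.fun_mul (hg a k)) (hβ.fun_mul d1),
      pd_mul hα (hg a k), pd_mul hβ d1, pd_mul (hF' a) (hF' k), h.pd_eq_zero, h.eq, h.hessian_eq,
      hF a ha]
    ring
  have hHa : ∀ j, hessian G F a j x = α x * frameMetric ε a j := by
    intro j
    rw [hH0, hF a ha]; ring
  have hsum : ∀ X : Fin 4 → ℝ, ∑ l, ε l * (X l * pd l F x) = ε 0 * (X 0 * pd 0 F x) := by
    intro X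
    refine Finset.sum_eq_single 0 (fun b _ hb => ?_) (by simp)
    rw [hF b hb]; ring
  have hρ : ricci G a 0 x = 0 := by
    rw [h.ricci_eq hQ, hHa, hF a ha, frameMetric_ne ha]; ring
  have hz : ∀ j, hessian G F a j x * pd j F x = 0 := by
    intro j
    rw [hHa]
    by_cases hj : j = a
    · rw [hj, hF a ha, mul_zero]
    · rw [frameMetric_ne (Ne.symm hj)]; ring
  have hz' : ∀ j, hessian G F j a x * pd j F x = 0 := by
    intro j
    rw [h.hessian_eq, pd_comm hFs, ← h.hessian_eq, hz]
  -- The Ricci identity on the indices a, 0, 0, where the curvature term R_a000 vanishes.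
  have e0 : pd a α x * ε 0 + pd a β x * (pd 0 F x * pd 0 F x) = 0 := by
    have e := h.pd_hessian_sub hFs a 0 0
    have e' : riemann G a 0 0 0 x = 0 := by
      have := h.isFrameCurvature.right a 0 0 0
      linarith
    rw [hda, hdj, hsum fun l => riemann G a 0 0 l x, e', frameMetric_self, frameMetric_ne ha] at e
    linear_combination e - 2 * β x * hz 0 + β x * hz' 0
  have htr : ∑ j, ε j * pd a (hessian G F j j) x = 4 * pd a α x + pd a β x * (ε 0 * (pd 0 F x * pd 0 F x)) := by
    rw [← hsum fun l => pd l F x, ← sum_frameMetric_self h.unit, Finset.mul_sum, Finset.sum_mul,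
      ← Finset.sum_add_distrib]
    refine Finset.sum_congr rfl fun j _ => ?_
    rw [hda]
    linear_combination 2 * β x * ε j * hz j
  -- The traced Ricci identity: its right-hand side is a multiple of ρ(∂_a, ∇F), which is zero by
  -- the quasi-Einstein equation and the form of the Hessian.
  have e1 : ∑ j, ε j * (pd a (hessian G F j j) x - pd j (hessian G F a j) x) = 0 := by
    have e : ∀ j, ε j * (pd a (hessian G F j j) x - pd j (hessian G F a j) x) =
        -(ε 0 * pd 0 F x) * (ε j * riemann G a j 0 j x) := by
      intro j
      rw [h.pd_hessian_sub hFs, hsum fun l => riemann G a j j l x, h.isFrameCurvature.right a j 0 j]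
      ring
    simp only [e]
    rw [← Finset.mul_sum, ← h.isFrameCurvature.ricci, hρ, mul_zero]
  have e2 : ∑ j, ε j * pd j (hessian G F a j) x = pd a α x := by
    rw [← sum_frameMetric h.unit a fun j => pd j α x]
    refine Finset.sum_congr rfl fun j _ => ?_
    rw [hdj]
    linear_combination β x * ε j * hz' j
  simp only [mul_sub, Finset.sum_sub_distrib] at e1
  rw [e2, htr] at e1
  -- The trace gives 3 ∂_aα + ε₀ ∂_aβ (∂₀F)² = 0, while `e0` gives ∂_aα + ε₀ ∂_aβ (∂₀F)² = 0. Their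
  -- difference is 2 ∂_aα = 0.
  have hα0 : pd a α x = 0 := by
    linear_combination (1 / 2) * e1 - (1 / 2) * ε 0 * e0 + (1 / 2) * pd a α x * h.unit 0
  have hβ0 : pd a β x = 0 := by
    rw [hα0, zero_mul, zero_add] at e0
    exact (mul_eq_zero.1 e0).resolve_right (mul_ne_zero hF0 hF0)
  refine ⟨hα0, hβ0, ?_⟩
  have t1 : pd a (scalar G) x = 4 * pd a L x := by
    rw [(h.isFrameCurvature_pd a).scalar]
    have e : ∀ j, ε j * pd a (ricci G j j) x = pd a L x * (ε j * frameMetric ε j j) -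
        ε j * pd a (hessian G F j j) x := by
      intro j
      rw [h.pd_ricci hQ]
      linear_combination 2 * μ * ε j * hz j
    simp only [e, Finset.sum_sub_distrib]
    rw [← Finset.mul_sum, sum_frameMetric_self h.unit, htr, hα0, hβ0]
    ring
  have t2 : 2 * ∑ j, ε j * pd j (ricci G a j) x = pd a (scalar G) x :=
    two_mul_divergence_ricci h.isFrameCurvature_pd (fun m i j k l => h.bianchi m i j k l) a
  -- The quasi-Einstein equation gives (div ρ − dτ)_a = −3 ∂_aL and ∂_aτ = 4 ∂_aL, whereas Bianchi
  -- gives (div ρ)_a = ∂_aτ / 2. Hence −2 ∂_aL = −3 ∂_aL.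
  have t3 : ∑ j, ε j * pd j (ricci G a j) x - ∑ j, ε j * pd a (ricci G j j) x = -3 * pd a L x := by
    have e : ∀ j, ε j * pd j (ricci G a j) x - ε j * pd a (ricci G j j) x =
        ε j * (frameMetric ε a j * pd j L x) - pd a L x * (ε j * frameMetric ε j j) -
        (ε 0 * pd 0 F x) * (ε j * riemann G a j 0 j x) := by
      intro j
      have e3 := h.pd_ricci_sub hQ a j j
      rw [hsum fun l => riemann G a j j l x, h.isFrameCurvature.right a j j 0, hF a ha] at e3
      linear_combination ε j * e3 - μ * ε j * hz j
    rw [← Finset.sum_sub_distrib]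
    simp only [e, Finset.sum_sub_distrib]
    rw [sum_frameMetric h.unit a fun j => pd j L x, ← Finset.mul_sum, sum_frameMetric_self h.unit,
      ← Finset.mul_sum, ← h.isFrameCurvature.ricci, hρ]
    ring
  rw [← (h.isFrameCurvature_pd a).scalar] at t3
  linarith

end IsNormalAt

/-! ### Orthonormal frames -/

-- Since v is not null, its orthogonal complement is a nondegenerate space of dimension three. A
-- symmetric form has an orthogonal basis there, and nondegeneracy excludes null basis vectors.
open LinearMap.BilinForm in
theorem exists_orthogonal_frame {B : Matrix (Fin 4) (Fin 4) ℝ} (hs : B.IsSymm) (hd : B.det ≠ 0)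
    {v : Fin 4 → ℝ} (hv : v ⬝ᵥ B.mulVec v ≠ 0) :
    ∃ w : Fin 4 → Fin 4 → ℝ, w 0 = v ∧ (∀ i j, i ≠ j → w i ⬝ᵥ B.mulVec (w j) = 0) ∧
      ∀ i, w i ⬝ᵥ B.mulVec (w i) ≠ 0 := by
  set b := Matrix.toBilin' B with hb
  have hbn : b.Nondegenerate := (Matrix.nondegenerate_of_det_ne_zero hd).toBilin'
  have hba : ∀ x y, b x y = x ⬝ᵥ B.mulVec y := Matrix.toBilin'_apply' B
  have hbs : b.IsSymm := by
    rw [LinearMap.BilinForm.isSymm_def]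
    intro x y
    rw [hba, hba, Matrix.dotProduct_mulVec, ← Matrix.mulVec_transpose, hs.eq, dotProduct_comm]
  have hvv : b v v ≠ 0 := by rwa [hba]
  set W := b.orthogonal (Submodule.span ℝ {v}) with hW
  have hWn := restrict_nondegenerate_orthogonal_spanSingleton b hbn hbs.isRefl hvv
  have hWs : LinearMap.IsSymm (b.restrict W) :=
    ⟨fun x y => hbs.eq x y⟩
  have hfr : Module.finrank ℝ W = 3 := by
    rw [hW, finrank_orthogonal hbn, finrank_span_singleton (ne_zero_of_not_isOrtho_self v hvv)]
    simp
  obtain ⟨u, hu⟩ : ∃ u : Module.Basis (Fin 3) ℝ W, (b.restrict W).IsOrthoᵢ u :=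
    hfr ▸ exists_orthogonal_basis hWs
  have hvu : ∀ a, b v (u a) = 0 := fun a =>
    (u a).2 v (Submodule.mem_span_singleton_self v)
  refine ⟨Fin.cons v fun a => u a, rfl, fun i j => ?_, fun i => ?_⟩
  · rw [← hba]
    refine Fin.cases ?_ (fun a => ?_) i <;> refine Fin.cases ?_ (fun c => ?_) j
    · exact fun h => absurd rfl h
    · exact fun _ => hvu c
    · exact fun _ => hbs.isRefl _ _ (hvu a)
    · exact fun h => hu fun h' : a = c => h (congrArg Fin.succ h')
  · rw [← hba]
    refine Fin.cases hvv (fun a => ?_) i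
    exact iIsOrtho.not_isOrtho_basis_self_of_nondegenerate hu hWn a

/-- Normalising an orthogonal frame that starts with v. The orientation is corrected on the last
vector, so that the first column stays a positive multiple of v. -/
theorem exists_adapted_frame {B : Matrix (Fin 4) (Fin 4) ℝ} (hs : B.IsSymm) (hd : B.det ≠ 0)
    {v : Fin 4 → ℝ} (hv : v ⬝ᵥ B.mulVec v ≠ 0) :
    ∃ (ε : Fin 4 → ℝ) (P : Matrix (Fin 4) (Fin 4) ℝ), (∀ i, ε i * ε i = 1) ∧ 0 < P.det ∧
      (∀ i j, (P.transpose * B * P) i j = frameMetric ε i j) ∧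
      ∃ c, 0 < c ∧ ∀ i, P i 0 = c * v i := by
  obtain ⟨w, hw0, hw, hwn⟩ := exists_orthogonal_frame hs hd hv
  set d : Fin 4 → ℝ := fun i => w i ⬝ᵥ B.mulVec (w i) with hdd
  set Q : Matrix (Fin 4) (Fin 4) ℝ := Matrix.of fun i j => w j i with hQ
  have hQB : Q.transpose * B * Q = Matrix.diagonal d := by
    ext i j
    have h1 : (Q.transpose * B * Q) i j = w i ⬝ᵥ B.mulVec (w j) := by
      rw [Matrix.mul_assoc, Matrix.mul_apply]
      rfl
    rw [h1, Matrix.diagonal_apply]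
    split_ifs with hij
    · rw [hij]
    · exact hw i j hij
  have hQd : Q.det ≠ 0 := by
    intro h0
    have h1 := congrArg Matrix.det hQB
    rw [Matrix.det_mul, h0, mul_zero, Matrix.det_diagonal] at h1
    exact (Finset.prod_ne_zero_iff.2 fun i _ => hwn i) h1.symm
  -- The sign that makes the frame positively oriented; it is applied to the column with index 3
  -- only.
  obtain ⟨κ, hκ, hκQ⟩ : ∃ κ : ℝ, κ * κ = 1 ∧ 0 < κ * Q.det := by
    rcases lt_or_gt_of_ne hQd with h | h
    · exact ⟨-1, by norm_num, by linarith⟩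
    · exact ⟨1, by norm_num, by linarith⟩
  let c : Fin 4 → ℝ := fun i => (√|d i|)⁻¹ * if i = 3 then κ else 1
  have hsq : ∀ i, 0 < √|d i| := fun i => Real.sqrt_pos.2 (abs_pos.2 (hwn i))
  have hc2 : ∀ i, c i * c i = |d i|⁻¹ := by
    intro i
    have h1 : (√|d i|)⁻¹ * (√|d i|)⁻¹ = |d i|⁻¹ := by
      rw [← mul_inv, Real.mul_self_sqrt (abs_nonneg _)]
    simp only [c]
    split_ifs
    · linear_combination h1 * (κ * κ) + |d i|⁻¹ * hκ
    · linear_combination h1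
  refine ⟨fun i => d i / |d i|, Q * Matrix.diagonal c, fun i => ?_, ?_, fun i j => ?_, c 0, ?_,
    fun i => ?_⟩
  · have := abs_pos.2 (hwn i)
    rw [div_mul_div_comm, abs_mul_abs_self, div_self (mul_ne_zero (hwn i) (hwn i))]
  · rw [Matrix.det_mul, Matrix.det_diagonal]
    have h1 : ∏ i, c i = κ * ∏ i, (√|d i|)⁻¹ := by
      simp only [c, Finset.prod_mul_distrib]
      simp [mul_comm]
    rw [h1]
    have h2 : 0 < ∏ i, (√|d i|)⁻¹ := Finset.prod_pos fun i _ => inv_pos.2 (hsq i)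
    nlinarith [mul_pos hκQ h2]
  · have h1 : (Q * Matrix.diagonal c).transpose * B * (Q * Matrix.diagonal c) =
        Matrix.diagonal c * (Q.transpose * B * Q) * Matrix.diagonal c := by
      simp only [Matrix.transpose_mul, Matrix.diagonal_transpose, Matrix.mul_assoc]
    rw [h1, hQB, Matrix.diagonal_mul_diagonal, Matrix.diagonal_mul_diagonal, Matrix.diagonal_apply,
      frameMetric]
    split_ifs
    · rw [div_eq_mul_inv, ← hc2]; ring
    · rfl
  · simp only [c]
    simpa using abs_pos.2 (hwn 0)
  · rw [Matrix.mul_diagonal, hQ, Matrix.of_apply, hw0, mul_comm]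

/-! ### Local diffeomorphisms -/

section Diffeo

variable {n : ℕ} {φ : EuclideanSpace ℝ (Fin n) → EuclideanSpace ℝ (Fin n)}
  {x : EuclideanSpace ℝ (Fin n)}

theorem det_fderiv (hφ : DifferentiableAt ℝ φ x) : (fderiv ℝ φ x).det = (jac φ x).det := by
  rw [ContinuousLinearMap.det, ← LinearMap.det_toMatrix (EuclideanSpace.basisFun (Fin n) ℝ).toBasis]
  congr 1
  ext a i
  rw [LinearMap.toMatrix_apply, jac_apply, pd]
  have := fderiv_coord hφ a (EuclideanSpace.single i 1)
  simp [this]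

theorem contDiffAt_det_jac (hφ : ContDiffAt ℝ ∞ φ x) : ContDiffAt ℝ ∞ (fun y => (jac φ y).det) x :=
  contDiffAt_det fun a i => contDiffAt_jac hφ a i

/-- A smooth local diffeomorphism of `ℝⁿ`. -/
structure IsDiffeo (ψ : OpenPartialHomeomorph (EuclideanSpace ℝ (Fin n)) (EuclideanSpace ℝ (Fin n))) :
    Prop where
  smooth : ∀ y ∈ ψ.source, ContDiffAt ℝ ∞ ψ y
  smooth_symm : ∀ y ∈ ψ.target, ContDiffAt ℝ ∞ ψ.symm y
  det_ne : ∀ y ∈ ψ.source, (jac ψ y).det ≠ 0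

/-- The inverse function theorem. -/
theorem exists_isDiffeo (hφ : ∀ᶠ y in 𝓝 x, ContDiffAt ℝ ∞ φ y) (hJ : (jac φ x).det ≠ 0)
    {S : Set (EuclideanSpace ℝ (Fin n))} (hS : S ∈ 𝓝 x) :
    ∃ ψ : OpenPartialHomeomorph (EuclideanSpace ℝ (Fin n)) (EuclideanSpace ℝ (Fin n)),
      IsDiffeo ψ ∧ x ∈ ψ.source ∧ (∀ y, ψ y = φ y) ∧ ψ.source ⊆ S := by
  have hx := hφ.self_of_nhds
  have hdet : ∀ᶠ y in 𝓝 x, (jac φ y).det ≠ 0 := (contDiffAt_det_jac hx).continuousAt.eventually_ne hJ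
  have hd : (fderiv ℝ φ x).det ≠ 0 := by rwa [det_fderiv hx.diff]
  have hf' : HasFDerivAt φ (((fderiv ℝ φ x).toContinuousLinearEquivOfDetNeZero hd :
      EuclideanSpace ℝ (Fin n) ≃L[ℝ] EuclideanSpace ℝ (Fin n)) :
      EuclideanSpace ℝ (Fin n) →L[ℝ] EuclideanSpace ℝ (Fin n)) x := by
    rw [ContinuousLinearMap.coe_toContinuousLinearEquivOfDetNeZero]
    exact hx.diff.hasFDerivAt
  obtain ⟨U, hU, hUo, hxU⟩ := eventually_nhds_iff.1 ((hφ.and hdet).and hS)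
  let ψ := (hx.toOpenPartialHomeomorph φ hf' (by simp)).restrOpen U hUo
  have hψ : ∀ y ∈ ψ.source, y ∈ U := fun y hy => hy.2
  refine ⟨ψ, ⟨fun y hy => (hU y (hψ y hy)).1.1, fun y hy => ?_, fun y hy => (hU y (hψ y hy)).1.2⟩,
    ⟨hx.mem_toOpenPartialHomeomorph_source hf' (by simp), hxU⟩, fun y => rfl,
    fun y hy => (hU y (hψ y hy)).2⟩
  have hy' := hU _ (hψ _ (ψ.map_target hy))
  have hd' : (fderiv ℝ φ (ψ.symm y)).det ≠ 0 := by rw [det_fderiv hy'.1.1.diff]; exact hy'.1.2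
  refine ψ.contDiffAt_symm hy (f₀' := (fderiv ℝ φ (ψ.symm y)).toContinuousLinearEquivOfDetNeZero hd')
    ?_ hy'.1.1
  rw [ContinuousLinearMap.coe_toContinuousLinearEquivOfDetNeZero]
  exact hy'.1.1.diff.hasFDerivAt

end Diffeo

/-! ### Existence of normal coordinates -/

section Linear

variable {n : ℕ}

/-- A linear form with given coefficients. -/
def linForm (p : Fin n → ℝ) (y : EuclideanSpace ℝ (Fin n)) : ℝ := ∑ i, p i * y i

theorem contDiff_coordinate (i : Fin n) : ContDiff ℝ ∞ fun y : EuclideanSpace ℝ (Fin n) => y i :=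
  (EuclideanSpace.proj (𝕜 := ℝ) i : EuclideanSpace ℝ (Fin n) →L[ℝ] ℝ).contDiff

theorem pd_coordinate (i k : Fin n) (x : EuclideanSpace ℝ (Fin n)) :
    pd k (fun y : EuclideanSpace ℝ (Fin n) => y i) x = if i = k then 1 else 0 := by
  have h := (EuclideanSpace.proj (𝕜 := ℝ) i : EuclideanSpace ℝ (Fin n) →L[ℝ] ℝ).fderiv (x := x)
  have h2 : (⇑(EuclideanSpace.proj (𝕜 := ℝ) i : EuclideanSpace ℝ (Fin n) →L[ℝ] ℝ)) =
    fun y => y i := rfl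
  rw [h2] at h
  rw [pd, h]
  simp

theorem contDiff_linForm (p : Fin n → ℝ) : ContDiff ℝ ∞ (linForm p) :=
  ContDiff.sum fun i _ => contDiff_const.mul (contDiff_coordinate i)

theorem pd_linForm (p : Fin n → ℝ) (k : Fin n) (x : EuclideanSpace ℝ (Fin n)) :
    pd k (linForm p) x = p k := by
  have hd : ∀ i, DifferentiableAt ℝ (fun y : EuclideanSpace ℝ (Fin n) => y i) x :=
    fun i => (contDiff_coordinate i).contDiffAt.diff
  unfold linForm
  rw [pd_sum fun i _ => (hd i).const_mul _]
  simp only [pd_const_mul (hd _), pd_coordinate]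
  simp

theorem linForm_zero (p : Fin n → ℝ) : linForm p 0 = 0 := by simp [linForm]

/-- The map `y ↦ x + P y - Γ(P y, P y) / 2`. -/
def quadraticMap (x : EuclideanSpace ℝ (Fin n)) (P : Matrix (Fin n) (Fin n) ℝ)
    (Γ : Fin n → Fin n → Fin n → ℝ) (y : EuclideanSpace ℝ (Fin n)) : EuclideanSpace ℝ (Fin n) :=
  WithLp.toLp 2 fun a => x a + linForm (P a) y -
    (1 / 2) * ∑ b, ∑ c, Γ b c a * (linForm (P b) y * linForm (P c) y)

variable {x : EuclideanSpace ℝ (Fin n)} {P : Matrix (Fin n) (Fin n) ℝ}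
  {Γ : Fin n → Fin n → Fin n → ℝ}

theorem quadraticMap_zero : quadraticMap x P Γ 0 = x := by
  ext a
  simp [quadraticMap, linForm_zero]

theorem contDiff_quadraticMap : ContDiff ℝ ∞ (quadraticMap x P Γ) := by
  rw [contDiff_euclidean]
  intro a
  exact (contDiff_const.add (contDiff_linForm _)).sub (contDiff_const.mul
    (ContDiff.sum fun b _ => ContDiff.sum fun c _ => contDiff_const.mul
      ((contDiff_linForm _).mul (contDiff_linForm _))))

theorem jac_quadraticMap (y : EuclideanSpace ℝ (Fin n)) (a k : Fin n) :
    jac (quadraticMap x P Γ) y a k = P a k -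
      (1 / 2) * ∑ b, ∑ c, Γ b c a * (P b k * linForm (P c) y + linForm (P b) y * P c k) := by
  have hd : ∀ p : Fin n → ℝ, DifferentiableAt ℝ (linForm p) y :=
    fun p => (contDiff_linForm p).contDiffAt.diff
  have hd2 : ∀ b c, DifferentiableAt ℝ (fun y => Γ b c a * (linForm (P b) y * linForm (P c) y)) y :=
    fun b c => ((hd _).fun_mul (hd _)).const_mul _
  rw [jac_apply]
  simp only [quadraticMap]
  rw [pd_sub ((differentiableAt_const _).fun_add (hd _)) ((DifferentiableAt.fun_sum fun b _ =>
    DifferentiableAt.fun_sum fun c _ => hd2 b c).const_mul _), pd_add (differentiableAt_const _) (hd _),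
    pd_const, pd_linForm, pd_const_mul (DifferentiableAt.fun_sum fun b _ =>
    DifferentiableAt.fun_sum fun c _ => hd2 b c), pd_sum fun b _ =>
    DifferentiableAt.fun_sum fun c _ => hd2 b c]
  simp only [pd_sum fun c _ => hd2 _ c, pd_const_mul ((hd _).fun_mul (hd _)), pd_mul (hd _) (hd _),
    pd_linForm, zero_add]

theorem jac_quadraticMap_zero : jac (quadraticMap x P Γ) 0 = P := by
  ext a k
  simp [jac_quadraticMap, linForm_zero]

theorem pd_jac_quadraticMap (hΓ : ∀ b c a, Γ b c a = Γ c b a) (a k m : Fin n)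
    (y : EuclideanSpace ℝ (Fin n)) :
    pd m (fun y => jac (quadraticMap x P Γ) y a k) y = -∑ b, ∑ c, P b m * P c k * Γ b c a := by
  have hd : ∀ p : Fin n → ℝ, DifferentiableAt ℝ (linForm p) y :=
    fun p => (contDiff_linForm p).contDiffAt.diff
  have hd2 : ∀ b c, DifferentiableAt ℝ
      (fun y => Γ b c a * (P b k * linForm (P c) y + linForm (P b) y * P c k)) y :=
    fun b c => (((hd _).const_mul _).fun_add ((hd _).mul_const _)).const_mul _
  simp only [jac_quadraticMap]
  rw [pd_sub (differentiableAt_const _) ((DifferentiableAt.fun_sum fun b _ =>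
    DifferentiableAt.fun_sum fun c _ => hd2 b c).const_mul _), pd_const,
    pd_const_mul (DifferentiableAt.fun_sum fun b _ =>
    DifferentiableAt.fun_sum fun c _ => hd2 b c), pd_sum fun b _ =>
    DifferentiableAt.fun_sum fun c _ => hd2 b c]
  simp only [pd_sum fun c _ => hd2 _ c,
    pd_const_mul (((hd _).const_mul _).fun_add ((hd _).mul_const _)),
    pd_add ((hd _).const_mul _) ((hd _).mul_const _), pd_mul (hd _) (differentiableAt_const _), pd_const_mul (hd _),
    pd_const, pd_linForm, mul_zero, add_zero]
  have h1 : ∑ b, ∑ c, Γ b c a * (P b k * P c m) = ∑ b, ∑ c, P b m * P c k * Γ b c a := by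
    rw [Finset.sum_comm]
    exact Finset.sum_congr rfl fun b _ => Finset.sum_congr rfl fun c _ => by rw [hΓ c b]; ring
  have h2 : ∑ b, ∑ c, Γ b c a * (P b m * P c k) = ∑ b, ∑ c, P b m * P c k * Γ b c a :=
    Finset.sum_congr rfl fun b _ => Finset.sum_congr rfl fun c _ => by ring
  simp only [mul_add, Finset.sum_add_distrib]
  rw [h1, h2]
  ring

end Linear

/-- The linear part P makes the metric orthonormal at the centre, and the quadratic term −Γ(Py,
Py)/2 cancels the Christoffel symbols there. No geodesics are needed, since only first derivatives
of the metric must vanish. Positivity of det P keeps the chart oriented. -/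
theorem exists_normal_chart {G : EuclideanSpace ℝ (Fin 4) → Matrix (Fin 4) (Fin 4) ℝ}
    {x : EuclideanSpace ℝ (Fin 4)} (hG : ∀ᶠ y in 𝓝 x, IsMetricAt G y) {ε : Fin 4 → ℝ}
    {P : Matrix (Fin 4) (Fin 4) ℝ} (hε : ∀ i, ε i * ε i = 1) (hP : 0 < P.det)
    (hPG : ∀ i j, (P.transpose * G x * P) i j = frameMetric ε i j)
    {S : Set (EuclideanSpace ℝ (Fin 4))} (hS : S ∈ 𝓝 x) :
    ∃ ψ : OpenPartialHomeomorph (EuclideanSpace ℝ (Fin 4)) (EuclideanSpace ℝ (Fin 4)),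
      IsDiffeo ψ ∧ 0 ∈ ψ.source ∧ ψ 0 = x ∧ jac ψ 0 = P ∧ ψ.target ⊆ S ∧
      (∀ y ∈ ψ.source, 0 < (jac ψ y).det) ∧ IsNormalAt ε (pullback ψ G) 0 := by
  set φ := quadraticMap x P fun b c a => christoffel G b c a x with hφd
  have hφ : ∀ y, ContDiffAt ℝ ∞ φ y := fun y => contDiff_quadraticMap.contDiffAt
  have hφ0 : φ 0 = x := quadraticMap_zero
  have hJ0 : jac φ 0 = P := jac_quadraticMap_zero
  have hx := hG.self_of_nhds
  have hT : {y | φ y ∈ S ∧ 0 < (jac φ y).det} ∈ 𝓝 0 := by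
    refine ((hφ 0).continuousAt.eventually_mem (by rwa [hφ0])).and ?_
    exact (contDiffAt_det_jac (hφ 0)).continuousAt.eventually
      (lt_mem_nhds (show 0 < (jac φ 0).det by rwa [hJ0]))
  obtain ⟨ψ, hψ, h0, hψφ, hψT⟩ := exists_isDiffeo (Eventually.of_forall hφ)
    (by rw [hJ0]; exact hP.ne') hT
  have hψe : (ψ : EuclideanSpace ℝ (Fin 4) → EuclideanSpace ℝ (Fin 4)) = φ := funext hψφ
  refine ⟨ψ, hψ, h0, by rw [hψφ, hφ0], by rw [hψe, hJ0], fun y hy => ?_, fun y hy => ?_, ?_⟩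
  · have := (hψT (ψ.map_target hy)).1
    rwa [← hψφ, ψ.right_inv hy] at this
  · rw [hψe]
    exact (hψT hy).2
  · rw [hψe] at *
    have hd0 : (jac φ 0).det ≠ 0 := by rw [hJ0]; exact hP.ne'
    have hm : ∀ᶠ y in 𝓝 0, IsMetricAt (pullback φ G) y := by
      filter_upwards [(hφ 0).continuousAt.eventually
        (show ∀ᶠ z in 𝓝 (φ 0), IsMetricAt G z by rwa [hφ0]),
        (contDiffAt_det_jac (hφ 0)).continuousAt.eventually_ne hd0] with y h1 h2
      exact IsMetricAt.pullback h1 (hφ y) h2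
    -- The transformation law at the centre: the second derivatives of the quadratic map are exactly
    -- minus the old Christoffel symbols evaluated on P.
    have hΓ : ∀ i j k, christoffel (pullback φ G) i j k 0 = 0 := by
      intro i j
      have h1 : P.mulVec (fun k => christoffel (pullback φ G) i j k 0) = 0 := by
        funext d
        have h2 := sum_jac_mul_christoffel_pullback (φ := φ) (x := 0) (by rwa [hφ0]) (hφ 0) hd0 i j d
        rw [pd_jac_quadraticMap fun b c a => hx.christoffel_symm b c a] at h2
        simp only [hJ0, hφ0, neg_add_cancel] at h2
        exact h2
      have h3 := Matrix.eq_zero_of_mulVec_eq_zero hP.ne' h1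
      exact fun k => congrFun h3 k
    refine ⟨hm, hε, fun i j => ?_, fun k i j => ?_⟩
    · rw [pullback, hJ0, hφ0, hPG]
    · rw [hm.self_of_nhds.pd_metric, ← hm.self_of_nhds.sum_christoffel_mul,
        ← hm.self_of_nhds.sum_christoffel_mul]
      simp [hΓ]

/-! ### The differential equations satisfied by `F` -/

/-- The generalized quasi-Einstein equation with `‖∇F‖ ≠ 0` for a half conformally flat metric, in
all coordinates (resp. in all positively oriented coordinates). -/
structure IsQEOn (μ s : ℝ) (G : EuclideanSpace ℝ (Fin 4) → Matrix (Fin 4) (Fin 4) ℝ)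
    (F L : EuclideanSpace ℝ (Fin 4) → ℝ) (V : Set (EuclideanSpace ℝ (Fin 4))) : Prop where
  isOpen : IsOpen V
  qe : ∀ x ∈ V, IsQEAt μ G F L x
  pullback_qe : ∀ ψ : OpenPartialHomeomorph (EuclideanSpace ℝ (Fin 4)) (EuclideanSpace ℝ (Fin 4)),
    IsDiffeo ψ → ψ.target ⊆ V → ∀ y ∈ ψ.source,
      IsQEAt μ (pullback ψ G) (fun y => F (ψ y)) (fun y => L (ψ y)) y
  pullback_halfFlat : ∀ ψ : OpenPartialHomeomorph (EuclideanSpace ℝ (Fin 4))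
    (EuclideanSpace ℝ (Fin 4)), IsDiffeo ψ → ψ.target ⊆ V → (∀ y ∈ ψ.source, 0 < (jac ψ y).det) →
      ∀ y ∈ ψ.source, IsHalfFlatAt s (pullback ψ G) y

/-- Orthonormal normal coordinates adapted to the gradient of `F`. -/
structure IsAdaptedChart (G : EuclideanSpace ℝ (Fin 4) → Matrix (Fin 4) (Fin 4) ℝ)
    (F : EuclideanSpace ℝ (Fin 4) → ℝ) (x : EuclideanSpace ℝ (Fin 4)) (ε : Fin 4 → ℝ)
    (ψ : OpenPartialHomeomorph (EuclideanSpace ℝ (Fin 4)) (EuclideanSpace ℝ (Fin 4))) : Prop where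
  isDiffeo : IsDiffeo ψ
  mem : 0 ∈ ψ.source
  zero : ψ 0 = x
  det_pos : ∀ y ∈ ψ.source, 0 < (jac ψ y).det
  isNormalAt : IsNormalAt ε (pullback ψ G) 0
  pd_eq_zero : ∀ a, a ≠ 0 → pd a (fun y => F (ψ y)) 0 = 0

section Laws

variable {μ s : ℝ} {G : EuclideanSpace ℝ (Fin 4) → Matrix (Fin 4) (Fin 4) ℝ}
  {F L : EuclideanSpace ℝ (Fin 4) → ℝ} {V : Set (EuclideanSpace ℝ (Fin 4))}
  {x : EuclideanSpace ℝ (Fin 4)}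

/-- The components of the gradient of `F`. -/
def grad (G : EuclideanSpace ℝ (Fin 4) → Matrix (Fin 4) (Fin 4) ℝ)
    (F : EuclideanSpace ℝ (Fin 4) → ℝ) (x : EuclideanSpace ℝ (Fin 4)) : Fin 4 → ℝ :=
  (G x)⁻¹.mulVec fun i => pd i F x

theorem mulVec_grad (hG : (G x).det ≠ 0) : (G x).mulVec (grad G F x) = fun i => pd i F x := by
  rw [grad, Matrix.mulVec_mulVec, Matrix.mul_nonsing_inv _ (isUnit_iff_ne_zero.2 hG),
    Matrix.one_mulVec]

theorem grad_dotProduct (hG : (G x).det ≠ 0) :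
    grad G F x ⬝ᵥ (G x).mulVec (grad G F x) = gradNormSq G F x := by
  rw [mulVec_grad hG, gradNormSq_eq, grad, dotProduct_comm]

/-- The remaining vectors of a frame adapted to σ∇F are orthogonal to ∇F, so they lie in the kernel
of dF. The factor σ allows the first vector to be aligned with ∇F itself or with ∇F/‖∇F‖², whose
direction differs when the norm is negative. -/
theorem IsQEAt.exists_frame (h : IsQEAt μ G F L x) (σ : ℝ) (hσ : σ ≠ 0) :
    ∃ (ε : Fin 4 → ℝ) (P : Matrix (Fin 4) (Fin 4) ℝ), (∀ i, ε i * ε i = 1) ∧ 0 < P.det ∧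
      (∀ i j, (P.transpose * G x * P) i j = frameMetric ε i j) ∧
      (∃ c, 0 < c ∧ ∀ i, P i 0 = c * (σ * grad G F x i)) ∧
      ∀ a, a ≠ 0 → ∑ i, pd i F x * P i a = 0 := by
  have hG := h.metric.self_of_nhds
  obtain ⟨ε, P, hε, hP, hPG, c, hc, hPc⟩ := exists_adapted_frame hG.symm.self_of_nhds hG.nondeg
    (v := σ • grad G F x) (by
      rw [Matrix.mulVec_smul, dotProduct_smul, smul_dotProduct, grad_dotProduct hG.nondeg]
      exact smul_ne_zero hσ (smul_ne_zero hσ h.gradNormSq_ne))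
  refine ⟨ε, P, hε, hP, hPG, ⟨c, hc, hPc⟩, fun a ha => ?_⟩
  have h1 := hPG a 0
  rw [frameMetric_ne ha, Matrix.mul_assoc, Matrix.mul_apply] at h1
  have h2 : ∀ i, (G x * P) i 0 = c * σ * pd i F x := by
    intro i
    rw [← congrFun (mulVec_grad (F := F) hG.nondeg) i]
    simp only [Matrix.mul_apply, Matrix.mulVec, dotProduct, Finset.mul_sum]
    refine Finset.sum_congr rfl fun j _ => ?_
    rw [hPc j, Pi.smul_apply, smul_eq_mul]
    ring
  simp only [h2, Matrix.transpose_apply] at h1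
  have h3 : c * σ * ∑ i, pd i F x * P i a = 0 := by
    rw [← h1, Finset.mul_sum]
    exact Finset.sum_congr rfl fun i _ => by ring
  exact (mul_eq_zero.1 h3).resolve_left (mul_ne_zero hc.ne' hσ)

theorem IsQEOn.exists_adapted_chart (h : IsQEOn μ s G F L V) (hx : x ∈ V) :
    ∃ ε ψ, IsAdaptedChart G F x ε ψ ∧ ψ.target ⊆ V := by
  have hq := h.qe x hx
  obtain ⟨ε, P, hε, hP, hPG, -, hPF⟩ := hq.exists_frame 1 one_ne_zero
  obtain ⟨ψ, h1, h2, h3, h4, h5, h6, h7⟩ := exists_normal_chart hq.metric hε hP hPG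
    (h.isOpen.mem_nhds hx)
  refine ⟨ε, ψ, ⟨h1, h2, h3, h6, h7, fun a ha => ?_⟩, h5⟩
  have hF : ContDiffAt ℝ ∞ F (ψ 0) := by rw [h3]; exact hq.smooth.self_of_nhds
  rw [pd_comp_jac hF (h1.smooth 0 h2), h3, h4]
  exact hPF a ha

theorem eq_zero_of_congruence {n : ℕ} {J T : Matrix (Fin n) (Fin n) ℝ} (hJ : J.det ≠ 0)
    (h : ∀ i j, ∑ a, ∑ b, J a i * J b j * T a b = 0) : T = 0 := by
  have h1 : J.transpose * T * J = 0 := by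
    ext i j
    rw [Matrix.zero_apply, ← h i j, Finset.sum_comm]
    simp only [Matrix.mul_apply, Matrix.transpose_apply, Finset.sum_mul]
    exact Finset.sum_congr rfl fun a _ => Finset.sum_congr rfl fun b _ => by ring
  have hu : IsUnit J.det := isUnit_iff_ne_zero.2 hJ
  have hu' : IsUnit J.transpose.det := by rwa [Matrix.det_transpose]
  have h2 : J.transpose⁻¹ * (J.transpose * T * J) * J⁻¹ = T := by
    rw [Matrix.mul_assoc, Matrix.mul_assoc, Matrix.mul_nonsing_inv _ hu, Matrix.mul_one,
      ← Matrix.mul_assoc, Matrix.nonsing_inv_mul _ hu', Matrix.one_mul]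
  rw [← h2, h1, Matrix.mul_zero, Matrix.zero_mul]

theorem sum_sum_congruence {n : ℕ} {J T : Matrix (Fin n) (Fin n) ℝ} {v : Fin n → ℝ} (α β : ℝ)
    (i j : Fin n) :
    ∑ a, ∑ b, J a i * J b j * (α * T a b + β * (v a * v b)) =
      α * ∑ a, ∑ b, J a i * J b j * T a b + β * ((∑ a, v a * J a i) * ∑ b, v b * J b j) := by
  rw [Finset.sum_mul_sum]
  simp only [Finset.mul_sum, ← Finset.sum_add_distrib]
  exact Finset.sum_congr rfl fun a _ => Finset.sum_congr rfl fun b _ => by ring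

theorem hessian_pullback_eq {φ : EuclideanSpace ℝ (Fin 4) → EuclideanSpace ℝ (Fin 4)}
    {y : EuclideanSpace ℝ (Fin 4)} (hφ : ∀ᶠ z in 𝓝 y, ContDiffAt ℝ ∞ φ z)
    (hJ : (jac φ y).det ≠ 0) (h : IsMetricAt G (φ y)) (hF : ∀ᶠ z in 𝓝 (φ y), ContDiffAt ℝ ∞ F z)
    {α β : ℝ} (hH : ∀ i j, hessian G F i j (φ y) = α * G (φ y) i j +
      β * (pd i F (φ y) * pd j F (φ y))) (i j : Fin 4) :
    hessian (pullback φ G) (fun y => F (φ y)) i j y = α * pullback φ G y i j +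
      β * (pd i (fun y => F (φ y)) y * pd j (fun y => F (φ y)) y) := by
  rw [hessian_pullback h hφ.self_of_nhds hJ hF.self_of_nhds hF hφ, pullback_apply,
    pd_comp_jac hF.self_of_nhds hφ.self_of_nhds, pd_comp_jac hF.self_of_nhds hφ.self_of_nhds,
    ← sum_sum_congruence]
  simp only [hH]

theorem IsDiffeo.eventually {n : ℕ}
    {ψ : OpenPartialHomeomorph (EuclideanSpace ℝ (Fin n)) (EuclideanSpace ℝ (Fin n))}
    (h : IsDiffeo ψ) {y : EuclideanSpace ℝ (Fin n)} (hy : y ∈ ψ.source) :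
    ∀ᶠ z in 𝓝 y, ContDiffAt ℝ ∞ ψ z :=
  (ψ.open_source.eventually_mem hy).mono fun z hz => h.smooth z hz

/-- The Hessian of `F` is a combination of `g` and `dF ⊗ dF`. -/
theorem IsQEOn.exists_hessian_eq (h : IsQEOn μ s G F L V) (hμ : μ ≠ -1 / 2) (hx : x ∈ V) :
    ∃ α β, ∀ i j, hessian G F i j x = α * G x i j + β * (pd i F x * pd j F x) := by
  obtain ⟨ε, ψ, hψ, hV⟩ := h.exists_adapted_chart hx
  have hq := h.qe x hx
  obtain ⟨α, β, hαβ⟩ := hψ.isNormalAt.exists_hessian_eq (h.pullback_qe ψ hψ.isDiffeo hV 0 hψ.mem)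
    (h.pullback_halfFlat ψ hψ.isDiffeo hV hψ.det_pos 0 hψ.mem) hμ hψ.pd_eq_zero
  refine ⟨α, β, fun i j => ?_⟩
  have hJ := hψ.isDiffeo.det_ne 0 hψ.mem
  have hφ := hψ.isDiffeo.smooth 0 hψ.mem
  have h0 := hψ.zero
  have hF : ContDiffAt ℝ ∞ F (ψ 0) := by rw [h0]; exact hq.smooth.self_of_nhds
  -- Both sides are tensors, so the identity found in the adapted chart returns to the original
  -- coordinates through the invertible Jacobian.
  have h1 := eq_zero_of_congruence (J := jac ψ 0) (T := Matrix.of fun a b =>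
    hessian G F a b x - (α * G x a b + β * (pd a F x * pd b F x))) hJ (fun i j => by
      have h2 := hαβ i j
      rw [hessian_pullback (by rw [h0]; exact hq.metric.self_of_nhds) hφ hJ hF
        (by rw [h0]; exact hq.smooth) (hψ.isDiffeo.eventually hψ.mem), pullback_apply,
        pd_comp_jac hF hφ, pd_comp_jac hF hφ, ← sum_sum_congruence, h0] at h2
      simp only [Matrix.of_apply, mul_sub, Finset.sum_sub_distrib]
      rw [h2, sub_self])
  have h3 := congrFun (congrFun h1 i) j
  simp only [Matrix.of_apply, Matrix.zero_apply] at h3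
  linarith

/-- In the adapted chart both differentials have only a first component at the centre, so they are
proportional. Proportionality of covectors survives the change of coordinates. -/
theorem IsAdaptedChart.exists_pd_eq {ε : Fin 4 → ℝ}
    {ψ : OpenPartialHomeomorph (EuclideanSpace ℝ (Fin 4)) (EuclideanSpace ℝ (Fin 4))}
    (hψ : IsAdaptedChart G F x ε ψ) (hF : DifferentiableAt ℝ F x)
    (hF0 : pd 0 (fun y => F (ψ y)) 0 ≠ 0) {Φ : EuclideanSpace ℝ (Fin 4) → ℝ}
    (hΦ : DifferentiableAt ℝ Φ x) (h : ∀ a, a ≠ 0 → pd a (fun y => Φ (ψ y)) 0 = 0) :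
    ∃ c, ∀ i, pd i Φ x = c * pd i F x := by
  have hJ := hψ.isDiffeo.det_ne 0 hψ.mem
  have hφ := (hψ.isDiffeo.smooth 0 hψ.mem).diff
  have h0 := hψ.zero
  refine ⟨pd 0 (fun y => Φ (ψ y)) 0 / pd 0 (fun y => F (ψ y)) 0, fun i => ?_⟩
  set c := pd 0 (fun y => Φ (ψ y)) 0 / pd 0 (fun y => F (ψ y)) 0 with hc
  have h1 : ∀ a, pd a (fun y => Φ (ψ y)) 0 = c * pd a (fun y => F (ψ y)) 0 := by
    intro a
    by_cases ha : a = 0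
    · rw [ha, hc, div_mul_cancel₀ _ hF0]
    · rw [h a ha, hψ.pd_eq_zero a ha, mul_zero]
  have h2 : (jac ψ 0).transpose.mulVec (fun i => pd i Φ x - c * pd i F x) = 0 := by
    funext a
    have h3 := h1 a
    rw [pd_comp (by rwa [h0]) hφ, pd_comp (by rwa [h0]) hφ, h0, Finset.mul_sum, ← sub_eq_zero,
      ← Finset.sum_sub_distrib] at h3
    rw [Pi.zero_apply, ← h3]
    simp only [Matrix.mulVec, dotProduct, Matrix.transpose_apply, jac_apply]
    exact Finset.sum_congr rfl fun b _ => by ring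
  have h3 := congrFun (Matrix.eq_zero_of_mulVec_eq_zero (by rwa [Matrix.det_transpose]) h2) i
  simp only [Pi.zero_apply] at h3
  linarith

/-- The differential of `‖∇F‖²` is a multiple of `dF`. -/
theorem IsQEOn.exists_pd_gradNormSq_eq (h : IsQEOn μ s G F L V) (hμ : μ ≠ -1 / 2) (hx : x ∈ V) :
    ∃ c, ∀ i, pd i (gradNormSq G F) x = c * pd i F x := by
  obtain ⟨ε, ψ, hψ, hV⟩ := h.exists_adapted_chart hx
  have hq := h.qe x hx
  have hq' := h.pullback_qe ψ hψ.isDiffeo hV 0 hψ.mem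
  have hF' := hq'.smooth.self_of_nhds
  obtain ⟨α, β, hαβ⟩ := hψ.isNormalAt.exists_hessian_eq hq'
    (h.pullback_halfFlat ψ hψ.isDiffeo hV hψ.det_pos 0 hψ.mem) hμ hψ.pd_eq_zero
  refine hψ.exists_pd_eq hq.smooth.self_of_nhds.diff (hψ.isNormalAt.pd_zero_ne hq' hψ.pd_eq_zero)
    (hq.metric.self_of_nhds.gradNormSq_smooth hq.smooth.self_of_nhds).diff fun a ha => ?_
  have h1 : (fun y => gradNormSq G F (ψ y)) =ᶠ[𝓝 0]
      gradNormSq (pullback ψ G) fun y => F (ψ y) := by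
    filter_upwards [ψ.open_source.eventually_mem hψ.mem] with y hy
    exact (gradNormSq_pullback (hψ.isDiffeo.smooth y hy) (hψ.isDiffeo.det_ne y hy)
      (h.qe _ (hV (ψ.map_source hy))).smooth.self_of_nhds).symm
  rw [pd_congr h1, hψ.isNormalAt.pd_gradNormSq hF']
  rw [Finset.sum_eq_zero, mul_zero]
  intro i _
  rw [hαβ, hψ.isNormalAt.eq, hψ.pd_eq_zero a ha]
  by_cases hi : i = 0
  · rw [hi, frameMetric_ne ha]; ring
  · rw [hψ.pd_eq_zero i hi]; ring

/-- If the Hessian of `F` is `α g + β dF ⊗ dF`, then `dα`, `dβ` and `dL` are multiples of `dF`. -/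
theorem IsQEOn.exists_pd_eq_of_hessian_eq (h : IsQEOn μ s G F L V) (hx : x ∈ V)
    {α β : EuclideanSpace ℝ (Fin 4) → ℝ} (hα : DifferentiableAt ℝ α x) (hβ : DifferentiableAt ℝ β x)
    (hH : ∀ᶠ y in 𝓝 x, ∀ i j, hessian G F i j y = α y * G y i j + β y * (pd i F y * pd j F y)) :
    (∃ c, ∀ i, pd i α x = c * pd i F x) ∧ (∃ c, ∀ i, pd i β x = c * pd i F x) ∧
      ∃ c, ∀ i, pd i L x = c * pd i F x := by
  obtain ⟨ε, ψ, hψ, hV⟩ := h.exists_adapted_chart hx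
  have hq := h.qe x hx
  have hq' := h.pullback_qe ψ hψ.isDiffeo hV 0 hψ.mem
  have hφ := hψ.isDiffeo.smooth 0 hψ.mem
  have h0 := hψ.zero
  have hα' : DifferentiableAt ℝ (fun y => α (ψ y)) 0 :=
    DifferentiableAt.comp 0 (g := α) (by rwa [h0]) hφ.diff
  have hβ' : DifferentiableAt ℝ (fun y => β (ψ y)) 0 :=
    DifferentiableAt.comp 0 (g := β) (by rwa [h0]) hφ.diff
  have key := hψ.isNormalAt.pd_eq_zero_of_hessian_eq hq' hψ.pd_eq_zero hα' hβ' (by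
    rw [← h0] at hH
    filter_upwards [ψ.open_source.eventually_mem hψ.mem, hφ.continuousAt.eventually hH] with y hy hy'
    have hqy := h.qe _ (hV (ψ.map_source hy))
    exact hessian_pullback_eq (hψ.isDiffeo.eventually hy) (hψ.isDiffeo.det_ne y hy)
      hqy.metric.self_of_nhds hqy.smooth hy')
  have hne := hψ.isNormalAt.pd_zero_ne hq' hψ.pd_eq_zero
  have hFd := hq.smooth.self_of_nhds.diff
  exact ⟨hψ.exists_pd_eq hFd hne hα fun a ha => (key a ha).1,
    hψ.exists_pd_eq hFd hne hβ fun a ha => (key a ha).2.1,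
    hψ.exists_pd_eq hFd hne hq.smooth'.diff fun a ha => (key a ha).2.2⟩

end Laws

/-! ### Boxes -/

section Box

variable {n : ℕ}

theorem contDiff_tail : ContDiff ℝ ∞ (tail : EuclideanSpace ℝ (Fin (n + 1)) → _) := by
  rw [contDiff_euclidean]
  exact fun i => contDiff_coordinate i.succ

/-- The product of an interval and a ball. -/
def box (r : ℝ) : Set (EuclideanSpace ℝ (Fin (n + 1))) :=
  {z | z 0 ∈ Ioo (-r) r ∧ tail z ∈ Metric.ball 0 r}

theorem isOpen_box (r : ℝ) : IsOpen (box (n := n) r) :=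
  (isOpen_Ioo.preimage (contDiff_coordinate 0).continuous).inter
    (Metric.isOpen_ball.preimage contDiff_tail.continuous)

theorem convex_box (r : ℝ) : Convex ℝ (box (n := n) r) := by
  intro z hz w hw a b ha hb hab
  exact ⟨convex_Ioo (-r) r hz.1 hw.1 ha hb hab,
    convex_ball (0 : EuclideanSpace ℝ (Fin n)) r hz.2 hw.2 ha hb hab⟩

theorem zero_mem_box {r : ℝ} (hr : 0 < r) : (0 : EuclideanSpace ℝ (Fin (n + 1))) ∈ box r :=
  ⟨by simpa using hr, by
    have : tail (0 : EuclideanSpace ℝ (Fin (n + 1))) = 0 := rfl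
    simpa [this] using hr⟩

theorem exists_box_subset {S : Set (EuclideanSpace ℝ (Fin (n + 1)))} (hS : S ∈ 𝓝 0) :
    ∃ r, 0 < r ∧ box r ⊆ S := by
  obtain ⟨δ, hδ, hδS⟩ := Metric.mem_nhds_iff.1 hS
  refine ⟨δ / 2, by positivity, fun z hz => hδS ?_⟩
  have h1 : ‖z‖ ^ 2 = z 0 ^ 2 + ‖tail z‖ ^ 2 := by
    rw [EuclideanSpace.real_norm_sq_eq, EuclideanSpace.real_norm_sq_eq, Fin.sum_univ_succ]
    rfl
  have h2 : ‖tail z‖ < δ / 2 := by simpa using hz.2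
  have h3 := hz.1.1
  have h4 := hz.1.2
  have h5 : z 0 ^ 2 < (δ / 2) ^ 2 := by nlinarith
  have h6 := norm_nonneg (tail z)
  rw [mem_ball_zero_iff]
  nlinarith [norm_nonneg z]

/-- A function on a convex set whose derivatives in all but the first direction vanish only depends
on the first coordinate. -/
theorem eq_of_pd_eq_zero {S : Set (EuclideanSpace ℝ (Fin (n + 1)))} (hS : Convex ℝ S)
    {w : EuclideanSpace ℝ (Fin (n + 1)) → ℝ} (hw : ∀ z ∈ S, DifferentiableAt ℝ w z)
    (h : ∀ z ∈ S, ∀ a, a ≠ 0 → pd a w z = 0) {z z' : EuclideanSpace ℝ (Fin (n + 1))} (hz : z ∈ S)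
    (hz' : z' ∈ S) (h0 : z 0 = z' 0) : w z = w z' := by
  have hmem : ∀ τ ∈ Icc (0 : ℝ) 1, z' + τ • (z - z') ∈ S :=
    fun τ hτ => hS.add_smul_sub_mem hz' hz hτ
  have hd : ∀ τ ∈ Icc (0 : ℝ) 1, HasDerivAt (fun τ : ℝ => w (z' + τ • (z - z'))) 0 τ := by
    intro τ hτ
    have h1 : HasDerivAt (fun τ : ℝ => z' + τ • (z - z')) (z - z') τ := by
      simpa using ((hasDerivAt_id τ).smul_const (z - z')).const_add z'
    have h2 := (hw _ (hmem τ hτ)).hasFDerivAt.comp_hasDerivAt τ h1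
    have h3 : ∑ a, (z - z') a * pd a w (z' + τ • (z - z')) = 0 := by
      refine Finset.sum_eq_zero fun a _ => ?_
      by_cases ha : a = 0
      · rw [ha, PiLp.sub_apply, h0, sub_self, zero_mul]
      · rw [h _ (hmem τ hτ) a ha, mul_zero]
    rw [fderiv_apply_eq_sum, h3] at h2
    exact h2
  have h3 := constant_of_has_deriv_right_zero
    (fun τ hτ => (hd τ hτ).continuousAt.continuousWithinAt)
    (fun τ hτ => (hd τ ⟨hτ.1, hτ.2.le⟩).hasDerivWithinAt) 1 ⟨zero_le_one, le_rfl⟩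
  simpa using h3

end Box

/-! ### Coordinates along the gradient flow -/

section Gauss

variable {μ s : ℝ} {G : EuclideanSpace ℝ (Fin 4) → Matrix (Fin 4) (Fin 4) ℝ}
  {F L : EuclideanSpace ℝ (Fin 4) → ℝ} {V : Set (EuclideanSpace ℝ (Fin 4))}
  {x : EuclideanSpace ℝ (Fin 4)}

/-- The vector field `∇F / ‖∇F‖²`. -/
def unitField (G : EuclideanSpace ℝ (Fin 4) → Matrix (Fin 4) (Fin 4) ℝ)
    (F : EuclideanSpace ℝ (Fin 4) → ℝ) (x : EuclideanSpace ℝ (Fin 4)) : EuclideanSpace ℝ (Fin 4) :=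
  WithLp.toLp 2 fun i => grad G F x i / gradNormSq G F x

theorem IsQEOn.contDiffOn_unitField (h : IsQEOn μ s G F L V) : ContDiffOn ℝ ∞ (unitField G F) V := by
  intro x hx
  refine ContDiffAt.contDiffWithinAt ?_
  have hq := h.qe x hx
  have hG := hq.metric.self_of_nhds
  have hF := hq.smooth.self_of_nhds
  rw [contDiffAt_euclidean]
  intro i
  refine ContDiffAt.div ?_ (hG.gradNormSq_smooth hF) hq.gradNormSq_ne
  simp only [grad, Matrix.mulVec, dotProduct]
  exact ContDiffAt.sum fun j _ => (hG.inv_smooth i j).mul (contDiffAt_pd hF j)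

theorem IsQEAt.fderiv_unitField (h : IsQEAt μ G F L x) : fderiv ℝ F x (unitField G F x) = 1 := by
  rw [fderiv_apply_eq_sum]
  have h1 : ∑ i, unitField G F x i * pd i F x =
      ((fun i => pd i F x) ⬝ᵥ grad G F x) / gradNormSq G F x := by
    rw [dotProduct, Finset.sum_div]
    exact Finset.sum_congr rfl fun i _ => by simp only [unitField]; ring
  rw [h1, grad, ← gradNormSq_eq, div_self h.gradNormSq_ne]

theorem IsQEAt.sum_unitField (h : IsQEAt μ G F L x) (j : Fin 4) :
    ∑ i, G x j i * unitField G F x i = pd j F x / gradNormSq G F x := by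
  rw [← congrFun (mulVec_grad (F := F) h.metric.self_of_nhds.nondeg) j, Matrix.mulVec, dotProduct,
    Finset.sum_div]
  exact Finset.sum_congr rfl fun i _ => by simp only [unitField]; ring

/-- Flow coordinates: `F` is constant on the images of the slices `z 0 = const`. -/
def gaussMap (fl : ℝ × EuclideanSpace ℝ (Fin 4) → EuclideanSpace ℝ (Fin 4)) (σ : ℝ → ℝ)
    (F : EuclideanSpace ℝ (Fin 4) → ℝ)
    (ι : EuclideanSpace ℝ (Fin 4) →L[ℝ] EuclideanSpace ℝ (Fin 4)) (x : EuclideanSpace ℝ (Fin 4))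
    (z : EuclideanSpace ℝ (Fin 4)) : EuclideanSpace ℝ (Fin 4) :=
  fl (σ (z 0) - F (x + ι z), x + ι z)

variable {fl : ℝ × EuclideanSpace ℝ (Fin 4) → EuclideanSpace ℝ (Fin 4)} {σ : ℝ → ℝ}
  {ι : EuclideanSpace ℝ (Fin 4) →L[ℝ] EuclideanSpace ℝ (Fin 4)} {z : EuclideanSpace ℝ (Fin 4)}

theorem contDiffAt_gaussMap (hσ : ContDiffAt ℝ ∞ σ (z 0)) (hF : ContDiffAt ℝ ∞ F (x + ι z))
    (hfl : ContDiffAt ℝ ∞ fl (σ (z 0) - F (x + ι z), x + ι z)) :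
    ContDiffAt ℝ ∞ (gaussMap fl σ F ι x) z := by
  have h1 : ContDiffAt ℝ ∞ (fun z => x + ι z) z := contDiffAt_const.add ι.contDiff.contDiffAt
  exact hfl.comp z (f := fun z => (σ (z 0) - F (x + ι z), x + ι z))
    (((hσ.comp z (contDiff_coordinate 0).contDiffAt).sub (hF.comp z h1)).prodMk h1)

theorem fderiv_gaussMap {σ' : ℝ} (hσ : HasDerivAt σ σ' (z 0)) (hF : ContDiffAt ℝ ∞ F (x + ι z))
    (hfl : ContDiffAt ℝ ∞ fl (σ (z 0) - F (x + ι z), x + ι z)) (v : EuclideanSpace ℝ (Fin 4)) :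
    fderiv ℝ (gaussMap fl σ F ι x) z v =
      fderiv ℝ fl (σ (z 0) - F (x + ι z), x + ι z)
        (v 0 * σ' - fderiv ℝ F (x + ι z) (ι v), ι v) := by
  have h1 : HasFDerivAt (fun z => x + ι z) ι z := ι.hasFDerivAt.const_add x
  have h2 : HasFDerivAt (fun z : EuclideanSpace ℝ (Fin 4) => z 0) (EuclideanSpace.proj (𝕜 := ℝ) 0 :
    EuclideanSpace ℝ (Fin 4) →L[ℝ] ℝ) z := (EuclideanSpace.proj (𝕜 := ℝ) 0 :
    EuclideanSpace ℝ (Fin 4) →L[ℝ] ℝ).hasFDerivAt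
  have h3 := hfl.diff.hasFDerivAt.comp z (f := fun z => (σ (z 0) - F (x + ι z), x + ι z))
    (((hσ.hasFDerivAt.comp z h2).fun_sub (hF.diff.hasFDerivAt.comp z h1)).prodMk h1)
  have h4 : gaussMap fl σ F ι x = fl ∘ fun z => (σ (z 0) - F (x + ι z), x + ι z) := rfl
  rw [h4, h3.fderiv]
  simp

theorem fderiv_flow_time {r : ℝ} {y w : EuclideanSpace ℝ (Fin 4)} (hfl : ContDiffAt ℝ ∞ fl (r, y))
    (h : HasDerivAt (fun τ => fl (τ, y)) w r) : fderiv ℝ fl (r, y) (1, 0) = w := by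
  have h1 : HasDerivAt (fun τ : ℝ => (τ, y)) ((1 : ℝ), (0 : EuclideanSpace ℝ (Fin 4))) r :=
    (hasDerivAt_id r).prodMk (hasDerivAt_const r y)
  exact (hfl.diff.hasFDerivAt.comp_hasDerivAt r h1).unique h

theorem fderiv_flow_space {y : EuclideanSpace ℝ (Fin 4)} (hfl : ContDiffAt ℝ ∞ fl (0, y))
    (h : ∀ᶠ y' in 𝓝 y, fl (0, y') = y') (v : EuclideanSpace ℝ (Fin 4)) :
    fderiv ℝ fl (0, y) (0, v) = v := by
  have h1 : HasFDerivAt (fun y' : EuclideanSpace ℝ (Fin 4) => ((0 : ℝ), y'))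
      (ContinuousLinearMap.inr ℝ ℝ _) y := hasFDerivAt_prodMk_right 0 y
  have h2 := hfl.diff.hasFDerivAt.comp y h1
  have h3 : (fl ∘ fun y' => ((0 : ℝ), y')) =ᶠ[𝓝 y] id := h
  have h4 := h2.unique ((hasFDerivAt_id y).congr_of_eventuallyEq h3)
  have h5 := DFunLike.congr_fun h4 v
  simpa using h5

/-- The field is normalised so that dF takes the value 1 on it; hence F grows at unit rate along the
flow. -/
theorem IsQEOn.apply_flow (h : IsQEOn μ s G F L V) {δ : ℝ} {y : EuclideanSpace ℝ (Fin 4)}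
    (hfl : ∀ r ∈ Metric.ball (0 : ℝ) δ, fl (r, y) ∈ V ∧
      HasDerivAt (fun τ => fl (τ, y)) (unitField G F (fl (r, y))) r) (h0 : fl (0, y) = y)
    {r : ℝ} (hr : r ∈ Metric.ball (0 : ℝ) δ) : F (fl (r, y)) = F y + r := by
  have hd : ∀ τ ∈ Metric.ball (0 : ℝ) δ, HasDerivAt (fun τ => F (fl (τ, y)) - τ) 0 τ := by
    intro τ hτ
    have hq := h.qe _ (hfl τ hτ).1
    have h1 := hq.smooth.self_of_nhds.diff.hasFDerivAt.comp_hasDerivAt τ (hfl τ hτ).2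
    rw [hq.fderiv_unitField] at h1
    have h2 := h1.sub (hasDerivAt_id τ)
    rw [sub_self] at h2
    exact h2
  have h0δ : (0 : ℝ) ∈ Metric.ball (0 : ℝ) δ :=
    Metric.mem_ball_self (dist_nonneg.trans_lt (Metric.mem_ball.1 hr))
  have h2 := Metric.isOpen_ball.is_const_of_deriv_eq_zero (convex_ball (0 : ℝ) δ).isPreconnected
    (fun τ hτ => (hd τ hτ).differentiableAt.differentiableWithinAt) (fun τ hτ => (hd τ hτ).deriv)
    hr h0δ
  simp only [h0, sub_zero] at h2
  linarith

end Gauss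

section Gauss

variable {μ s : ℝ} {G : EuclideanSpace ℝ (Fin 4) → Matrix (Fin 4) (Fin 4) ℝ}
  {F L : EuclideanSpace ℝ (Fin 4) → ℝ} {V : Set (EuclideanSpace ℝ (Fin 4))}
  {x : EuclideanSpace ℝ (Fin 4)}

theorem IsDiffeo.restrOpen {n : ℕ}
    {ψ : OpenPartialHomeomorph (EuclideanSpace ℝ (Fin n)) (EuclideanSpace ℝ (Fin n))}
    (h : IsDiffeo ψ) {S : Set (EuclideanSpace ℝ (Fin n))} (hS : IsOpen S) :
    IsDiffeo (ψ.restrOpen S hS) where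
  smooth y hy := h.smooth y hy.1
  smooth_symm y hy := h.smooth_symm y hy.1
  det_ne y hy := h.det_ne y hy.1

theorem jac_apply_eq_fderiv {n : ℕ} {φ : EuclideanSpace ℝ (Fin n) → EuclideanSpace ℝ (Fin n)}
    {z : EuclideanSpace ℝ (Fin n)} (hφ : DifferentiableAt ℝ φ z) (a i : Fin n) :
    jac φ z a i = (fderiv ℝ φ z (EuclideanSpace.single i 1)) a := by
  rw [jac_apply, pd, fderiv_coord hφ]

/-- Coordinates on a box in which `F` only depends on the first coordinate `t` and the metric is
`ε dt² + g_ab(t, y) dy^a dy^b`. -/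
structure IsGaussChart (G : EuclideanSpace ℝ (Fin 4) → Matrix (Fin 4) (Fin 4) ℝ)
    (F : EuclideanSpace ℝ (Fin 4) → ℝ) (x : EuclideanSpace ℝ (Fin 4)) (ε r : ℝ)
    (ψ : OpenPartialHomeomorph (EuclideanSpace ℝ (Fin 4)) (EuclideanSpace ℝ (Fin 4))) : Prop where
  isDiffeo : IsDiffeo ψ
  pos : 0 < r
  source_eq : ψ.source = box r
  zero : ψ 0 = x
  det_pos : ∀ z ∈ ψ.source, 0 < (jac ψ z).det
  sign : ε = 1 ∨ ε = -1
  metric_zero : ∀ z ∈ ψ.source, pullback ψ G z 0 0 = ε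
  metric_cross : ∀ z ∈ ψ.source, ∀ a, a ≠ 0 → pullback ψ G z 0 a = 0
  pd_eq_zero : ∀ z ∈ ψ.source, ∀ a, a ≠ 0 → pd a (fun z => F (ψ z)) z = 0

/-- Lowering the index of ∇F/‖∇F‖² gives dF/‖∇F‖², so ∂₀ is orthogonal to every coordinate direction
along which F is constant. -/
theorem pullback_unitField {φ : EuclideanSpace ℝ (Fin 4) → EuclideanSpace ℝ (Fin 4)}
    {z : EuclideanSpace ℝ (Fin 4)} (hφ : ContDiffAt ℝ ∞ φ z) (hq : IsQEAt μ G F L (φ z)) {c : ℝ}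
    (h : ∀ i, jac φ z i 0 = c * unitField G F (φ z) i) (j : Fin 4) :
    pullback φ G z 0 j = c * pd j (fun z => F (φ z)) z / gradNormSq G F (φ z) := by
  have hG := hq.metric.self_of_nhds
  rw [pullback_apply, Finset.sum_comm, pd_comp_jac hq.smooth.self_of_nhds hφ, Finset.mul_sum,
    Finset.sum_div]
  refine Finset.sum_congr rfl fun b _ => ?_
  have h1 := hq.sum_unitField b
  have h2 : ∑ a, jac φ z a 0 * jac φ z b j * G (φ z) a b =
      c * jac φ z b j * ∑ a, G (φ z) b a * unitField G F (φ z) a := by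
    rw [Finset.mul_sum]
    refine Finset.sum_congr rfl fun a _ => ?_
    rw [h, hG.symm_apply a b]
    ring
  rw [h2, h1]
  ring

/-- From each point of a transversal hyperplane, follow ∇F/‖∇F‖² until F takes the value σ(t). The
slices are then level sets of F and ∂₀ is orthogonal to them. Since ‖∇F‖² is a function of F alone,
one reparametrisation σ makes ∂₀ a unit vector on all flow lines simultaneously. -/
theorem IsQEOn.exists_gauss_chart (h : IsQEOn μ s G F L V) (hμ : μ ≠ -1 / 2) (hx : x ∈ V) :
    ∃ ε r ψ, IsGaussChart G F x ε r ψ ∧ ψ.target ⊆ V := by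
  have hq := h.qe x hx
  obtain ⟨-, P, -, hP, -, ⟨c, hc, hPc⟩, hPF⟩ := hq.exists_frame (gradNormSq G F x)⁻¹
    (inv_ne_zero hq.gradNormSq_ne)
  have hPX : ∀ i, P i 0 = c * unitField G F x i := by
    intro i
    rw [hPc]
    simp only [unitField]
    ring
  -- The transversal: ι forgets the first coordinate and maps the other three onto the kernel of dF
  -- at x.
  let ι : EuclideanSpace ℝ (Fin 4) →L[ℝ] EuclideanSpace ℝ (Fin 4) :=
    LinearMap.toContinuousLinearMap (Matrix.toEuclideanLin
      (Matrix.of fun i a => if a = 0 then 0 else P i a))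
  have hι : ∀ a i, ι (EuclideanSpace.single a 1) i = if a = 0 then 0 else P i a := by
    intro a i
    simp [ι, Matrix.toEuclideanLin]
  have hι0 : ι (EuclideanSpace.single 0 1) = 0 := by
    ext i
    rw [hι, if_pos rfl]
    rfl
  obtain ⟨δ, hδ, fl, hfl⟩ := exists_flow h.isOpen h.contDiffOn_unitField hx
  have hx0 : x ∈ Metric.ball x δ := Metric.mem_ball_self hδ
  -- ‖∇F‖² along the flow line through x, as a function of the value t of F there.
  set U : ℝ → ℝ := fun t => gradNormSq G F (fl (t - F x, x)) with hU
  have hUs : ContDiffOn ℝ ∞ (fun t => √|U t|) (Metric.ball (F x) δ) := by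
    intro t ht
    refine ContDiffAt.contDiffWithinAt ?_
    have ht' : t - F x ∈ Metric.ball (0 : ℝ) δ := by simpa [dist_eq_norm] using ht
    obtain ⟨f1, -, f3, -⟩ := hfl _ ht' x hx0
    have hqt := h.qe _ f3
    have hu : ContDiffAt ℝ ∞ U t := by
      have h1 : ContDiffAt ℝ ∞ (fun t : ℝ => (t - F x, x)) t :=
        (contDiffAt_id.sub contDiffAt_const).prodMk contDiffAt_const
      exact ContDiffAt.comp (g := gradNormSq G F) (f := fun t => fl (t - F x, x)) t
        (hqt.metric.self_of_nhds.gradNormSq_smooth hqt.smooth.self_of_nhds) (f1.comp t h1)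
    exact (hu.abs hqt.gradNormSq_ne).sqrt (abs_ne_zero.2 hqt.gradNormSq_ne)
  -- The function σ solves σ' = √|U(σ)|, σ(0) = F(x). As |g(X, X)| = 1/|U| for X = ∇F/‖∇F‖², this is
  -- the arc-length parametrisation.
  obtain ⟨δ', hδ', fl', hfl'⟩ := exists_flow Metric.isOpen_ball hUs (Metric.mem_ball_self hδ)
  set σ : ℝ → ℝ := fun t => fl' (t, F x) with hσ
  have hσs : ∀ t ∈ Metric.ball (0 : ℝ) δ', ContDiffAt ℝ ∞ σ t ∧ σ t ∈ Metric.ball (F x) δ ∧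
      HasDerivAt σ √|U (σ t)| t := by
    intro t ht
    obtain ⟨f1, f2, f3, f4⟩ := hfl' t ht (F x) (Metric.mem_ball_self hδ')
    exact ⟨f1.comp t (contDiffAt_id.prodMk contDiffAt_const), f3, f4⟩
  have h0δ' : (0 : ℝ) ∈ Metric.ball (0 : ℝ) δ' := Metric.mem_ball_self hδ'
  have hσ0 : σ 0 = F x := (hfl' 0 h0δ' (F x) (Metric.mem_ball_self hδ')).2.1
  set φ := gaussMap fl σ F ι x with hφ
  set S : Set (EuclideanSpace ℝ (Fin 4)) := {z | z 0 ∈ Metric.ball (0 : ℝ) δ' ∧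
    x + ι z ∈ V ∧ x + ι z ∈ Metric.ball x δ ∧ σ (z 0) - F (x + ι z) ∈ Metric.ball (0 : ℝ) δ} with hS
  have hS0 : S ∈ 𝓝 0 := by
    have c0 : ContinuousAt (fun z : EuclideanSpace ℝ (Fin 4) => z 0) 0 :=
      (contDiff_coordinate 0).continuous.continuousAt
    have c1 : ContinuousAt (fun z => x + ι z) 0 := by fun_prop
    have e1 : x + ι 0 = x := by simp
    have c2 : ContinuousAt (fun z : EuclideanSpace ℝ (Fin 4) => σ (z 0) - F (x + ι z)) 0 := by
      refine ContinuousAt.sub (ContinuousAt.comp (g := σ) (f := fun z : EuclideanSpace ℝ (Fin 4) => z 0)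
        (hσs 0 h0δ').1.continuousAt c0) (ContinuousAt.comp (g := F) ?_ c1)
      rw [e1]
      exact hq.smooth.self_of_nhds.continuousAt
    refine (c0.eventually_mem (Metric.ball_mem_nhds _ hδ')).and
      ((c1.eventually_mem ?_).and ((c1.eventually_mem ?_).and (c2.eventually_mem ?_)))
    · rw [e1]; exact h.isOpen.mem_nhds hx
    · rw [e1]; exact Metric.ball_mem_nhds _ hδ
    · rw [e1]
      have : σ ((0 : EuclideanSpace ℝ (Fin 4)) 0) - F x = 0 := by
        rw [PiLp.zero_apply, hσ0, sub_self]
      rw [this]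
      exact Metric.ball_mem_nhds _ hδ
  have hSF : ∀ z ∈ S, ContDiffAt ℝ ∞ F (x + ι z) := fun z hz => (h.qe _ hz.2.1).smooth.self_of_nhds
  have hSfl : ∀ z ∈ S, ContDiffAt ℝ ∞ fl (σ (z 0) - F (x + ι z), x + ι z) :=
    fun z hz => (hfl _ hz.2.2.2 _ hz.2.2.1).1
  have hφs : ∀ z ∈ S, ContDiffAt ℝ ∞ φ z := fun z hz =>
    contDiffAt_gaussMap (hσs _ hz.1).1 (hSF z hz) (hSfl z hz)
  have hφV : ∀ z ∈ S, φ z ∈ V := fun z hz => (hfl _ hz.2.2.2 _ hz.2.2.1).2.2.1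
  have hφF : ∀ z ∈ S, F (φ z) = σ (z 0) := by
    intro z hz
    rw [hφ, gaussMap, h.apply_flow (fun r hr => (hfl r hr _ hz.2.2.1).2.2)
      (hfl 0 (Metric.mem_ball_self hδ) _ hz.2.2.1).2.1 hz.2.2.2]
    ring
  have hφd : ∀ z ∈ S, ∀ i, jac φ z i 0 = √|U (σ (z 0))| * unitField G F (φ z) i := by
    intro z hz i
    rw [jac_apply_eq_fderiv (hφs z hz).diff, hφ,
      fderiv_gaussMap (hσs _ hz.1).2.2 (hSF z hz) (hSfl z hz), hι0]
    have h1 := fderiv_flow_time (hSfl z hz) (hfl _ hz.2.2.2 _ hz.2.2.1).2.2.2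
    have h2 : ((EuclideanSpace.single (0 : Fin 4) (1 : ℝ) : EuclideanSpace ℝ (Fin 4)) 0 *
        √|U (σ (z 0))| - fderiv ℝ F (x + ι z) 0, (0 : EuclideanSpace ℝ (Fin 4))) =
        √|U (σ (z 0))| • ((1 : ℝ), (0 : EuclideanSpace ℝ (Fin 4))) := by
      ext <;> simp
    rw [h2, map_smul, h1]
    rfl
  have h0S : (0 : EuclideanSpace ℝ (Fin 4)) ∈ S := mem_of_mem_nhds hS0
  have hφ0 : φ 0 = x := by
    rw [hφ, gaussMap, map_zero, add_zero, PiLp.zero_apply, hσ0, sub_self]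
    exact (hfl 0 (Metric.mem_ball_self hδ) _ hx0).2.1
  have hφa : ∀ a, a ≠ 0 → ∀ i, jac φ 0 i a = P i a := by
    intro a ha i
    have e1 : x + ι 0 = x := by simp
    have e2 : σ ((0 : EuclideanSpace ℝ (Fin 4)) 0) - F x = 0 := by
      rw [PiLp.zero_apply, hσ0, sub_self]
    rw [jac_apply_eq_fderiv (hφs 0 h0S).diff, hφ,
      fderiv_gaussMap (hσs _ h0S.1).2.2 (hSF 0 h0S) (hSfl 0 h0S), e1, e2]
    have h1 : fderiv ℝ F x (ι (EuclideanSpace.single a 1)) = 0 := by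
      rw [fderiv_apply_eq_sum, ← hPF a ha]
      refine Finset.sum_congr rfl fun i _ => ?_
      rw [hι, if_neg ha]
      ring
    rw [h1, PiLp.single_apply, if_neg (Ne.symm ha), zero_mul, sub_zero,
      fderiv_flow_space (hfl 0 (Metric.mem_ball_self hδ) x hx0).1, hι, if_neg ha]
    filter_upwards [Metric.ball_mem_nhds x hδ] with y hy
    exact (hfl 0 (Metric.mem_ball_self hδ) y hy).2.1
  have hUne : ∀ t ∈ Metric.ball (F x) δ, U t ≠ 0 := by
    intro t ht
    have ht' : t - F x ∈ Metric.ball (0 : ℝ) δ := by simpa [dist_eq_norm] using ht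
    exact (h.qe _ (hfl _ ht' x hx0).2.2.1).gradNormSq_ne
  have hsqrt : ∀ z ∈ S, 0 < √|U (σ (z 0))| := fun z hz =>
    Real.sqrt_pos.2 (abs_pos.2 (hUne _ (hσs _ hz.1).2.1))
  -- At the origin the Jacobian is the frame P with its first column rescaled by a positive number,
  -- so the chart inherits the orientation of P.
  have hdet0 : 0 < (jac φ 0).det := by
    have h1 : jac φ 0 = P * Matrix.diagonal fun a =>
        if a = 0 then √|U (σ ((0 : EuclideanSpace ℝ (Fin 4)) 0))| / c else 1 := by
      ext i a
      rw [Matrix.mul_diagonal]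
      split_ifs with ha
      · rw [ha, hφd 0 h0S, hPX, hφ0]
        field_simp
      · rw [hφa a ha, mul_one]
    rw [h1, Matrix.det_mul, Matrix.det_diagonal]
    refine mul_pos hP (Finset.prod_pos fun a _ => ?_)
    split_ifs
    · exact div_pos (hsqrt 0 h0S) hc
    · exact one_pos
  have hu : ∀ z ∈ S, ContDiffAt ℝ ∞ (fun z => gradNormSq G F (φ z)) z := by
    intro z hz
    have hqz := h.qe _ (hφV z hz)
    exact (hqz.metric.self_of_nhds.gradNormSq_smooth hqz.smooth.self_of_nhds).comp z (hφs z hz)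
  -- The second condition keeps the sign of ‖∇F‖² equal to its sign at x, so that ε is constant on
  -- the chart.
  have hT : S ∩ {z | 0 < (jac φ z).det ∧ 0 < gradNormSq G F (φ z) * gradNormSq G F x} ∈ 𝓝 0 := by
    refine inter_mem hS0 (((contDiffAt_det_jac (hφs 0 h0S)).continuousAt.eventually
      (lt_mem_nhds hdet0)).and ?_)
    refine ((hu 0 h0S).continuousAt.mul continuousAt_const).eventually (lt_mem_nhds ?_)
    change 0 < gradNormSq G F (φ 0) * gradNormSq G F x
    rw [hφ0]
    exact mul_self_pos.2 hq.gradNormSq_ne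
  obtain ⟨ψ₀, hψ₀, h0ψ, hψφ, hψT⟩ := exists_isDiffeo (by filter_upwards [hS0] with z hz using hφs z hz)
    hdet0.ne' hT
  obtain ⟨r, hr, hbox⟩ := exists_box_subset (ψ₀.open_source.mem_nhds h0ψ)
  have hbS : ∀ z ∈ box r, z ∈ S := fun z hz => (hψT (hbox hz)).1
  have hψe : (ψ₀.restrOpen (box r) (isOpen_box r) : EuclideanSpace ℝ (Fin 4) → _) = φ := funext hψφ
  have hsrc : (ψ₀.restrOpen (box r) (isOpen_box r)).source = box r :=
    inter_eq_right.2 hbox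
  have hFpd : ∀ z ∈ box r, ∀ a, pd a (fun z => F (φ z)) z = if a = 0 then √|U (σ (z 0))| else 0 := by
    intro z hz a
    have h1 : (fun z => F (φ z)) =ᶠ[𝓝 z] fun z => σ (z 0) := by
      filter_upwards [(isOpen_box r).mem_nhds hz] with y hy using hφF y (hbS y hy)
    have h2 := (hσs _ (hbS z hz).1).2.2.comp_hasFDerivAt z
      (EuclideanSpace.proj (𝕜 := ℝ) (0 : Fin 4) : EuclideanSpace ℝ (Fin 4) →L[ℝ] ℝ).hasFDerivAt
    have h3 : pd a (fun z : EuclideanSpace ℝ (Fin 4) => σ (z 0)) z = √|U (σ (z 0))| *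
        (EuclideanSpace.single a (1 : ℝ) : EuclideanSpace ℝ (Fin 4)) 0 := by
      rw [pd]
      have h4 : (σ ∘ (EuclideanSpace.proj (𝕜 := ℝ) (0 : Fin 4) : EuclideanSpace ℝ (Fin 4) →L[ℝ] ℝ)) =
        fun z : EuclideanSpace ℝ (Fin 4) => σ (z 0) := rfl
      rw [h4] at h2
      rw [h2.fderiv]
      rfl
    rw [pd_congr h1, h3, PiLp.single_apply]
    by_cases ha : a = 0
    · rw [if_pos ha, if_pos ha.symm, mul_one]
    · rw [if_neg ha, if_neg (Ne.symm ha), mul_zero]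
  -- The differential of ‖∇F‖² is a multiple of dF, so it vanishes along slices. By convexity of the
  -- box, ‖∇F‖² equals its value on the flow line through x at the same t.
  have huU : ∀ z ∈ box r, gradNormSq G F (φ z) = U (σ (z 0)) := by
    intro z hz
    have hz' : EuclideanSpace.single 0 (z 0) ∈ box (n := 3) r := by
      refine ⟨by simpa using hz.1, ?_⟩
      have : tail (EuclideanSpace.single 0 (z 0) : EuclideanSpace ℝ (Fin 4)) = 0 := by
        ext i
        simp [tail]
      rw [this]
      exact Metric.mem_ball_self hr
    rw [eq_of_pd_eq_zero (convex_box r) (fun y hy => (hu y (hbS y hy)).diff) (fun y hy a ha => ?_) hz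
      hz' (by simp)]
    · have h1 : (EuclideanSpace.single 0 (z 0) : EuclideanSpace ℝ (Fin 4)) =
          z 0 • EuclideanSpace.single 0 1 := by
        ext i
        simp
      rw [hφ, gaussMap, h1, map_smul, hι0]
      simp [hU]
    · have hqy := h.qe _ (hφV y (hbS y hy))
      obtain ⟨k, hk⟩ := h.exists_pd_gradNormSq_eq hμ (hφV y (hbS y hy))
      rw [pd_comp_jac (hqy.metric.self_of_nhds.gradNormSq_smooth hqy.smooth.self_of_nhds)
        (hφs y (hbS y hy))]
      have h2 := hFpd y hy a
      rw [pd_comp_jac hqy.smooth.self_of_nhds (hφs y (hbS y hy)), if_neg ha] at h2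
      simp only [hk, mul_assoc, ← Finset.mul_sum, h2, mul_zero]
  have hmetric : ∀ z ∈ box r, ∀ a, pullback φ G z 0 a = √|U (σ (z 0))| *
      (if a = 0 then √|U (σ (z 0))| else 0) / gradNormSq G F (φ z) := by
    intro z hz a
    rw [pullback_unitField (hφs z (hbS z hz)) (h.qe _ (hφV z (hbS z hz))) (hφd z (hbS z hz)),
      hFpd z hz]
  refine ⟨|gradNormSq G F x| / gradNormSq G F x, r, ψ₀.restrOpen (box r) (isOpen_box r),
    ⟨hψ₀.restrOpen _, hr, hsrc, by rw [hψe, hφ0], ?_, ?_, ?_, ?_, ?_⟩, ?_⟩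
  · rw [hψe, hsrc]
    exact fun z hz => (hψT (hbox hz)).2.1
  · rcases lt_or_gt_of_ne hq.gradNormSq_ne with hlt | hlt
    · right; rw [abs_of_neg hlt, neg_div, div_self hq.gradNormSq_ne]
    · left; rw [abs_of_pos hlt, div_self hq.gradNormSq_ne]
  · rw [hψe, hsrc]
    intro z hz
    have hp := (hψT (hbox hz)).2.2
    rw [hmetric z hz, if_pos rfl, Real.mul_self_sqrt (abs_nonneg _), huU z hz]
    rw [huU z hz] at hp
    rcases pos_and_pos_or_neg_and_neg_of_mul_pos hp with ⟨h1, h2⟩ | ⟨h1, h2⟩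
    · rw [abs_of_pos h1, abs_of_pos h2, div_self h1.ne', div_self h2.ne']
    · rw [abs_of_neg h1, abs_of_neg h2, neg_div, neg_div, div_self h1.ne, div_self h2.ne]
  · rw [hψe, hsrc]
    intro z hz a ha
    rw [hmetric z hz, if_neg ha, mul_zero, zero_div]
  · rw [hψe, hsrc]
    intro z hz a ha
    rw [hFpd z hz, if_neg ha]
  · intro y hy
    have h1 := (ψ₀.restrOpen (box r) (isOpen_box r)).map_target hy
    rw [← (ψ₀.restrOpen (box r) (isOpen_box r)).right_inv hy, hψe]
    rw [hsrc] at h1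
    exact hφV _ (hbS _ h1)

end Gauss

/-! ### Block metrics on `ℝ × ℝⁿ` -/

section Block

variable {n : ℕ}

theorem pd_comp_zero {f : ℝ → ℝ} {z : EuclideanSpace ℝ (Fin (n + 1))}
    (hf : DifferentiableAt ℝ f (z 0)) (i : Fin (n + 1)) :
    pd i (fun z => f (z 0)) z = deriv f (z 0) * if i = 0 then 1 else 0 := by
  have h2 := hf.hasDerivAt.comp_hasFDerivAt z
    (EuclideanSpace.proj (𝕜 := ℝ) (0 : Fin (n + 1)) : EuclideanSpace ℝ (Fin (n + 1)) →L[ℝ] ℝ).hasFDerivAt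
  have h4 : (f ∘ (EuclideanSpace.proj (𝕜 := ℝ) (0 : Fin (n + 1)) :
      EuclideanSpace ℝ (Fin (n + 1)) →L[ℝ] ℝ)) = fun z => f (z 0) := rfl
  rw [h4] at h2
  rw [pd, h2.fderiv]
  simp [eq_comm]

theorem pd_comp_tail {k : EuclideanSpace ℝ (Fin n) → ℝ} {z : EuclideanSpace ℝ (Fin (n + 1))}
    (hk : DifferentiableAt ℝ k (tail z)) (i : Fin (n + 1)) :
    pd i (fun z => k (tail z)) z = Fin.cases (motive := fun _ => ℝ) 0 (fun a => pd a k (tail z)) i := by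
  rw [pd_comp hk contDiff_tail.contDiffAt.diff]
  simp only [tail, pd_coordinate]
  refine Fin.cases ?_ (fun a => ?_) i
  · simp
  · simp

/-- The metric `a(t) dt² + b(t) h`. -/
def block (a b : ℝ → ℝ) (h : EuclideanSpace ℝ (Fin n) → Matrix (Fin n) (Fin n) ℝ)
    (z : EuclideanSpace ℝ (Fin (n + 1))) : Matrix (Fin (n + 1)) (Fin (n + 1)) ℝ :=
  Matrix.of (Fin.cons (Fin.cons (a (z 0)) fun _ => 0)
    fun i => Fin.cons 0 fun j => b (z 0) * h (tail z) i j)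

variable {a b : ℝ → ℝ} {h : EuclideanSpace ℝ (Fin n) → Matrix (Fin n) (Fin n) ℝ}
  {z : EuclideanSpace ℝ (Fin (n + 1))}

@[simp] theorem block_zero_zero : block a b h z 0 0 = a (z 0) := rfl

@[simp] theorem block_zero_succ (j : Fin n) : block a b h z 0 j.succ = 0 := rfl

@[simp] theorem block_succ_zero (i : Fin n) : block a b h z i.succ 0 = 0 := rfl

@[simp] theorem block_succ_succ (i j : Fin n) :
    block a b h z i.succ j.succ = b (z 0) * h (tail z) i j := rfl

/-- The conditions under which `block a b h` is a metric near `z`. -/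
structure IsBlockAt (a b : ℝ → ℝ) (h : EuclideanSpace ℝ (Fin n) → Matrix (Fin n) (Fin n) ℝ)
    (z : EuclideanSpace ℝ (Fin (n + 1))) : Prop where
  smooth_left : ContDiffAt ℝ ∞ a (z 0)
  smooth_right : ContDiffAt ℝ ∞ b (z 0)
  left_ne : a (z 0) ≠ 0
  right_ne : b (z 0) ≠ 0
  metric : IsMetricAt h (tail z)

namespace IsBlockAt

theorem inv_mul_block (H : IsBlockAt a b h z) :
    block (fun t => (a t)⁻¹) (fun t => (b t)⁻¹) (fun y => (h y)⁻¹) z * block a b h z = 1 := by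
  ext i j
  rw [Matrix.mul_apply, Fin.sum_univ_succ]
  refine Fin.cases ?_ (fun i => ?_) i <;> refine Fin.cases ?_ (fun j => ?_) j
  · simp [H.left_ne]
  · simp [(Fin.succ_ne_zero j).symm]
  · simp
  · have h1 := H.metric.sum_inv_mul i j
    have h2 : ∑ k : Fin n, (b (z 0))⁻¹ * (h (tail z))⁻¹ i k * (b (z 0) * h (tail z) k j) =
        ∑ k, (h (tail z))⁻¹ i k * h (tail z) k j :=
      Finset.sum_congr rfl fun k _ => by have := H.right_ne; field_simp
    simp [h2, h1, Matrix.one_apply]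

theorem inv_block (H : IsBlockAt a b h z) : (block a b h z)⁻¹ =
    block (fun t => (a t)⁻¹) (fun t => (b t)⁻¹) (fun y => (h y)⁻¹) z :=
  Matrix.inv_eq_left_inv H.inv_mul_block

theorem isMetricAt (H : IsBlockAt a b h z) : IsMetricAt (block a b h) z where
  smooth i j := by
    have c0 : ContDiffAt ℝ ∞ (fun z : EuclideanSpace ℝ (Fin (n + 1)) => z 0) z :=
      (contDiff_coordinate 0).contDiffAt
    refine Fin.cases ?_ (fun i => ?_) i <;> refine Fin.cases ?_ (fun j => ?_) j
    · exact H.smooth_left.comp z c0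
    · exact contDiffAt_const
    · exact contDiffAt_const
    · exact (H.smooth_right.comp z c0).mul ((H.metric.smooth i j).comp z contDiff_tail.contDiffAt)
  symm := by
    filter_upwards [contDiff_tail.continuous.continuousAt.eventually H.metric.symm] with y hy
    ext i j
    refine Fin.cases ?_ (fun i => ?_) i <;> refine Fin.cases ?_ (fun j => ?_) j
    · rfl
    · rfl
    · rfl
    · rw [Matrix.transpose_apply, block_succ_succ, block_succ_succ, hy.apply]
  nondeg h0 := by
    have h1 := congrArg Matrix.det H.inv_mul_block
    rw [Matrix.det_mul, h0, mul_zero, Matrix.det_one] at h1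
    exact zero_ne_one h1

theorem pd_zero_zero (H : IsBlockAt a b h z) (k : Fin (n + 1)) :
    pd k (fun z => a (z 0)) z = deriv a (z 0) * if k = 0 then 1 else 0 :=
  pd_comp_zero H.smooth_left.diff k

theorem pd_succ_succ_zero (H : IsBlockAt a b h z) (i j : Fin n) :
    pd 0 (fun z => block a b h z i.succ j.succ) z = deriv b (z 0) * h (tail z) i j := by
  have d1 : DifferentiableAt ℝ (fun z : EuclideanSpace ℝ (Fin (n + 1)) => b (z 0)) z :=
    (H.smooth_right.comp z (contDiff_coordinate 0).contDiffAt).diff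
  have d2 : DifferentiableAt ℝ (fun z => h (tail z) i j) z :=
    ((H.metric.smooth i j).comp z contDiff_tail.contDiffAt).diff
  simp only [block_succ_succ]
  rw [pd_mul d1 d2, pd_comp_zero H.smooth_right.diff,
    pd_comp_tail (k := fun y => h y i j) (H.metric.smooth i j).diff]
  simp

theorem pd_succ_succ_succ (H : IsBlockAt a b h z) (k i j : Fin n) :
    pd k.succ (fun z => block a b h z i.succ j.succ) z =
      b (z 0) * pd k (fun y => h y i j) (tail z) := by
  have d1 : DifferentiableAt ℝ (fun z : EuclideanSpace ℝ (Fin (n + 1)) => b (z 0)) z :=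
    (H.smooth_right.comp z (contDiff_coordinate 0).contDiffAt).diff
  have d2 : DifferentiableAt ℝ (fun z => h (tail z) i j) z :=
    ((H.metric.smooth i j).comp z contDiff_tail.contDiffAt).diff
  simp only [block_succ_succ]
  rw [pd_mul d1 d2, pd_comp_zero H.smooth_right.diff,
    pd_comp_tail (k := fun y => h y i j) (H.metric.smooth i j).diff]
  simp

theorem christoffel_000 (H : IsBlockAt a b h z) :
    christoffel (block a b h) 0 0 0 z = deriv a (z 0) / (2 * a (z 0)) := by
  rw [christoffel_eq, H.inv_block, Fin.sum_univ_succ]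
  simp [christoffelLower, H.pd_zero_zero]
  ring

theorem christoffel_00 (H : IsBlockAt a b h z) (k : Fin n) :
    christoffel (block a b h) 0 0 k.succ z = 0 := by
  rw [christoffel_eq, H.inv_block, Fin.sum_univ_succ]
  simp [christoffelLower, H.pd_zero_zero]

theorem christoffel_0i0 (H : IsBlockAt a b h z) (i : Fin n) :
    christoffel (block a b h) 0 i.succ 0 z = 0 := by
  rw [christoffel_eq, H.inv_block, Fin.sum_univ_succ]
  simp [christoffelLower, H.pd_zero_zero]

theorem christoffel_i00 (H : IsBlockAt a b h z) (i : Fin n) :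
    christoffel (block a b h) i.succ 0 0 z = 0 := by
  rw [H.isMetricAt.christoffel_symm, H.christoffel_0i0]

theorem christoffel_0ij (H : IsBlockAt a b h z) (i j : Fin n) :
    christoffel (block a b h) 0 i.succ j.succ z =
      deriv b (z 0) / (2 * b (z 0)) * if i = j then 1 else 0 := by
  rw [christoffel_eq, H.inv_block, Fin.sum_univ_succ]
  have h1 := H.metric.sum_inv_mul j i
  simp only [christoffelLower, block_zero_zero, block_zero_succ, block_succ_zero, block_succ_succ,
    pd_const]
  have h2 : ∀ l : Fin n, (b (z 0))⁻¹ * (h (tail z))⁻¹ j l * (1 / 2 * (pd 0 (fun y => b (y 0) * h (tail y) i l) z +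
      0 - 0)) = deriv b (z 0) / (2 * b (z 0)) * ((h (tail z))⁻¹ j l * h (tail z) l i) := by
    intro l
    have := H.pd_succ_succ_zero i l
    simp only [block_succ_succ] at this
    rw [this, H.metric.symm_apply i l]
    have := H.right_ne
    field_simp
    ring
  simp only [h2, ← Finset.mul_sum, h1, zero_mul, zero_add]
  simp only [eq_comm]

theorem christoffel_i0j (H : IsBlockAt a b h z) (i j : Fin n) :
    christoffel (block a b h) i.succ 0 j.succ z =
      deriv b (z 0) / (2 * b (z 0)) * if i = j then 1 else 0 := by
  rw [H.isMetricAt.christoffel_symm, H.christoffel_0ij]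

theorem christoffel_ij0 (H : IsBlockAt a b h z) (i j : Fin n) :
    christoffel (block a b h) i.succ j.succ 0 z =
      -(deriv b (z 0) / (2 * a (z 0))) * h (tail z) i j := by
  rw [christoffel_eq, H.inv_block, Fin.sum_univ_succ]
  have := H.pd_succ_succ_zero i j
  simp only [block_succ_succ] at this
  simp [christoffelLower, this]
  ring

theorem christoffel_ijk (H : IsBlockAt a b h z) (i j k : Fin n) :
    christoffel (block a b h) i.succ j.succ k.succ z = christoffel h i j k (tail z) := by
  rw [christoffel_eq, H.inv_block, Fin.sum_univ_succ, christoffel_eq]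
  have := H.pd_succ_succ_succ
  simp only [block_succ_succ] at this
  simp only [christoffelLower, block_succ_zero, block_succ_succ, this, zero_mul, zero_add]
  refine Finset.sum_congr rfl fun l _ => ?_
  have := H.right_ne
  field_simp

theorem pd_christoffel_ijk (H : ∀ᶠ w in 𝓝 z, IsBlockAt a b h w) (m : Fin (n + 1)) (i j k : Fin n) :
    pd m (christoffel (block a b h) i.succ j.succ k.succ) z =
      Fin.cases (motive := fun _ => ℝ) 0 (fun m => pd m (christoffel h i j k) (tail z)) m := by
  have h1 : christoffel (block a b h) i.succ j.succ k.succ =ᶠ[𝓝 z] fun w =>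
      christoffel h i j k (tail w) := H.mono fun w hw => hw.christoffel_ijk i j k
  rw [pd_congr h1, pd_comp_tail (H.self_of_nhds.metric.christoffel_smooth i j k).diff]

/-- The Ricci tensor of the fibres of a warped product. -/
theorem ricci_succ_succ {c : ℝ} (H : ∀ᶠ w in 𝓝 z, IsBlockAt (fun _ => c) b h w) (i j : Fin n) :
    ricci (block (fun _ => c) b h) i.succ j.succ z = ricci h i j (tail z) +
      (-(deriv (deriv b) (z 0) / (2 * c)) + (2 - n) * (deriv b (z 0) ^ 2 / (4 * c * b (z 0)))) *
        h (tail z) i j := by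
  have H0 := H.self_of_nhds
  have hc : c ≠ 0 := H0.left_ne
  have hb := H0.right_ne
  have hb' : DifferentiableAt ℝ (deriv b) (z 0) := by
    have : ContDiffAt ℝ ∞ (deriv b) (z 0) := by
      exact (H0.smooth_right.fderiv_right (m := ∞) (by simp)).clm_apply contDiffAt_const
    exact this.diff
  have p1 : pd 0 (christoffel (block (fun _ => c) b h) i.succ j.succ 0) z =
      -(deriv (deriv b) (z 0) / (2 * c)) * h (tail z) i j := by
    have h1 : christoffel (block (fun _ => c) b h) i.succ j.succ 0 =ᶠ[𝓝 z] fun w =>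
        (-(2 * c)⁻¹) * (deriv b (w 0) * h (tail w) i j) := by
      filter_upwards [H] with w hw
      rw [hw.christoffel_ij0]
      ring
    have d1 : DifferentiableAt ℝ (fun z : EuclideanSpace ℝ (Fin (n + 1)) => deriv b (z 0)) z :=
      DifferentiableAt.comp z (g := deriv b) hb' (contDiff_coordinate 0).contDiffAt.diff
    have d2 : DifferentiableAt ℝ (fun z => h (tail z) i j) z :=
      ((H0.metric.smooth i j).comp z contDiff_tail.contDiffAt).diff
    rw [pd_congr h1, pd_const_mul (d1.fun_mul d2), pd_mul d1 d2, pd_comp_zero hb',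
      pd_comp_tail (k := fun y => h y i j) (H0.metric.smooth i j).diff]
    simp
    ring
  have p2 : pd i.succ (christoffel (block (fun _ => c) b h) 0 j.succ 0) z = 0 := by
    have h1 : christoffel (block (fun _ => c) b h) 0 j.succ 0 =ᶠ[𝓝 z] fun _ => 0 :=
      H.mono fun w hw => hw.christoffel_0i0 j
    rw [pd_congr h1, pd_const]
  have c0 : curvOp (block (fun _ => c) b h) i.succ 0 j.succ 0 z =
      (-(deriv (deriv b) (z 0) / (2 * c)) + deriv b (z 0) ^ 2 / (4 * c * b (z 0))) *
        h (tail z) i j := by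
    rw [curvOp, p1, p2, Fin.sum_univ_succ]
    simp only [H0.christoffel_000, H0.christoffel_0i0, H0.christoffel_0ij, H0.christoffel_ij0,
      H0.christoffel_i00, deriv_const]
    have h3 : ∀ m : Fin n, christoffel (block (fun _ => c) b h) i.succ j.succ m.succ z * 0 -
        deriv b (z 0) / (2 * b (z 0)) * (if j = m then 1 else 0) *
          (-(deriv b (z 0) / (2 * c)) * h (tail z) i m) =
        if j = m then deriv b (z 0) ^ 2 / (4 * c * b (z 0)) * h (tail z) i m else 0 := by
      intro m
      split_ifs
      · field_simp
        ring
      · ring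
    simp only [h3, Finset.sum_ite_eq, Finset.mem_univ, if_true]
    ring
  -- The Gauss equation: the correction is quadratic in the second fundamental form, a multiple of
  -- h. Summed over k it contributes −(n − 1) times b'²/(4cb), and `c0` contributes +1, which makes
  -- 2 − n.
  have c1 : ∀ k : Fin n, curvOp (block (fun _ => c) b h) i.succ k.succ j.succ k.succ z =
      curvOp h i k j k (tail z) - deriv b (z 0) ^ 2 / (4 * c * b (z 0)) *
        (h (tail z) i j - if i = k then h (tail z) i j else 0) := by
    intro k
    rw [curvOp, pd_christoffel_ijk H, pd_christoffel_ijk H, Fin.sum_univ_succ]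
    simp only [H0.christoffel_ij0, H0.christoffel_i0j, H0.christoffel_ijk, curvOp, Fin.cases_succ]
    by_cases hik : i = k
    · simp [hik]
    · simp only [hik, if_true, if_false]
      field_simp
      ring
  rw [ricci, Fin.sum_univ_succ, c0]
  simp only [c1, Finset.sum_sub_distrib, ← Finset.mul_sum, Finset.sum_const, Finset.sum_ite_eq,
    Finset.mem_univ, if_true, Finset.card_univ, Fintype.card_fin, nsmul_eq_mul]
  rw [ricci]
  ring

/-- The curvature of a product metric. -/
theorem curvOp_product (H : ∀ᶠ w in 𝓝 z, IsBlockAt a (fun _ => 1) h w) (i j k l : Fin (n + 1)) :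
    curvOp (block a (fun _ => 1) h) i j k l z =
      Fin.cases (motive := fun _ => ℝ) 0 (fun i => Fin.cases (motive := fun _ => ℝ) 0 (fun j =>
        Fin.cases (motive := fun _ => ℝ) 0 (fun k => Fin.cases (motive := fun _ => ℝ) 0 (fun l =>
          curvOp h i j k l (tail z)) l) k) j) i := by
  have H0 := H.self_of_nhds
  have hz : ∀ {f : EuclideanSpace ℝ (Fin (n + 1)) → ℝ}, (∀ w, IsBlockAt a (fun _ => 1) h w → f w = 0) →
      ∀ m, pd m f z = 0 := by
    intro f hf m
    have h1 : f =ᶠ[𝓝 z] fun _ => 0 := H.mono hf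
    rw [pd_congr h1, pd_const]
  have p1 := fun k => hz fun w hw => hw.christoffel_00 k
  have p2 := fun k => hz fun w hw => hw.christoffel_0i0 k
  have p3 := fun k => hz fun w hw => hw.christoffel_i00 k
  have p4 := fun i j => hz fun w hw => (hw.christoffel_0ij i j).trans (by simp)
  have p5 := fun i j => hz fun w hw => (hw.christoffel_i0j i j).trans (by simp)
  have p6 := fun i j => hz fun w hw => (hw.christoffel_ij0 i j).trans (by simp)
  -- The function a enters only through Γ₀₀⁰, which depends on t alone; its derivatives along the
  -- fibre vanish, so a leaves no trace in the curvature.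
  have p7 : ∀ m : Fin n, pd m.succ (christoffel (block a (fun _ => 1) h) 0 0 0) z = 0 := by
    intro m
    have h1 : christoffel (block a (fun _ => 1) h) 0 0 0 =ᶠ[𝓝 z] fun w =>
        (fun t => deriv a t / (2 * a t)) (w 0) := H.mono fun w hw => hw.christoffel_000
    have hd : DifferentiableAt ℝ (fun t => deriv a t / (2 * a t)) (z 0) := by
      have : ContDiffAt ℝ ∞ (deriv a) (z 0) := by
        exact (H0.smooth_left.fderiv_right (m := ∞) (by simp)).clm_apply contDiffAt_const
      exact this.diff.div (H0.smooth_left.diff.const_mul 2) (mul_ne_zero two_ne_zero H0.left_ne)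
    rw [pd_congr h1, pd_comp_zero hd]
    simp
  refine Fin.cases ?_ (fun i => ?_) i <;> refine Fin.cases ?_ (fun j => ?_) j <;>
    refine Fin.cases ?_ (fun k => ?_) k <;> refine Fin.cases ?_ (fun l => ?_) l <;>
    simp [curvOp, Fin.sum_univ_succ, p1, p2, p3, p4, p5, p6, p7, H0.christoffel_00,
      H0.christoffel_0i0, H0.christoffel_i00, H0.christoffel_0ij, H0.christoffel_i0j,
      H0.christoffel_ij0, H0.christoffel_ijk, pd_christoffel_ijk H]

end IsBlockAt

end Block

/-! ### Three-dimensional Einstein metrics -/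

/-- In dimension three, a trace-free algebraic curvature tensor vanishes. -/
theorem eq_zero_of_trace_eq_zero {g : Fin 3 → Fin 3 → ℝ} (hs : ∀ i j, g i j = g j i)
    (hd : (Matrix.of g).det ≠ 0) {D : Fin 3 → Fin 3 → Fin 3 → Fin 3 → ℝ} (left : ∀ i j k l, D i j k l = -D j i k l)
    (right : ∀ i j k l, D i j k l = -D i j l k)
    (htr : ∀ i k, ∑ j, ∑ l, g j l * D i j k l = 0) (i j k l : Fin 3) : D i j k l = 0 := by
  have l0 : ∀ i k l, D i i k l = 0 := fun i k l => by linarith [left i i k l]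
  have r0 : ∀ i j k, D i j k k = 0 := fun i j k => by linarith [right i j k k]
  -- With g in the role of the inverse metric, this is minus the Einstein tensor with raised
  -- indices. In dimension three its components are, up to sign, det g times the components of D on
  -- the complementary index pairs, so each of the latter can be isolated.
  have q : ∀ a b : Fin 3, g a b * ((∑ i, ∑ k, g i k * ∑ j, ∑ l, g j l * D i j k l) / 2) -
      ∑ i, ∑ k, g a i * g k b * ∑ j, ∑ l, g j l * D i j k l = 0 := by
    intro a b
    simp [htr]
  simp only [Fin.sum_univ_three, l0, r0, left 1 0, left 2 0, left 2 1, right _ _ 1 0, right _ _ 2 0,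
    right _ _ 2 1, hs 1 0, hs 2 0, hs 2 1] at q
  have hdet := hd
  simp only [Matrix.det_fin_three, Matrix.of_apply, hs 1 0, hs 2 0, hs 2 1] at hdet
  have fin : ∀ x, (g 0 0 * g 1 1 * g 2 2 - g 0 0 * g 1 2 * g 1 2 - g 0 1 * g 0 1 * g 2 2 + g 0 1 * g 1 2 * g 0 2 +
      g 0 2 * g 0 1 * g 1 2 - g 0 2 * g 1 1 * g 0 2) * x = 0 → x = 0 :=
    fun x hx => (mul_eq_zero.1 hx).resolve_left hdet
  have m22 : D 0 1 0 1 = 0 := fin _ (by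
    have h0 := q 2 2
    simp only [hs 2 0, hs 2 1] at h0
    linear_combination h0)
  have m21 : D 0 1 0 2 = 0 := fin _ (by
    have h0 := q 1 2
    simp only [hs 1 0] at h0
    linear_combination -h0)
  have m12 : D 0 2 0 1 = 0 := fin _ (by
    have h0 := q 2 1
    simp only [hs 2 0, hs 2 1] at h0
    linear_combination -h0)
  have m20 : D 0 1 1 2 = 0 := fin _ (by
    linear_combination q 0 2)
  have m02 : D 1 2 0 1 = 0 := fin _ (by
    have h0 := q 2 0
    simp only [hs 1 0, hs 2 0, hs 2 1] at h0
    linear_combination h0)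
  have m11 : D 0 2 0 2 = 0 := fin _ (by
    have h0 := q 1 1
    simp only [hs 1 0, hs 2 1] at h0
    linear_combination h0)
  have m10 : D 0 2 1 2 = 0 := fin _ (by
    have h0 := q 0 1
    simp only [hs 2 1] at h0
    linear_combination -h0)
  have m01 : D 1 2 0 2 = 0 := fin _ (by
    have h0 := q 1 0
    simp only [hs 1 0, hs 2 0] at h0
    linear_combination -h0)
  have m00 : D 1 2 1 2 = 0 := fin _ (by
    have h0 := q 0 0
    simp only [hs 1 0, hs 2 0] at h0
    linear_combination h0)
  fin_cases i <;> fin_cases j <;> fin_cases k <;> fin_cases l <;>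
    simp [l0, r0, left 1 0, left 2 0, left 2 1, right _ _ 1 0, right _ _ 2 0, right _ _ 2 1,
      m22, m21, m12, m20, m02, m11, m10, m01, m00]

section Einstein

variable {h : EuclideanSpace ℝ (Fin 3) → Matrix (Fin 3) (Fin 3) ℝ} {y : EuclideanSpace ℝ (Fin 3)}
  {κ : ℝ}

theorem IsMetricAt.sum_riemann_mul_inv {n : ℕ}
    {h : EuclideanSpace ℝ (Fin n) → Matrix (Fin n) (Fin n) ℝ} {y : EuclideanSpace ℝ (Fin n)}
    (hm : IsMetricAt h y) (i j k l : Fin n) :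
    ∑ m, riemann h i j k m y * (h y)⁻¹ m l = curvOp h i j k l y := by
  simp only [riemann, Finset.sum_mul]
  rw [Finset.sum_comm]
  have h1 : ∀ p, ∑ m, curvOp h i j k p y * h y p m * (h y)⁻¹ m l =
      curvOp h i j k p y * if p = l then 1 else 0 := by
    intro p
    rw [← hm.sum_mul_inv p l, Finset.mul_sum]
    exact Finset.sum_congr rfl fun m _ => mul_assoc _ _ _
  simp [h1]

/-- The difference between R and the constant-curvature tensor with the same Ricci tensor is
trace-free. In dimension three the Ricci tensor determines the curvature, so the difference
vanishes. -/
theorem riemann_of_ricci (hm : ∀ᶠ z in 𝓝 y, IsMetricAt h z)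
    (hρ : ∀ i j, ricci h i j y = κ * h y i j) (i j k l : Fin 3) :
    riemann h i j k l y = κ / 2 * (h y i k * h y j l - h y i l * h y j k) := by
  have hy := hm.self_of_nhds
  have hdet : (h y)⁻¹.det ≠ 0 := by
    rw [Matrix.det_nonsing_inv, Ring.inverse_eq_inv]
    exact inv_ne_zero hy.nondeg
  rw [← sub_eq_zero]
  refine eq_zero_of_trace_eq_zero (g := fun a b => (h y)⁻¹ a b) hy.inv_symm hdet (D := fun i j k l =>
    riemann h i j k l y - κ / 2 * (h y i k * h y j l - h y i l * h y j k))
    (fun i j k l => ?_) (fun i j k l => ?_) (fun i k => ?_) i j k l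
  · rw [riemann_antisymm_left]; ring
  · rw [hy.riemann_antisymm_right hm]; ring
  · have h1 : ∀ j, ∑ l, (h y)⁻¹ j l * (riemann h i j k l y -
        κ / 2 * (h y i k * h y j l - h y i l * h y j k)) = curvOp h i j k j y -
        κ / 2 * (h y i k - (if i = j then 1 else 0) * h y j k) := by
      intro j
      have e1 : ∑ l, h y j l * (h y)⁻¹ l j = 1 := by rw [hy.sum_mul_inv, if_pos rfl]
      have e2 : κ / 2 * (h y i k - (if i = j then 1 else 0) * h y j k) = κ / 2 *
          (h y i k * ∑ l, h y j l * (h y)⁻¹ l j - (∑ l, h y i l * (h y)⁻¹ l j) * h y j k) := by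
        rw [e1, hy.sum_mul_inv i j, mul_one]
      rw [← hy.sum_riemann_mul_inv i j k j, e2]
      simp only [Finset.mul_sum, Finset.sum_mul, ← Finset.sum_sub_distrib]
      exact Finset.sum_congr rfl fun l _ => by rw [hy.inv_symm j l]; ring
    simp only [h1, Finset.sum_sub_distrib, ← Finset.mul_sum]
    have h2 := hρ i k
    rw [ricci] at h2
    rw [h2]
    simp
    ring

theorem curvOp_of_ricci (hm : ∀ᶠ z in 𝓝 y, IsMetricAt h z)
    (hρ : ∀ i j, ricci h i j y = κ * h y i j) (i j k l : Fin 3) :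
    curvOp h i j k l y = κ / 2 * ((if j = l then 1 else 0) * h y i k -
      (if i = l then 1 else 0) * h y j k) := by
  have hy := hm.self_of_nhds
  rw [← hy.sum_riemann_mul_inv, ← hy.sum_mul_inv j l, ← hy.sum_mul_inv i l]
  simp only [riemann_of_ricci hm hρ, Finset.mul_sum, Finset.sum_mul, ← Finset.sum_sub_distrib]
  exact Finset.sum_congr rfl fun m _ => by ring

theorem sectional_of_ricci (hm : ∀ᶠ z in 𝓝 y, IsMetricAt h z)
    (hρ : ∀ i j, ricci h i j y = κ * h y i j) {v w : Fin 3 → ℝ}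
    (hvw : pair h y v v * pair h y w w - pair h y v w ^ 2 ≠ 0) : sectional h y v w = κ / 2 := by
  rw [sectional, div_eq_iff hvw]
  have h1 : pair h y v w = pair h y w v := by
    rw [pair, pair, Finset.sum_comm]
    exact Finset.sum_congr rfl fun i _ => Finset.sum_congr rfl fun j _ => by
      rw [hm.self_of_nhds.symm_apply i j]; ring
  have h2 : pair h y v w ^ 2 = pair h y v w * pair h y w v := by rw [← h1, sq]
  rw [h2]
  simp only [riemann_of_ricci hm hρ, pair, Fin.sum_univ_three]
  ring

end Einstein

/-! ### The metric in Gauss coordinates is a warped product -/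

theorem eq_of_pd_zero_eq_zero {n : ℕ} {S : Set (EuclideanSpace ℝ (Fin (n + 1)))} (hS : Convex ℝ S)
    {w : EuclideanSpace ℝ (Fin (n + 1)) → ℝ} (hw : ∀ z ∈ S, DifferentiableAt ℝ w z)
    (h : ∀ z ∈ S, pd 0 w z = 0) {z z' : EuclideanSpace ℝ (Fin (n + 1))} (hz : z ∈ S)
    (hz' : z' ∈ S) (h0 : tail z = tail z') : w z = w z' := by
  have hmem : ∀ τ ∈ Icc (0 : ℝ) 1, z' + τ • (z - z') ∈ S :=
    fun τ hτ => hS.add_smul_sub_mem hz' hz hτ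
  have hd : ∀ τ ∈ Icc (0 : ℝ) 1, HasDerivAt (fun τ : ℝ => w (z' + τ • (z - z'))) 0 τ := by
    intro τ hτ
    have h1 : HasDerivAt (fun τ : ℝ => z' + τ • (z - z')) (z - z') τ := by
      simpa using ((hasDerivAt_id τ).smul_const (z - z')).const_add z'
    have h2 := (hw _ (hmem τ hτ)).hasFDerivAt.comp_hasDerivAt τ h1
    have h3 : ∑ a, (z - z') a * pd a w (z' + τ • (z - z')) = 0 := by
      rw [Fin.sum_univ_succ, h _ (hmem τ hτ), mul_zero, zero_add]
      refine Finset.sum_eq_zero fun a _ => ?_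
      have h4 : z a.succ = z' a.succ := congrArg (fun y : EuclideanSpace ℝ (Fin n) => y a) h0
      rw [PiLp.sub_apply, h4, sub_self, zero_mul]
    rw [fderiv_apply_eq_sum, h3] at h2
    exact h2
  have h3 := constant_of_has_deriv_right_zero
    (fun τ hτ => (hd τ hτ).continuousAt.continuousWithinAt)
    (fun τ hτ => (hd τ ⟨hτ.1, hτ.2.le⟩).hasDerivWithinAt) 1 ⟨zero_le_one, le_rfl⟩
  simpa using h3

/-- A primitive of a smooth function on an interval around `0`. -/
theorem exists_primitive {r : ℝ} (hr : 0 < r) {p : ℝ → ℝ} (hp : ContDiffOn ℝ ∞ p (Ioo (-r) r)) :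
    ∃ Φ : ℝ → ℝ, ContDiffOn ℝ ∞ Φ (Ioo (-r) r) ∧ ∀ t ∈ Ioo (-r) r, HasDerivAt Φ (p t) t := by
  have hd : ∀ t ∈ Ioo (-r) r, HasDerivAt (fun t => ∫ τ in (0 : ℝ)..t, p τ) (p t) t := by
    intro t ht
    have hsub : uIcc 0 t ⊆ Ioo (-r) r := by
      intro τ hτ
      rcases le_total 0 t with h | h
      · rw [uIcc_of_le h] at hτ
        exact ⟨by linarith [hτ.1], by linarith [hτ.2, ht.2]⟩
      · rw [uIcc_of_ge h] at hτ
        exact ⟨by linarith [hτ.1, ht.1], by linarith [hτ.2]⟩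
    have hn : Ioo (-r) r ∈ 𝓝 t := isOpen_Ioo.mem_nhds ht
    exact intervalIntegral.integral_hasDerivAt_right
      ((hp.continuousOn.mono hsub).intervalIntegrable)
      (hp.continuousOn.stronglyMeasurableAtFilter isOpen_Ioo t ht)
      (hp.continuousOn.continuousAt hn)
  refine ⟨fun t => ∫ τ in (0 : ℝ)..t, p τ, ?_, hd⟩
  rw [contDiffOn_infty_iff_deriv_of_isOpen isOpen_Ioo]
  exact ⟨fun t ht => (hd t ht).differentiableAt.differentiableWithinAt,
    hp.congr fun t ht => (hd t ht).deriv⟩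

/-- The point `(t, y)`. -/
def point {n : ℕ} (t : ℝ) (y : EuclideanSpace ℝ (Fin n)) : EuclideanSpace ℝ (Fin (n + 1)) :=
  WithLp.toLp 2 (Fin.cons t y)

@[simp] theorem point_zero {n : ℕ} (t : ℝ) (y : EuclideanSpace ℝ (Fin n)) : point t y 0 = t := rfl

@[simp] theorem tail_point {n : ℕ} (t : ℝ) (y : EuclideanSpace ℝ (Fin n)) : tail (point t y) = y := rfl

theorem contDiff_point_left {n : ℕ} (y : EuclideanSpace ℝ (Fin n)) :
    ContDiff ℝ ∞ fun t => point t y := by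
  rw [contDiff_euclidean]
  refine Fin.cases ?_ fun i => ?_
  · exact contDiff_id
  · exact contDiff_const

theorem contDiff_point_right {n : ℕ} (t : ℝ) :
    ContDiff ℝ ∞ fun y : EuclideanSpace ℝ (Fin n) => point t y := by
  rw [contDiff_euclidean]
  refine Fin.cases ?_ fun i => ?_
  · exact contDiff_const
  · exact contDiff_coordinate i

theorem point_mem_box {n : ℕ} {r t : ℝ} {y : EuclideanSpace ℝ (Fin n)} :
    point t y ∈ box r ↔ t ∈ Ioo (-r) r ∧ y ∈ Metric.ball 0 r := Iff.rfl

section Warped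

variable {μ s : ℝ} {G : EuclideanSpace ℝ (Fin 4) → Matrix (Fin 4) (Fin 4) ℝ}
  {F L : EuclideanSpace ℝ (Fin 4) → ℝ} {V : Set (EuclideanSpace ℝ (Fin 4))}
  {x : EuclideanSpace ℝ (Fin 4)} {ε r : ℝ}
  {ψ : OpenPartialHomeomorph (EuclideanSpace ℝ (Fin 4)) (EuclideanSpace ℝ (Fin 4))}

theorem IsGaussChart.sign_mul_self (hψ : IsGaussChart G F x ε r ψ) : ε * ε = 1 := by
  rcases hψ.sign with h | h <;> rw [h] <;> norm_num

theorem IsGaussChart.inv_metric_zero (hψ : IsGaussChart G F x ε r ψ) {z : EuclideanSpace ℝ (Fin 4)}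
    (hz : z ∈ ψ.source) (hm : IsMetricAt (pullback ψ G) z) (j : Fin 4) :
    (pullback ψ G z)⁻¹ 0 j = if j = 0 then ε else 0 := by
  have h1 := hm.sum_mul_inv 0 j
  rw [Fin.sum_univ_succ, hψ.metric_zero z hz, Finset.sum_eq_zero fun a _ => by
    rw [hψ.metric_cross z hz _ (Fin.succ_ne_zero a), zero_mul], add_zero] at h1
  calc (pullback ψ G z)⁻¹ 0 j = ε * (ε * (pullback ψ G z)⁻¹ 0 j) := by
        rw [← mul_assoc, hψ.sign_mul_self, one_mul]
    _ = _ := by rw [h1]; simp [eq_comm]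

theorem IsGaussChart.gradNormSq_eq (hψ : IsGaussChart G F x ε r ψ) {z : EuclideanSpace ℝ (Fin 4)}
    (hz : z ∈ ψ.source) (hm : IsMetricAt (pullback ψ G) z) :
    gradNormSq (pullback ψ G) (fun z => F (ψ z)) z = ε * pd 0 (fun z => F (ψ z)) z ^ 2 := by
  rw [gradNormSq, Fin.sum_univ_succ, Finset.sum_eq_zero (s := Finset.univ (α := Fin 3)), add_zero,
    Fin.sum_univ_succ, Finset.sum_eq_zero, hψ.inv_metric_zero hz hm, if_pos rfl]
  · ring
  · intro a _
    rw [hψ.pd_eq_zero z hz _ (Fin.succ_ne_zero a), mul_zero]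
  · intro a _
    simp only [hψ.pd_eq_zero z hz _ (Fin.succ_ne_zero a), mul_zero, zero_mul, Finset.sum_const_zero]

/-- The coefficient `α` in `Hes_F = α g + β dF ⊗ dF`, in Gauss coordinates. -/
def hessLeft (ε : ℝ) (G : EuclideanSpace ℝ (Fin 4) → Matrix (Fin 4) (Fin 4) ℝ)
    (F : EuclideanSpace ℝ (Fin 4) → ℝ) (z : EuclideanSpace ℝ (Fin 4)) : ℝ :=
  1 / 3 * (∑ i, ∑ j, (G z)⁻¹ i j * hessian G F i j z - ε * hessian G F 0 0 z)

/-- The coefficient `β` in `Hes_F = α g + β dF ⊗ dF`, in Gauss coordinates. -/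
def hessRight (ε : ℝ) (G : EuclideanSpace ℝ (Fin 4) → Matrix (Fin 4) (Fin 4) ℝ)
    (F : EuclideanSpace ℝ (Fin 4) → ℝ) (z : EuclideanSpace ℝ (Fin 4)) : ℝ :=
  (hessian G F 0 0 z - ε * hessLeft ε G F z) / pd 0 F z ^ 2

/-- The properties of Gauss coordinates. -/
structure IsGaussAt (μ ε : ℝ) (G : EuclideanSpace ℝ (Fin 4) → Matrix (Fin 4) (Fin 4) ℝ)
    (F L A : EuclideanSpace ℝ (Fin 4) → ℝ) (z : EuclideanSpace ℝ (Fin 4)) : Prop where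
  qe : IsQEAt μ G F L z
  metric_zero : G z 0 0 = ε
  metric_cross : ∀ a, a ≠ 0 → G z 0 a = 0
  pd_eq_zero : ∀ a, a ≠ 0 → pd a F z = 0
  pd_zero_ne : pd 0 F z ≠ 0
  smooth : ContDiffAt ℝ ∞ A z
  hessian_eq : ∀ a b, a ≠ 0 → b ≠ 0 → hessian G F a b z = A z * G z a b
  pd_left : ∀ a, a ≠ 0 → pd a A z = 0
  pd_lam : ∀ a, a ≠ 0 → pd a L z = 0

/-- The coefficients α and β are known pointwise only; in Gauss coordinates they are recovered by
explicit smooth formulas. Smoothness allows the proportionality of dα and dL to dF to be applied,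
and dF vanishes along the slices. -/
theorem IsQEOn.isGaussAt (h : IsQEOn μ s G F L V) (hμ : μ ≠ -1 / 2)
    (hψ : IsGaussChart G F x ε r ψ) (hV : ψ.target ⊆ V) {z : EuclideanSpace ℝ (Fin 4)}
    (hz : z ∈ ψ.source) : IsGaussAt μ ε (pullback ψ G) (fun z => F (ψ z)) (fun z => L (ψ z))
      (hessLeft ε (pullback ψ G) fun z => F (ψ z)) z := by
  have hq : ∀ z ∈ ψ.source, IsQEAt μ (pullback ψ G) (fun z => F (ψ z)) (fun z => L (ψ z)) z :=
    fun z hz => h.pullback_qe ψ hψ.isDiffeo hV z hz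
  have hne : ∀ z ∈ ψ.source, pd 0 (fun z => F (ψ z)) z ≠ 0 := by
    intro z hz h0
    have h1 := (hq z hz).gradNormSq_ne
    rw [hψ.gradNormSq_eq hz (hq z hz).metric.self_of_nhds, h0] at h1
    exact h1 (by ring)
  have hA : ∀ z ∈ ψ.source, ContDiffAt ℝ ∞ (hessLeft ε (pullback ψ G) fun z => F (ψ z)) z := by
    intro z hz
    have hm := (hq z hz).metric.self_of_nhds
    have hs := (hq z hz).smooth.self_of_nhds
    exact contDiffAt_const.mul ((ContDiffAt.sum fun i _ => ContDiffAt.sum fun j _ =>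
      (hm.inv_smooth i j).mul (hm.hessian_smooth hs i j)).sub
      (contDiffAt_const.mul (hm.hessian_smooth hs 0 0)))
  have hB : ∀ z ∈ ψ.source, ContDiffAt ℝ ∞ (hessRight ε (pullback ψ G) fun z => F (ψ z)) z := by
    intro z hz
    have hm := (hq z hz).metric.self_of_nhds
    have hs := (hq z hz).smooth.self_of_nhds
    exact ((hm.hessian_smooth hs 0 0).sub (contDiffAt_const.mul (hA z hz))).div
      ((contDiffAt_pd hs 0).pow 2) (pow_ne_zero 2 (hne z hz))
  have key : ∀ z ∈ ψ.source, ∀ α β, (∀ i j, hessian G F i j (ψ z) = α * G (ψ z) i j +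
      β * (pd i F (ψ z) * pd j F (ψ z))) → α = hessLeft ε (pullback ψ G) (fun z => F (ψ z)) z ∧
      β = hessRight ε (pullback ψ G) (fun z => F (ψ z)) z := by
    intro z hz α β hαβ
    have hb := h.qe _ (hV (ψ.map_source hz))
    have hm := (hq z hz).metric.self_of_nhds
    have h1 := hessian_pullback_eq (hψ.isDiffeo.eventually hz) (hψ.isDiffeo.det_ne z hz)
      hb.metric.self_of_nhds hb.smooth hαβ
    have h2 := h1 0 0
    rw [hψ.metric_zero z hz] at h2
    have h3 : ∑ i, ∑ j, (pullback ψ G z)⁻¹ i j * hessian (pullback ψ G) (fun z => F (ψ z)) i j z =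
        α * 4 + β * gradNormSq (pullback ψ G) (fun z => F (ψ z)) z := by
      have h4 : ∀ i, ∑ j, (pullback ψ G z)⁻¹ i j * pullback ψ G z i j = 1 := by
        intro i
        have h5 := hm.sum_inv_mul i i
        rw [if_pos rfl] at h5
        rw [← h5]
        exact Finset.sum_congr rfl fun j _ => by rw [hm.symm_apply i j]
      have h5 : (4 : ℝ) = ∑ i : Fin 4, ∑ j, (pullback ψ G z)⁻¹ i j * pullback ψ G z i j := by
        simp [h4]
      rw [h5, gradNormSq]
      simp only [Finset.mul_sum, ← Finset.sum_add_distrib, h1]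
      exact Finset.sum_congr rfl fun i _ => Finset.sum_congr rfl fun j _ => by ring
    have hε := hψ.sign_mul_self
    -- The trace of the Hessian is 4α + β‖∇F‖², the (0,0) component times ε is α + εβ(∂₀F)², and
    -- ‖∇F‖² = ε(∂₀F)². Subtracting leaves 3α.
    have hα : α = hessLeft ε (pullback ψ G) (fun z => F (ψ z)) z := by
      rw [hessLeft, h3, h2, hψ.gradNormSq_eq hz hm]
      linear_combination (1 / 3 * α) * hε
    refine ⟨hα, ?_⟩
    rw [hessRight, ← hα, eq_div_iff (pow_ne_zero 2 (hne z hz)), h2]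
    ring
  have hxz : ψ z ∈ V := hV (ψ.map_source hz)
  have hsymm := hψ.isDiffeo.smooth_symm _ (ψ.map_source hz)
  have hleft : ψ.symm (ψ z) = z := ψ.left_inv hz
  have hAs : ContDiffAt ℝ ∞ (fun y => hessLeft ε (pullback ψ G) (fun z => F (ψ z)) (ψ.symm y)) (ψ z) :=
    ContDiffAt.comp (ψ z) (g := hessLeft ε (pullback ψ G) fun z => F (ψ z))
      (by rw [hleft]; exact hA z hz) hsymm
  -- The coefficients are carried back to V by the inverse chart, because the proportionality
  -- statement is made in the original coordinates.
  obtain ⟨⟨cA, hcA⟩, -, cL, hcL⟩ := h.exists_pd_eq_of_hessian_eq hxz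
    (α := fun y => hessLeft ε (pullback ψ G) (fun z => F (ψ z)) (ψ.symm y))
    (β := fun y => hessRight ε (pullback ψ G) (fun z => F (ψ z)) (ψ.symm y))
    hAs.diff
    (ContDiffAt.comp (ψ z) (g := hessRight ε (pullback ψ G) fun z => F (ψ z))
      (by rw [hleft]; exact hB z hz) hsymm).diff (by
    filter_upwards [ψ.open_target.mem_nhds (ψ.map_source hz)] with y hy
    obtain ⟨α, β, hαβ⟩ := h.exists_hessian_eq hμ (hV hy)
    obtain ⟨e1, e2⟩ := key (ψ.symm y) (ψ.map_target hy) α β (by rwa [ψ.right_inv hy])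
    rwa [← e1, ← e2])
  have hb := h.qe _ hxz
  have hφ := hψ.isDiffeo.smooth z hz
  have hpF : ∀ a, a ≠ 0 → ∑ b, pd b F (ψ z) * jac ψ z b a = 0 := by
    intro a ha
    rw [← pd_comp_jac hb.smooth.self_of_nhds hφ]
    exact hψ.pd_eq_zero z hz a ha
  refine ⟨hq z hz, hψ.metric_zero z hz, hψ.metric_cross z hz, hψ.pd_eq_zero z hz, hne z hz, hA z hz,
    fun a b ha hb' => ?_, fun a ha => ?_, fun a ha => ?_⟩
  · obtain ⟨α, β, hαβ⟩ := h.exists_hessian_eq hμ hxz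
    rw [← (key z hz α β hαβ).1, hessian_pullback_eq (hψ.isDiffeo.eventually hz)
      (hψ.isDiffeo.det_ne z hz) hb.metric.self_of_nhds hb.smooth hαβ, hψ.pd_eq_zero z hz a ha]
    ring
  · have e : hessLeft ε (pullback ψ G) (fun z => F (ψ z)) =ᶠ[𝓝 z]
        fun y => (fun y => hessLeft ε (pullback ψ G) (fun z => F (ψ z)) (ψ.symm y)) (ψ y) := by
      filter_upwards [ψ.open_source.mem_nhds hz] with y hy
      simp only [ψ.left_inv hy]
    rw [pd_congr e, pd_comp_jac hAs hφ]
    simp only [hcA, mul_assoc, ← Finset.mul_sum, hpF a ha, mul_zero]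
  · rw [pd_comp_jac hb.smooth' hφ]
    simp only [hcL, mul_assoc, ← Finset.mul_sum, hpF a ha, mul_zero]

/-- Along a slice Hes_F(∂_a, ∂_b) = −Γ_ab⁰ ∂₀F, and Γ_ab,₀ = −½ ∂₀g_ab because the cross terms of
the metric vanish. The Hessian equation therefore says that the slices are umbilic. -/
theorem IsGaussAt.pd_metric_eq {A : EuclideanSpace ℝ (Fin 4) → ℝ} {S : Set (EuclideanSpace ℝ (Fin 4))}
    (hS : IsOpen S) (hG : ∀ z ∈ S, IsGaussAt μ ε G F L A z)
    {z : EuclideanSpace ℝ (Fin 4)} (hz : z ∈ S) {a b : Fin 4} (ha : a ≠ 0) (hb : b ≠ 0) :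
    pd 0 (fun z => G z a b) z = 2 * (ε * A z / pd 0 F z) * G z a b := by
  have hm := (hG z hz).qe.metric.self_of_nhds
  have hn : ∀ᶠ y in 𝓝 z, y ∈ S := hS.eventually_mem hz
  have h1 := (hG z hz).hessian_eq a b ha hb
  have e1 : pd a (pd b F) z = 0 := by
    rw [pd_congr (hn.mono fun y hy => (hG y hy).pd_eq_zero b hb : pd b F =ᶠ[𝓝 z] fun _ => (0 : ℝ)),
      pd_const]
  rw [hessian, e1, Fin.sum_univ_succ, Finset.sum_eq_zero fun c _ => by
    rw [(hG z hz).pd_eq_zero _ (Fin.succ_ne_zero c), mul_zero]] at h1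
  have h2 := hm.sum_christoffel_mul a b 0
  have e2 : ∀ c b, c ≠ 0 → b ≠ 0 → pd c (fun y => G y b 0) z = 0 := by
    intro c b _ hb
    rw [pd_congr (hn.mono fun y hy => by
      change G y b 0 = 0
      rw [(hG y hy).qe.metric.self_of_nhds.symm_apply, (hG y hy).metric_cross b hb] :
      (fun y => G y b 0) =ᶠ[𝓝 z] fun _ => (0 : ℝ)), pd_const]
  rw [Fin.sum_univ_succ, Finset.sum_eq_zero fun c _ => by
    rw [hm.symm_apply, (hG z hz).metric_cross _ (Fin.succ_ne_zero c), mul_zero], christoffelLower,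
    e2 a b ha hb, e2 b a hb ha, (hG z hz).metric_zero] at h2
  have hF := (hG z hz).pd_zero_ne
  field_simp
  linear_combination (2 * ε) * h1 + (2 * pd 0 F z) * h2

/-- α and ∂₀F depend on t alone, so the linear equation for g_ab in t integrates to a common factor
φ². The quasi-Einstein equation on the fibre then makes h Einstein. -/
theorem exists_warped {A : EuclideanSpace ℝ (Fin 4) → ℝ} (hr : 0 < r) (hε : ε * ε = 1)
    (hG : ∀ z ∈ box r, IsGaussAt μ ε G F L A z) :
    ∃ (φ : ℝ → ℝ) (h : EuclideanSpace ℝ (Fin 3) → Matrix (Fin 3) (Fin 3) ℝ) (κ : ℝ),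
      ContDiffOn ℝ ∞ φ (Ioo (-r) r) ∧ (∀ t, 0 < φ t) ∧
      (∀ z ∈ box r, G z = block (fun _ => ε) (fun t => φ t ^ 2) h z) ∧
      ∀ y ∈ Metric.ball 0 r, IsMetricAt h y ∧ ∀ i j, ricci h i j y = κ * h y i j := by
  have ho : IsOpen (box (n := 3) r) := isOpen_box r
  have hc : Convex ℝ (box (n := 3) r) := convex_box r
  have hmem : ∀ t ∈ Ioo (-r) r, point t 0 ∈ box (n := 3) r := fun t ht =>
    point_mem_box.2 ⟨ht, Metric.mem_ball_self hr⟩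
  have hmem' : ∀ y ∈ Metric.ball 0 r, point 0 y ∈ box (n := 3) r := fun y hy =>
    point_mem_box.2 ⟨⟨by linarith, hr⟩, hy⟩
  have hF2 : ∀ z ∈ box r, ∀ a, a ≠ 0 → pd a (pd 0 F) z = 0 := by
    intro z hz a ha
    rw [pd_comm (hG z hz).qe.smooth.self_of_nhds, pd_congr ((ho.eventually_mem hz).mono fun y hy =>
      (hG y hy).pd_eq_zero a ha : pd a F =ᶠ[𝓝 z] fun _ => (0 : ℝ)), pd_const]
  have eA : ∀ z ∈ box r, A z = A (point (z 0) 0) := fun z hz => eq_of_pd_eq_zero hc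
    (fun y hy => (hG y hy).smooth.diff) (fun y hy => (hG y hy).pd_left) hz (hmem _ hz.1) rfl
  have eL : ∀ z ∈ box r, L z = L (point (z 0) 0) := fun z hz => eq_of_pd_eq_zero hc
    (fun y hy => (hG y hy).qe.smooth'.diff) (fun y hy => (hG y hy).pd_lam) hz (hmem _ hz.1) rfl
  have eF : ∀ z ∈ box r, pd 0 F z = pd 0 F (point (z 0) 0) := fun z hz => eq_of_pd_eq_zero hc
    (fun y hy => (contDiffAt_pd (hG y hy).qe.smooth.self_of_nhds 0).diff) hF2 hz (hmem _ hz.1) rfl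
  -- The logarithmic derivative of the warping function. The normalisation φ(0) = 1 makes h the
  -- metric induced on the slice t = 0.
  obtain ⟨Φ, hΦ, hΦ'⟩ := exists_primitive hr
    (p := fun t => ε * A (point t 0) / pd 0 F (point t 0)) fun t ht => by
      have hg := hG _ (hmem t ht)
      have hp := (contDiff_point_left (0 : EuclideanSpace ℝ (Fin 3))).contDiffAt (x := t)
      have h2 : ContDiffAt ℝ ∞ (fun t => pd 0 F (point t 0)) t :=
        ContDiffAt.comp t (g := pd 0 F) (contDiffAt_pd hg.qe.smooth.self_of_nhds 0) hp
      exact ((contDiffAt_const.mul (ContDiffAt.comp t (g := A) hg.smooth hp)).div h2 hg.pd_zero_ne).contDiffWithinAt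
  set φ : ℝ → ℝ := fun t => Real.exp (Φ t - Φ 0) with hφdef
  have hφs : ContDiffOn ℝ ∞ φ (Ioo (-r) r) := (hΦ.sub contDiffOn_const).exp
  set h : EuclideanSpace ℝ (Fin 3) → Matrix (Fin 3) (Fin 3) ℝ :=
    fun y => Matrix.of fun i j => G (point 0 y) i.succ j.succ with hh
  -- The product g_ab e^(−2Φ) has vanishing t-derivative, hence equals its value on the slice t = 0.
  have hwarp : ∀ z ∈ box r, ∀ a b, a ≠ 0 → b ≠ 0 → G z a b = φ (z 0) ^ 2 * G (point 0 (tail z)) a b := by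
    intro z hz a b ha hb
    have hexp : ∀ t ∈ Ioo (-r) r, HasDerivAt (fun t => Real.exp (-2 * Φ t))
        (Real.exp (-2 * Φ t) * (-2 * (ε * A (point t 0) / pd 0 F (point t 0)))) t :=
      fun t ht => ((hΦ' t ht).const_mul (-2)).exp
    have hd : ∀ y ∈ box (n := 3) r, DifferentiableAt ℝ
        (fun z : EuclideanSpace ℝ (Fin 4) => Real.exp (-2 * Φ (z 0))) y := fun y hy =>
      DifferentiableAt.comp (𝕜 := ℝ) y (g := fun t => Real.exp (-2 * Φ t)) (f := fun z => z 0)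
        (hexp _ hy.1).differentiableAt (contDiff_coordinate 0).contDiffAt.diff
    have h1 := eq_of_pd_zero_eq_zero hc (w := fun z => G z a b * Real.exp (-2 * Φ (z 0)))
      (fun y hy => ((hG y hy).qe.metric.self_of_nhds.smooth a b).diff.fun_mul (hd y hy))
      (fun y hy => by
        have h2 := pd_comp_zero (n := 3) (z := y) (hexp _ hy.1).differentiableAt 0
        rw [pd_mul ((hG y hy).qe.metric.self_of_nhds.smooth a b).diff (hd y hy), h2,
          (hexp _ hy.1).deriv, IsGaussAt.pd_metric_eq ho hG hy ha hb, ← eA y hy, ← eF y hy,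
          if_pos rfl]
        ring) hz (hmem' _ hz.2) rfl
    simp only [point_zero] at h1
    have h2 : φ (z 0) ^ 2 = Real.exp (-2 * Φ 0) / Real.exp (-2 * Φ (z 0)) := by
      rw [hφdef, ← Real.exp_sub, ← Real.exp_nat_mul]
      congr 1
      push_cast
      ring
    rw [h2, div_mul_eq_mul_div, eq_div_iff (Real.exp_pos _).ne', h1]
    ring
  have hGb : ∀ z ∈ box r, G z = block (fun _ => ε) (fun t => φ t ^ 2) h z := by
    intro z hz
    ext i j
    refine Fin.cases ?_ (fun i => ?_) i <;> refine Fin.cases ?_ (fun j => ?_) j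
    · exact (hG z hz).metric_zero
    · exact (hG z hz).metric_cross _ (Fin.succ_ne_zero j)
    · rw [(hG z hz).qe.metric.self_of_nhds.symm_apply]
      exact (hG z hz).metric_cross _ (Fin.succ_ne_zero i)
    · exact hwarp z hz _ _ (Fin.succ_ne_zero i) (Fin.succ_ne_zero j)
  have hmet : ∀ y ∈ Metric.ball 0 r, IsMetricAt h y := by
    intro y hy
    have hm := (hG _ (hmem' y hy)).qe.metric.self_of_nhds
    refine ⟨fun i j => (hm.smooth i.succ j.succ).comp y (contDiff_point_right 0).contDiffAt, ?_, ?_⟩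
    · filter_upwards [(contDiff_point_right (n := 3) 0).continuous.continuousAt.eventually hm.symm]
        with z hz
      exact Matrix.IsSymm.ext fun i j => hz.apply _ _
    · have h1 := hm.nondeg
      rw [Matrix.det_succ_row_zero, Fin.sum_univ_succ, Finset.sum_eq_zero fun c _ => by
        rw [(hG _ (hmem' y hy)).metric_cross _ (Fin.succ_ne_zero c)]; ring, add_zero] at h1
      exact right_ne_zero_of_mul h1
  have hblock : ∀ z ∈ box r, IsBlockAt (fun _ => ε) (fun t => φ t ^ 2) h z := fun z hz =>
    ⟨contDiffAt_const, (hφs.contDiffAt (isOpen_Ioo.mem_nhds hz.1)).pow 2, left_ne_zero_of_mul_eq_one hε,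
      pow_ne_zero 2 (Real.exp_pos _).ne', hmet _ hz.2⟩
  set b : ℝ → ℝ := fun t => φ t ^ 2 with hb
  -- The Einstein constant is read off at t = 0: the coefficient λ − α of the fibre equation, minus
  -- the contribution of the warping to the Ricci tensor. The term dF ⊗ dF drops out on the fibre,
  -- and λ and α are constant on the slice.
  refine ⟨φ, h, L (point 0 0) - A (point 0 0) - (-(deriv (deriv b) 0 / (2 * ε)) +
    (2 - (3 : ℕ)) * (deriv b 0 ^ 2 / (4 * ε * b 0))), hφs, fun t => Real.exp_pos _, hGb,
    fun y hy => ⟨hmet y hy, fun i j => ?_⟩⟩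
  have hz := hmem' y hy
  have hn := ho.eventually_mem hz
  have h1 := (hG _ hz).qe.eq.self_of_nhds i.succ j.succ
  rw [(hG _ hz).hessian_eq _ _ (Fin.succ_ne_zero i) (Fin.succ_ne_zero j),
    (hG _ hz).pd_eq_zero _ (Fin.succ_ne_zero i),
    ricci_congr (hn.mono fun z hz => hGb z hz), IsBlockAt.ricci_succ_succ (hn.mono hblock), eA _ hz,
    eL _ hz] at h1
  simp only [point_zero, tail_point] at h1
  have e : h y i j = G (point 0 y) i.succ j.succ := rfl
  rw [← e] at h1
  linear_combination h1

end Warped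

/-! ### Overdetermined linear systems in coordinates -/

section TotalSystem

variable {n : ℕ} {ι : Type} [Fintype ι] [DecidableEq ι]

theorem contDiffAt_sum_smul {B W τ : Type*} [NormedAddCommGroup B] [NormedSpace ℝ B]
    [NormedAddCommGroup W] [NormedSpace ℝ W] [Fintype τ] {m : τ → B → ℝ} {x : B}
    (hm : ∀ t, ContDiffAt ℝ ∞ (m t) x) (C : τ → W) : ContDiffAt ℝ ∞ (fun x => ∑ t, m t x • C t) x :=
  ContDiffAt.sum fun t _ => (hm t).smul contDiffAt_const

theorem fderiv_sum_smul {B W τ : Type*} [NormedAddCommGroup B] [NormedSpace ℝ B]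
    [NormedAddCommGroup W] [NormedSpace ℝ W] [Fintype τ] {m : τ → B → ℝ} {x : B}
    (hm : ∀ t, DifferentiableAt ℝ (m t) x) (C : τ → W) (y : B) :
    fderiv ℝ (fun x => ∑ t, m t x • C t) x y = ∑ t, fderiv ℝ (m t) x y • C t := by
  have h1 : HasFDerivAt (fun x => ∑ t, m t x • C t) (∑ t, (fderiv ℝ (m t) x).smulRight (C t)) x :=
    HasFDerivAt.fun_sum fun t (_ : t ∈ Finset.univ) => (hm t).hasFDerivAt.smul_const (C t)
  rw [h1.fderiv]
  simp

/-- The elementary bilinear maps. -/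
def bilinUnit (t : Fin n × ι × ι) : EuclideanSpace ℝ (Fin n) →L[ℝ] (ι → ℝ) →L[ℝ] (ι → ℝ) :=
  (EuclideanSpace.proj t.1 : EuclideanSpace ℝ (Fin n) →L[ℝ] ℝ).smulRight
    ((ContinuousLinearMap.proj (R := ℝ) (φ := fun _ : ι => ℝ) t.2.2).smulRight
      (Pi.single t.2.1 (1 : ℝ)))

/-- The bilinear map with the given coefficients. -/
def ofCoeffs (c : Fin n × ι × ι → ℝ) : EuclideanSpace ℝ (Fin n) →L[ℝ] (ι → ℝ) →L[ℝ] (ι → ℝ) :=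
  ∑ t, c t • bilinUnit t

theorem ofCoeffs_apply (c : Fin n × ι × ι → ℝ) (y : EuclideanSpace ℝ (Fin n)) (e : ι → ℝ) (p : ι) :
    ofCoeffs c y e p = ∑ i, y i * ∑ q, c (i, p, q) * e q := by
  simp only [ofCoeffs, bilinUnit, sum_apply, smul_apply,
    ContinuousLinearMap.smulRight_apply, Finset.sum_apply, Pi.smul_apply, smul_eq_mul,
    Pi.single_apply, PiLp.proj_apply, ContinuousLinearMap.proj_apply, Fintype.sum_prod_type]
  refine Finset.sum_congr rfl fun i _ => ?_
  rw [Finset.sum_comm, Finset.mul_sum]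
  refine Finset.sum_congr rfl fun q _ => ?_
  simp
  ring

theorem contDiffAt_ofCoeffs {M : Fin n × ι × ι → EuclideanSpace ℝ (Fin n) → ℝ}
    {x : EuclideanSpace ℝ (Fin n)} (hM : ∀ t, ContDiffAt ℝ ∞ (M t) x) :
    ContDiffAt ℝ ∞ (fun x => ofCoeffs fun t => M t x) x :=
  contDiffAt_sum_smul hM _

theorem fderiv_ofCoeffs {M : Fin n × ι × ι → EuclideanSpace ℝ (Fin n) → ℝ}
    {x : EuclideanSpace ℝ (Fin n)} (hM : ∀ t, DifferentiableAt ℝ (M t) x)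
    (y : EuclideanSpace ℝ (Fin n)) : fderiv ℝ (fun x => ofCoeffs fun t => M t x) x y =
      ofCoeffs fun t => fderiv ℝ (M t) x y := by
  have h := fderiv_sum_smul hM (bilinUnit (n := n) (ι := ι)) y
  exact h

theorem ofCoeffs_add_ofCoeffs {M : Fin n × ι × ι → EuclideanSpace ℝ (Fin n) → ℝ}
    {x y w : EuclideanSpace ℝ (Fin n)} {e : ι → ℝ} (p : ι) :
    ofCoeffs (fun t => fderiv ℝ (M t) x w) y e p +
      ofCoeffs (fun t => M t x) y (ofCoeffs (fun t => M t x) w e) p =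
    ∑ i, ∑ j, ∑ q, y i * w j * e q *
      (pd j (M (i, p, q)) x + ∑ r, M (i, p, r) x * M (j, r, q) x) := by
  simp only [ofCoeffs_apply]
  rw [← Finset.sum_add_distrib]
  refine Finset.sum_congr rfl fun i _ => ?_
  simp only [fderiv_apply_eq_sum, mul_add, Finset.sum_add_distrib]
  congr 1
  · rw [Finset.sum_comm, Finset.mul_sum]
    refine Finset.sum_congr rfl fun q _ => ?_
    rw [Finset.sum_mul, Finset.mul_sum]
    exact Finset.sum_congr rfl fun j _ => by ring
  · simp only [Finset.mul_sum]
    rw [Finset.sum_comm]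
    refine Finset.sum_congr rfl fun j _ => ?_
    rw [Finset.sum_comm]
    exact Finset.sum_congr rfl fun q _ => Finset.sum_congr rfl fun r _ => by ring

/-- The Frobenius theorem for linear systems, in coordinates. -/
theorem exists_linear_total_solution_coord {M : Fin n → ι → ι → EuclideanSpace ℝ (Fin n) → ℝ}
    {U : Set (EuclideanSpace ℝ (Fin n))} (hU : IsOpen U)
    (hM : ∀ x ∈ U, ∀ i p q, ContDiffAt ℝ ∞ (M i p q) x)
    (hint : ∀ x ∈ U, ∀ i j p q, pd j (M i p q) x + ∑ r, M i p r x * M j r q x =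
      pd i (M j p q) x + ∑ r, M j p r x * M i r q x)
    {x₀ : EuclideanSpace ℝ (Fin n)} (hx₀ : x₀ ∈ U) (e₀ : ι → ℝ) :
    ∃ u : EuclideanSpace ℝ (Fin n) → ι → ℝ, u x₀ = e₀ ∧ ∀ᶠ x in 𝓝 x₀,
      ∀ p, ContDiffAt ℝ ∞ (fun x => u x p) x ∧ ∀ i, pd i (fun x => u x p) x = ∑ q, M i p q x * u x q := by
  set N : Fin n × ι × ι → EuclideanSpace ℝ (Fin n) → ℝ := fun t => M t.1 t.2.1 t.2.2 with hN
  have hA : ContDiffOn ℝ ∞ (fun x => ofCoeffs fun t => N t x) U := fun x hx =>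
    (contDiffAt_ofCoeffs fun t => hM x hx _ _ _).contDiffWithinAt
  have hI : ∀ x ∈ U, ∀ (y w : EuclideanSpace ℝ (Fin n)) (e : ι → ℝ),
      fderiv ℝ (fun x => ofCoeffs fun t => N t x) x w y e +
        ofCoeffs (fun t => N t x) y (ofCoeffs (fun t => N t x) w e) =
      fderiv ℝ (fun x => ofCoeffs fun t => N t x) x y w e +
        ofCoeffs (fun t => N t x) w (ofCoeffs (fun t => N t x) y e) := by
    intro x hx y w e
    have hd : ∀ t, DifferentiableAt ℝ (N t) x := fun t => (hM x hx _ _ _).diff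
    rw [fderiv_ofCoeffs hd, fderiv_ofCoeffs hd]
    funext p
    rw [Pi.add_apply, Pi.add_apply, ofCoeffs_add_ofCoeffs, ofCoeffs_add_ofCoeffs, Finset.sum_comm]
    refine Finset.sum_congr rfl fun i _ => Finset.sum_congr rfl fun j _ =>
      Finset.sum_congr rfl fun q _ => ?_
    have := hint x hx i j p q
    simp only [hN]
    rw [this]
    ring
  obtain ⟨u, h0, hu⟩ := exists_linear_total_solution hU hA hI hx₀ e₀
  refine ⟨u, h0, hu.mono fun x hx p => ?_⟩
  refine ⟨contDiffAt_pi.1 hx.1 p, fun i => ?_⟩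
  have h1 : fderiv ℝ (fun x => u x p) x = (ContinuousLinearMap.proj p).comp (fderiv ℝ u x) :=
    ((hasFDerivAt_pi'.1 hx.1.diff.hasFDerivAt) p).fderiv
  rw [pd, h1, ContinuousLinearMap.comp_apply, hx.2, ContinuousLinearMap.proj_apply, ofCoeffs_apply]
  simp [hN]

end TotalSystem

/-! ### Metrics with the curvature of a product of spaces of opposite constant curvatures -/

/-- The conditions under which the prolonged system `prolong` is integrable; they hold for a product
of two metrics with constant curvatures of opposite sign. -/
structure IsSplitAt {n : ℕ} (κ : Fin n → ℝ) (G : EuclideanSpace ℝ (Fin n) → Matrix (Fin n) (Fin n) ℝ)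
    (x : EuclideanSpace ℝ (Fin n)) : Prop where
  metric : IsMetricAt G x
  apply_eq : ∀ i j, κ i * G x i j = κ j * G x i j
  christoffel_eq : ∀ i j k, κ i * christoffel G i j k x = κ j * christoffel G i j k x
  curvOp_eq : ∀ i j k l, curvOp G i j k l x = (κ i + κ j) * ((if j = l then 1 else 0) * G x i k -
    (if i = l then 1 else 0) * G x j k)

/-- The coefficients of the system `∂ᵢ w = gᵢⱼ wʲ`, `∂ᵢ wᵏ = -Γᵢₗᵏ wˡ - (κᵢ w + σ) δᵢᵏ`,
`∂ᵢ σ = κᵢ gᵢⱼ wʲ` for the unknowns `w`, `σ` and `wᵏ`. -/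
def prolong {n : ℕ} (κ : Fin n → ℝ) (G : EuclideanSpace ℝ (Fin n) → Matrix (Fin n) (Fin n) ℝ)
    (i : Fin n) : Option (Option (Fin n)) → Option (Option (Fin n)) → EuclideanSpace ℝ (Fin n) → ℝ
  | none, some (some j) => fun x => G x i j
  | some none, some (some j) => fun x => κ i * G x i j
  | some (some k), none => fun _ => -(κ i * if i = k then 1 else 0)
  | some (some k), some none => fun _ => -(if i = k then 1 else 0)
  | some (some k), some (some l) => fun x => -christoffel G i l k x
  | _, _ => fun _ => 0

section Split

variable {n : ℕ} {κ : Fin n → ℝ} {G : EuclideanSpace ℝ (Fin n) → Matrix (Fin n) (Fin n) ℝ}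
  {x : EuclideanSpace ℝ (Fin n)}

theorem contDiffAt_prolong (h : IsMetricAt G x) (i : Fin n) (p q : Option (Option (Fin n))) :
    ContDiffAt ℝ ∞ (prolong κ G i p q) x := by
  rcases p with _ | _ | k <;> rcases q with _ | _ | l
  all_goals first
    | exact contDiffAt_const
    | exact h.smooth _ _
    | exact contDiffAt_const.mul (h.smooth _ _)
    | exact (h.christoffel_smooth _ _ _).neg

theorem IsMetricAt.pd_metric_sub (h : IsMetricAt G x) (i j l : Fin n) :
    pd j (fun y => G y i l) x - ∑ k, G x i k * christoffel G j l k x =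
      ∑ k, christoffel G i j k x * G x k l := by
  have h1 : ∑ k, G x i k * christoffel G j l k x = christoffelLower G j l i x := by
    rw [← h.sum_christoffel_mul]
    exact Finset.sum_congr rfl fun k _ => by rw [h.symm_apply i k, mul_comm]
  rw [h1, h.sum_christoffel_mul, h.pd_metric]
  simp only [christoffelLower]
  rw [h.pd_symm l i j, h.pd_symm j i l, h.pd_symm i j l, h.pd_symm l j i]
  ring

/-- In the rows of w and σ, compatibility follows from metricity and vanishing torsion of the
connection, and from κᵢ = κⱼ wherever gᵢⱼ or Γᵢⱼᵏ is nonzero. In the row of wᵏ the coefficient of wˡ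
is the curvature, which is matched by the prescribed value of `curvOp`. -/
theorem IsSplitAt.prolong_integrable (h : IsSplitAt κ G x) (i j : Fin n)
    (p q : Option (Option (Fin n))) :
    pd j (prolong κ G i p q) x + ∑ r, prolong κ G i p r x * prolong κ G j r q x =
      pd i (prolong κ G j p q) x + ∑ r, prolong κ G j p r x * prolong κ G i r q x := by
  have hm := h.metric
  have hneg : ∀ (m a b c : Fin n), pd m (fun x => -christoffel G a b c x) x =
      -pd m (christoffel G a b c) x := by
    intro m a b c
    have := pd_const_mul (hm.christoffel_smooth a b c).diff (-1) m
    simpa using this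
  have hmul : ∀ (m a b : Fin n) (c : ℝ), pd m (fun x => c * G x a b) x = c * pd m (fun x => G x a b) x :=
    fun m a b c => pd_const_mul (hm.smooth a b).diff c m
  have hS : ∀ l, ∑ k, christoffel G i j k x * G x k l = ∑ k, christoffel G j i k x * G x k l :=
    fun l => Finset.sum_congr rfl fun k _ => by rw [hm.christoffel_symm i j k]
  have hsum : ∀ l, pd j (fun y => G y i l) x - ∑ k, G x i k * christoffel G j l k x =
      pd i (fun y => G y j l) x - ∑ k, G x j k * christoffel G i l k x := fun l => by
    rw [hm.pd_metric_sub, hm.pd_metric_sub, hS]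
  have hij := h.apply_eq i j
  have hsym := hm.symm_apply i j
  rcases p with _ | _ | k <;> rcases q with _ | _ | l
  all_goals simp only [Fintype.sum_option, prolong, pd_const, hneg, hmul, mul_zero, zero_mul,
    zero_add, mul_neg, neg_mul, Finset.sum_neg_distrib, neg_neg,
    mul_ite, mul_one, Finset.sum_ite_eq, Finset.mem_univ, if_true, ite_mul, one_mul]
  · rw [hsym] at hij ⊢
    linarith
  · rw [hsym]
  · linarith [hsum l]
  · rw [hsym] at hij ⊢
    ring
  · rw [hsym] at hij ⊢
    linarith
  · have e : ∀ a b, ∑ k, κ a * G x a k * christoffel G b l k x =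
        κ a * ∑ k, G x a k * christoffel G b l k x := fun a b => by
      rw [Finset.mul_sum]; exact Finset.sum_congr rfl fun k _ => by ring
    rw [e, e]
    have h1 : κ i * ∑ k, christoffel G i j k x * G x k l = κ j * ∑ k, christoffel G i j k x * G x k l := by
      simp only [Finset.mul_sum, ← mul_assoc, h.christoffel_eq i j]
    have h2 := hm.pd_metric_sub i j l
    have h3 := hm.pd_metric_sub j i l
    rw [← hS] at h3
    linear_combination h1 + κ i * h2 - κ j * h3
  · have h1 := h.christoffel_eq i j k
    rw [hm.christoffel_symm j i k]
    linear_combination -h1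
  · rw [hm.christoffel_symm j i k]
  · have h1 := h.curvOp_eq i j l k
    rw [curvOp, Finset.sum_sub_distrib] at h1
    have e : ∀ a b, ∑ r, christoffel G a r k x * christoffel G b l r x =
        ∑ r, christoffel G b l r x * christoffel G a r k x :=
      fun a b => Finset.sum_congr rfl fun r _ => mul_comm _ _
    rw [e, e]
    split_ifs at h1 ⊢ <;> linear_combination -h1

/-- The solutions of the system `prolong`. -/
structure IsSol (κ : Fin n → ℝ) (G : EuclideanSpace ℝ (Fin n) → Matrix (Fin n) (Fin n) ℝ)
    (w σ : EuclideanSpace ℝ (Fin n) → ℝ) (v : Fin n → EuclideanSpace ℝ (Fin n) → ℝ)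
    (x : EuclideanSpace ℝ (Fin n)) : Prop where
  smooth : ContDiffAt ℝ ∞ w x
  smooth_pot : ContDiffAt ℝ ∞ σ x
  smooth_vec : ∀ k, ContDiffAt ℝ ∞ (v k) x
  pd_eq : ∀ i, pd i w x = ∑ j, G x i j * v j x
  pd_pot : ∀ i, pd i σ x = κ i * pd i w x
  pd_vec : ∀ i k, pd i (v k) x = -∑ l, christoffel G i l k x * v l x -
    (κ i * w x + σ x) * if i = k then 1 else 0

theorem exists_isSol {U : Set (EuclideanSpace ℝ (Fin n))} (hU : IsOpen U)
    (hG : ∀ x ∈ U, IsSplitAt κ G x) (hx : x ∈ U) (w₀ : ℝ) (v₀ : Fin n → ℝ) :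
    ∃ w σ v, w x = w₀ ∧ σ x = 0 ∧ (∀ k, v k x = v₀ k) ∧ ∀ᶠ y in 𝓝 x, IsSol κ G w σ v y := by
  obtain ⟨u, h0, hu⟩ := exists_linear_total_solution_coord hU (M := prolong κ G)
    (fun y hy i p q => contDiffAt_prolong (hG y hy).metric i p q)
    (fun y hy i j p q => (hG y hy).prolong_integrable i j p q) hx
    (fun p => Option.elim p w₀ fun p => Option.elim p 0 v₀)
  refine ⟨fun y => u y none, fun y => u y (some none), fun k y => u y (some (some k)),
    congrFun h0 none, congrFun h0 (some none), fun k => congrFun h0 (some (some k)), hu.mono fun y hy => ?_⟩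
  have h1 : ∀ i, pd i (fun y => u y none) y = ∑ j, G y i j * u y (some (some j)) := fun i => by
    rw [(hy _).2]
    simp [Fintype.sum_option, prolong]
  refine ⟨(hy _).1, (hy _).1, fun k => (hy _).1, h1, fun i => ?_, fun i k => ?_⟩
  · rw [h1, (hy _).2]
    simp [Fintype.sum_option, prolong, Finset.mul_sum, mul_assoc]
  · rw [(hy _).2]
    simp only [Fintype.sum_option, prolong, neg_mul, Finset.sum_neg_distrib]
    ring

variable {w σ w' σ' : EuclideanSpace ℝ (Fin n) → ℝ} {v v' : Fin n → EuclideanSpace ℝ (Fin n) → ℝ}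

/-- The meaning of the system: the Hessian of w is −(κᵢ w + σ) g, in which the auxiliary unknowns
are the gradient of w and the potential σ with dσ = κ dw. -/
theorem IsSol.pd_pd (h : ∀ᶠ y in 𝓝 x, IsSol κ G w σ v y) (hm : IsMetricAt G x) (i j : Fin n) :
    pd i (pd j w) x = ∑ k, christoffel G i j k x * pd k w x - (κ i * w x + σ x) * G x i j := by
  have h0 := h.self_of_nhds
  have hd : ∀ k, DifferentiableAt ℝ (v k) x := fun k => (h0.smooth_vec k).diff
  have h1 : pd j w =ᶠ[𝓝 x] fun y => ∑ k, G y j k * v k y := h.mono fun y hy => hy.pd_eq j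
  rw [pd_congr h1, pd_sum fun k _ => (hm.smooth j k).diff.fun_mul (hd k)]
  simp only [fun k => pd_mul (hm.smooth j k).diff (hd k) i, h0.pd_vec, h0.pd_eq]
  have h2 : ∑ l, (pd i (fun y => G y j l) x - ∑ k, G x j k * christoffel G i l k x) * v l x =
      ∑ l, (∑ k, christoffel G i j k x * G x k l) * v l x :=
    Finset.sum_congr rfl fun l _ => by
      rw [hm.pd_metric_sub]
      congr 1
      exact Finset.sum_congr rfl fun k _ => by rw [hm.christoffel_symm]
  have h3 : ∑ l, (∑ k, christoffel G i j k x * G x k l) * v l x =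
      ∑ k, christoffel G i j k x * ∑ l, G x k l * v l x := by
    simp only [Finset.sum_mul, Finset.mul_sum]
    rw [Finset.sum_comm]
    exact Finset.sum_congr rfl fun k _ => Finset.sum_congr rfl fun l _ => by ring
  have h4 : ∑ l, (∑ k, G x j k * christoffel G i l k x) * v l x =
      ∑ k, G x j k * ∑ l, christoffel G i l k x * v l x := by
    simp only [Finset.sum_mul, Finset.mul_sum]
    rw [Finset.sum_comm]
    exact Finset.sum_congr rfl fun k _ => Finset.sum_congr rfl fun l _ => by ring
  rw [← h3, ← h2]
  simp only [sub_mul, mul_sub, mul_neg, Finset.sum_add_distrib, Finset.sum_sub_distrib, h4,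
    Finset.sum_neg_distrib]
  simp only [mul_ite, mul_one, mul_zero, Finset.sum_ite_eq, Finset.mem_univ, if_true]
  rw [hm.symm_apply j i]
  ring

/-- The conserved bilinear form of the system. -/
def solPair (w σ : EuclideanSpace ℝ (Fin n) → ℝ) (w' σ' : EuclideanSpace ℝ (Fin n) → ℝ)
    (v' : Fin n → EuclideanSpace ℝ (Fin n) → ℝ) (x : EuclideanSpace ℝ (Fin n)) : ℝ :=
  ∑ k, pd k w x * v' k x + σ x * w' x + σ' x * w x

theorem IsSol.differentiableAt_solPair (h : IsSol κ G w σ v x) (h' : IsSol κ G w' σ' v' x) :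
    DifferentiableAt ℝ (solPair w σ w' σ' v') x :=
  ((DifferentiableAt.fun_sum fun k _ => (contDiffAt_pd h.smooth k).diff.fun_mul
    (h'.smooth_vec k).diff).fun_add (h.smooth_pot.diff.fun_mul h'.smooth.diff)).fun_add
    (h'.smooth_pot.diff.fun_mul h.smooth.diff)

/-- Differentiating ⟨dw, ∇w'⟩ gives −(κᵢ w + σ) ∂ᵢw' − (κᵢ w' + σ') ∂ᵢw, the Christoffel terms
cancelling. The derivative of σ w' + σ' w is exactly the opposite. -/
theorem IsSol.pd_solPair (h : ∀ᶠ y in 𝓝 x, IsSol κ G w σ v y)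
    (h' : IsSol κ G w' σ' v' x) (hm : IsMetricAt G x) (i : Fin n) :
    pd i (solPair w σ w' σ' v') x = 0 := by
  have h0 := h.self_of_nhds
  have d1 : ∀ k, DifferentiableAt ℝ (fun y => pd k w y * v' k y) x := fun k =>
    (contDiffAt_pd h0.smooth k).diff.fun_mul (h'.smooth_vec k).diff
  have d2 := h0.smooth_pot.diff.fun_mul h'.smooth.diff
  have d3 := h'.smooth_pot.diff.fun_mul h0.smooth.diff
  unfold solPair
  rw [pd_add ((DifferentiableAt.fun_sum fun k _ => d1 k).fun_add d2) d3,
    pd_add (DifferentiableAt.fun_sum fun k _ => d1 k) d2, pd_sum fun k _ => d1 k,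
    pd_mul h0.smooth_pot.diff h'.smooth.diff, pd_mul h'.smooth_pot.diff h0.smooth.diff,
    h0.pd_pot, h'.pd_pot]
  simp only [fun k => pd_mul (contDiffAt_pd h0.smooth k).diff (h'.smooth_vec k).diff i,
    IsSol.pd_pd h hm, h'.pd_vec, sub_mul, mul_sub, mul_neg, Finset.sum_add_distrib,
    Finset.sum_sub_distrib, Finset.sum_neg_distrib]
  simp only [mul_ite, mul_one, mul_zero, Finset.sum_ite_eq, Finset.mem_univ, if_true]
  have h1 : ∑ k, (∑ m, christoffel G i k m x * pd m w x) * v' k x =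
      ∑ k, pd k w x * ∑ l, christoffel G i l k x * v' l x := by
    simp only [Finset.sum_mul, Finset.mul_sum]
    rw [Finset.sum_comm]
    exact Finset.sum_congr rfl fun k _ => Finset.sum_congr rfl fun l _ => by ring
  have h2 : ∑ k, (κ i * w x + σ x) * G x i k * v' k x = (κ i * w x + σ x) * pd i w' x := by
    rw [h'.pd_eq, Finset.mul_sum]
    exact Finset.sum_congr rfl fun k _ => by ring
  rw [h1, h2]
  ring

theorem eventually_eq_of_pd_eq_zero {f : EuclideanSpace ℝ (Fin n) → ℝ}
    (h : ∀ᶠ y in 𝓝 x, DifferentiableAt ℝ f y ∧ ∀ i, pd i f y = 0) : ∀ᶠ y in 𝓝 x, f y = f x := by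
  obtain ⟨r, hr, hb⟩ := Metric.eventually_nhds_iff_ball.1 h
  filter_upwards [Metric.ball_mem_nhds x hr] with y hy
  refine (convex_ball x r).is_const_of_fderivWithin_eq_zero (𝕜 := ℝ)
    (fun z hz => (hb z hz).1.differentiableWithinAt) (fun z hz => ?_) hy (Metric.mem_ball_self hr)
  rw [fderivWithin_of_isOpen Metric.isOpen_ball hz]
  ext e
  rw [fderiv_apply_eq_sum]
  simp [(hb z hz).2]

theorem IsSol.solPair_eq (hG : ∀ᶠ y in 𝓝 x, IsMetricAt G y) (h : ∀ᶠ y in 𝓝 x, IsSol κ G w σ v y)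
    (h' : ∀ᶠ y in 𝓝 x, IsSol κ G w' σ' v' y) :
    ∀ᶠ y in 𝓝 x, solPair w σ w' σ' v' y = solPair w σ w' σ' v' x :=
  eventually_eq_of_pd_eq_zero (by
    filter_upwards [hG, h.eventually_nhds, h'] with y h1 h2 h3
    exact ⟨h2.self_of_nhds.differentiableAt_solPair h3, IsSol.pd_solPair h2 h3 h1⟩)

/-! ### Conformal changes -/

theorem IsMetricAt.smul (h : IsMetricAt G x) {c : EuclideanSpace ℝ (Fin n) → ℝ}
    (hc : ContDiffAt ℝ ∞ c x) (hc0 : c x ≠ 0) : IsMetricAt (fun y => c y • G y) x where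
  smooth i j := hc.mul (h.smooth i j)
  symm := h.symm.mono fun y hy => hy.smul _
  nondeg := by
    rw [Matrix.det_smul]
    exact mul_ne_zero (pow_ne_zero _ hc0) h.nondeg

theorem IsMetricAt.christoffel_smul (h : IsMetricAt G x) {c : EuclideanSpace ℝ (Fin n) → ℝ}
    (hc : DifferentiableAt ℝ c x) (hc0 : c x ≠ 0) (i j k : Fin n) :
    christoffel (fun y => c y • G y) i j k x = christoffel G i j k x +
      (1 / (2 * c x)) * (pd i c x * (if j = k then 1 else 0) + pd j c x * (if i = k then 1 else 0) -
        G x i j * ∑ l, (G x)⁻¹ k l * pd l c x) := by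
  have hu : IsUnit (G x).det := isUnit_iff_ne_zero.2 h.nondeg
  have h1 : (c x • G x)⁻¹ = (c x)⁻¹ • (G x)⁻¹ := by
    refine Matrix.inv_eq_left_inv ?_
    rw [Matrix.smul_mul, Matrix.mul_smul, smul_smul, inv_mul_cancel₀ hc0,
      Matrix.nonsing_inv_mul _ hu, one_smul]
  have h2 : ∀ l, christoffelLower (fun y => c y • G y) i j l x = c x * christoffelLower G i j l x +
      1 / 2 * (pd i c x * G x j l + pd j c x * G x i l - pd l c x * G x i j) := by
    intro l
    simp only [christoffelLower, Matrix.smul_apply, smul_eq_mul]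
    rw [pd_mul hc (h.smooth j l).diff, pd_mul hc (h.smooth i l).diff, pd_mul hc (h.smooth i j).diff]
    ring
  have h3 : ∀ j, ∑ l, (G x)⁻¹ k l * G x j l = if j = k then 1 else 0 := by
    intro j
    have := h.sum_mul_inv j k
    rw [← this]
    exact Finset.sum_congr rfl fun l _ => by rw [h.inv_symm, mul_comm]
  rw [christoffel_eq, christoffel_eq, h1, ← h3 j, ← h3 i]
  simp only [h2, Matrix.smul_apply, smul_eq_mul, Finset.mul_sum, ← Finset.sum_add_distrib,
    ← Finset.sum_sub_distrib]
  refine Finset.sum_congr rfl fun l _ => ?_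
  field_simp

/-- A metric with `n` independent functions of vanishing Hessian is flat. -/
theorem curvOp_eq_zero_of_pd_pd (hm : IsMetricAt G x) {X : Fin n → EuclideanSpace ℝ (Fin n) → ℝ}
    (hX : ∀ a, ContDiffAt ℝ ∞ (X a) x)
    (h : ∀ᶠ y in 𝓝 x, ∀ a i j, pd i (pd j (X a)) y = ∑ k, christoffel G i j k y * pd k (X a) y)
    (hdet : (Matrix.of fun a k => pd k (X a) x).det ≠ 0) (i j k l : Fin n) :
    curvOp G i j k l x = 0 := by
  have h1 : ∀ a i j m, pd m (pd i (pd j (X a))) x =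
      ∑ l, (pd m (christoffel G i j l) x + ∑ k, christoffel G i j k x * christoffel G m k l x) *
        pd l (X a) x := by
    intro a i j m
    have hd : ∀ k, DifferentiableAt ℝ (pd k (X a)) x := fun k => (contDiffAt_pd (hX a) k).diff
    have he : pd i (pd j (X a)) =ᶠ[𝓝 x] fun y => ∑ k, christoffel G i j k y * pd k (X a) y :=
      h.mono fun y hy => hy a i j
    rw [pd_congr he, pd_sum fun k _ => (hm.christoffel_smooth i j k).diff.fun_mul (hd k)]
    simp only [fun k => pd_mul (hm.christoffel_smooth i j k).diff (hd k) m,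
      fun k => h.self_of_nhds a m k, add_mul, Finset.sum_add_distrib, Finset.sum_mul, Finset.mul_sum]
    congr 1
    rw [Finset.sum_comm]
    exact Finset.sum_congr rfl fun k _ => Finset.sum_congr rfl fun l _ => by ring
  have h2 : (Matrix.of fun a k => pd k (X a) x).mulVec (fun l => curvOp G i j k l x) = 0 := by
    funext a
    -- The third derivatives of X_a commute, so the curvature annihilates each dX_a; independence of
    -- the n differentials then forces it to vanish.
    have h3 := pd_comm (contDiffAt_pd (hX a) k) j i
    rw [h1, h1, ← sub_eq_zero, ← Finset.sum_sub_distrib] at h3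
    rw [Pi.zero_apply, ← h3]
    change ∑ l, pd l (X a) x * curvOp G i j k l x = _
    refine Finset.sum_congr rfl fun l _ => ?_
    rw [curvOp, Finset.sum_sub_distrib]
    ring
  exact congrFun (Matrix.eq_zero_of_mulVec_eq_zero hdet h2) l

/-- The quotient of two null solutions has vanishing Hessian for a conformal metric. -/
theorem IsSol.pd_pd_div (hm : IsMetricAt G x) (h : ∀ᶠ y in 𝓝 x, IsSol κ G w σ v y)
    (h' : ∀ᶠ y in 𝓝 x, IsSol κ G w' σ' v' y) (hw : w' x ≠ 0)
    (h1 : solPair w σ w' σ' v' x = 0) (h2 : solPair w' σ' w' σ' v' x = 0) (i j : Fin n) :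
    pd i (pd j fun y => w y / w' y) x = ∑ k, christoffel (fun y => (w' y ^ 2)⁻¹ • G y) i j k x *
      pd k (fun y => w y / w' y) x := by
  set X : EuclideanSpace ℝ (Fin n) → ℝ := fun y => w y / w' y with hX
  have hw' : ∀ᶠ y in 𝓝 x, w' y ≠ 0 := h'.self_of_nhds.smooth.continuousAt.eventually_ne hw
  have hXs : ∀ᶠ y in 𝓝 x, ContDiffAt ℝ ∞ X y := by
    filter_upwards [h, h', hw'] with y a b c
    exact a.smooth.div b.smooth c
  have hXx := hXs.self_of_nhds
  have hws := h'.self_of_nhds.smooth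
  have e1 : ∀ k, pd k w =ᶠ[𝓝 x] fun y => pd k X y * w' y + X y * pd k w' y := by
    intro k
    filter_upwards [h', hw'.eventually_nhds, hXs] with y b c d
    rw [← pd_mul d.diff b.smooth.diff]
    exact pd_congr (c.mono fun z hz => (div_mul_cancel₀ _ hz).symm) k
  have e2 : ∀ k, pd k w x = pd k X x * w' x + X x * pd k w' x := fun k => (e1 k).self_of_nhds
  have e3 := IsSol.pd_pd h hm i j
  have dX : ∀ k, DifferentiableAt ℝ (pd k X) x := fun k => (contDiffAt_pd hXx k).diff
  have dw : ∀ k, DifferentiableAt ℝ (pd k w') x := fun k => (contDiffAt_pd hws k).diff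
  rw [pd_congr (e1 j), pd_add ((dX j).fun_mul hws.diff) (hXx.diff.fun_mul (dw j)),
    pd_mul (dX j) hws.diff, pd_mul hXx.diff (dw j), IsSol.pd_pd h' hm] at e3
  have e4 : ∀ l, pd l (fun y => (w' y ^ 2)⁻¹) x = -2 * pd l w' x / w' x ^ 3 := by
    intro l
    have d : HasFDerivAt (fun y => (w' y ^ 2)⁻¹) _ x :=
      HasDerivAt.comp_hasFDerivAt (h₂ := fun t : ℝ => (t ^ 2)⁻¹) x
        ((hasDerivAt_pow 2 (w' x)).fun_inv (pow_ne_zero 2 hw)) hws.diff.hasFDerivAt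
    rw [pd, d.fderiv]
    simp only [pd, smul_apply, smul_eq_mul, Nat.cast_ofNat, Nat.add_one_sub_one, pow_one]
    field_simp
  have hc : DifferentiableAt ℝ (fun y => (w' y ^ 2)⁻¹) x :=
    ((hws.pow 2).inv (pow_ne_zero 2 hw)).diff
  have e5 : ∀ k, ∑ l, (G x)⁻¹ k l * pd l w' x = v' k x := by
    intro k
    have := h'.self_of_nhds.pd_eq
    simp only [this, Finset.mul_sum, ← mul_assoc]
    rw [Finset.sum_comm]
    simp only [← Finset.sum_mul, hm.sum_inv_mul, ite_mul, one_mul, zero_mul, Finset.sum_ite_eq,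
      Finset.mem_univ, if_true]
  have e6 : ∀ k, christoffel (fun y => (w' y ^ 2)⁻¹ • G y) i j k x = christoffel G i j k x -
      1 / w' x * (pd i w' x * (if j = k then 1 else 0) + pd j w' x * (if i = k then 1 else 0) -
        G x i j * v' k x) := by
    intro k
    rw [hm.christoffel_smul hc (inv_ne_zero (pow_ne_zero 2 hw)), ← e5 k]
    have e7 : ∑ l, (G x)⁻¹ k l * pd l (fun y => (w' y ^ 2)⁻¹) x =
        -2 / w' x ^ 3 * ∑ l, (G x)⁻¹ k l * pd l w' x := by
      rw [Finset.mul_sum]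
      exact Finset.sum_congr rfl fun l _ => by rw [e4]; ring
    rw [e7, e4, e4]
    field_simp
    ring
  have e8 : ∑ k, christoffel (fun y => (w' y ^ 2)⁻¹ • G y) i j k x * pd k X x =
      ∑ k, christoffel G i j k x * pd k X x - 1 / w' x * (pd i w' x * pd j X x + pd j w' x * pd i X x -
        G x i j * ∑ k, pd k X x * v' k x) := by
    simp only [e6, sub_mul, mul_sub, mul_add, add_mul, Finset.sum_sub_distrib, Finset.sum_add_distrib]
    simp only [mul_ite, ite_mul, mul_one, mul_zero, zero_mul, Finset.sum_ite_eq, Finset.mem_univ,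
      if_true]
    have : ∑ k, 1 / w' x * (G x i j * v' k x) * pd k X x =
        1 / w' x * (G x i j * ∑ k, pd k X x * v' k x) := by
      simp only [Finset.mul_sum]
      exact Finset.sum_congr rfl fun k _ => by ring
    rw [this]
    ring
  have e9 : ∑ k, christoffel G i j k x * pd k w x =
      w' x * ∑ k, christoffel G i j k x * pd k X x + X x * ∑ k, christoffel G i j k x * pd k w' x := by
    simp only [e2, Finset.mul_sum, ← Finset.sum_add_distrib]
    exact Finset.sum_congr rfl fun k _ => by ring
  have e10 : ∑ k, pd k w x * v' k x =
      w' x * ∑ k, pd k X x * v' k x + X x * ∑ k, pd k w' x * v' k x := by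
    simp only [e2, Finset.mul_sum, ← Finset.sum_add_distrib]
    exact Finset.sum_congr rfl fun k _ => by ring
  rw [solPair, e10] at h1
  rw [solPair] at h2
  have hXw : w x = X x * w' x := (div_mul_cancel₀ _ hw).symm
  rw [e9, hXw] at e3
  rw [hXw] at h1
  -- Substituting w = X w' in the pairing of w with w' and subtracting X times the self-pairing of
  -- w' determines ⟨dX, ∇w'⟩. Its value is what cancels the multiple of g left in the Hessian of X.
  have e11 : ∑ k, pd k X x * v' k x = -σ x + X x * σ' x := by
    refine mul_left_cancel₀ hw ?_
    linear_combination h1 - X x * h2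
  rw [e8, e11]
  refine mul_left_cancel₀ hw ?_
  field_simp
  linear_combination e3

/-- A product of metrics with constant curvatures of opposite sign is conformally flat. -/
theorem exists_conformal_factor {U : Set (EuclideanSpace ℝ (Fin n))} (hU : IsOpen U)
    (hG : ∀ x ∈ U, IsSplitAt κ G x) (hx : x ∈ U) : ∃ w : EuclideanSpace ℝ (Fin n) → ℝ,
      ∀ᶠ y in 𝓝 x, ContDiffAt ℝ ∞ w y ∧ 0 < w y ∧
        ∀ i j k l, curvOp (fun y => (w y ^ 2)⁻¹ • G y) i j k l y = 0 := by
  have hm : ∀ᶠ y in 𝓝 x, IsMetricAt G y := (hU.eventually_mem hx).mono fun y hy => (hG y hy).metric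
  -- Initial data 1 with zero gradient and σ' = 0 give a solution that is null for the pairing. The
  -- n solutions with value 0 and gradient e_a are orthogonal to it. Conservation extends both facts
  -- to a neighbourhood.
  obtain ⟨w', σ', v', i1, i2, i3, hs'⟩ := exists_isSol hU hG hx 1 0
  have := fun a : Fin n => exists_isSol hU hG hx 0 (Pi.single a 1)
  choose w σ v j1 j2 j3 hs using this
  have p' : ∀ k, pd k w' x = 0 := fun k => by rw [hs'.self_of_nhds.pd_eq]; simp [i3]
  have p : ∀ a k, pd k (w a) x = G x k a := fun a k => by
    rw [(hs a).self_of_nhds.pd_eq]; simp [j3, Pi.single_apply]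
  have q' : ∀ᶠ y in 𝓝 x, solPair w' σ' w' σ' v' y = 0 := by
    have h1 : solPair w' σ' w' σ' v' x = 0 := by simp [solPair, p', i2]
    rw [← h1]
    exact IsSol.solPair_eq hm hs' hs'
  have q : ∀ᶠ y in 𝓝 x, ∀ a, solPair (w a) (σ a) w' σ' v' y = 0 := by
    refine eventually_all.2 fun a => ?_
    have h1 : solPair (w a) (σ a) w' σ' v' x = 0 := by simp [solPair, i3, i2, j2]
    rw [← h1]
    exact IsSol.solPair_eq hm (hs a) hs'
  have hpos : ∀ᶠ y in 𝓝 x, 0 < w' y :=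
    hs'.self_of_nhds.smooth.continuousAt.eventually (lt_mem_nhds (by rw [i1]; exact one_pos))
  have hsa : ∀ᶠ y in 𝓝 x, ∀ a, IsSol κ G (w a) (σ a) (v a) y := eventually_all.2 hs
  have hX : ∀ᶠ y in 𝓝 x, ∀ a, ContDiffAt ℝ ∞ (fun y => w a y / w' y) y := by
    filter_upwards [hsa, hs', hpos] with y h1 h2 h3 a
    exact (h1 a).smooth.div h2.smooth h3.ne'
  have hdet : ∀ᶠ y in 𝓝 x, (Matrix.of fun a k => pd k (fun y => w a y / w' y) y).det ≠ 0 := by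
    refine ContinuousAt.eventually_ne (contDiffAt_det fun a k =>
      contDiffAt_pd (hX.self_of_nhds a) k).continuousAt ?_
    -- At x one has w' = 1 and dw' = 0, so dX_a is dw_a, the vector e_a with its index lowered; the
    -- matrix of these differentials is nondegenerate because the metric is.
    have h1 : (Matrix.of fun a k => pd k (fun y => w a y / w' y) x) = (G x).transpose := by
      ext a k
      have h2 : pd k (w a) x = pd k (fun y => w a y / w' y) x * w' x + w a x / w' x * pd k w' x := by
        rw [← pd_mul (hX.self_of_nhds a).diff hs'.self_of_nhds.smooth.diff]
        exact pd_congr (hpos.mono fun z hz => (div_mul_cancel₀ _ hz.ne').symm) k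
      rw [p, p', i1, mul_one, mul_zero, add_zero] at h2
      rw [Matrix.of_apply, Matrix.transpose_apply, h2]
    rw [h1, Matrix.det_transpose]
    exact hm.self_of_nhds.nondeg
  refine ⟨w', ?_⟩
  filter_upwards [hm.eventually_nhds, hs'.eventually_nhds, hpos.eventually_nhds, q'.eventually_nhds,
    q.eventually_nhds, hsa.eventually_nhds, hX, hdet] with y k1 k2 k3 k4 k5 k6 k7 k8
  refine ⟨k2.self_of_nhds.smooth, k3.self_of_nhds, curvOp_eq_zero_of_pd_pd
    (X := fun a y => w a y / w' y) (k1.self_of_nhds.smul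
    ((k2.self_of_nhds.smooth.pow 2).inv (pow_ne_zero 2 k3.self_of_nhds.ne'))
    (inv_ne_zero (pow_ne_zero 2 k3.self_of_nhds.ne'))) k7 ?_ k8⟩
  filter_upwards [k1, k2.eventually_nhds, k3, k4, k5, k6.eventually_nhds] with z l1 l2 l3 l4 l5 l6 a i j
  exact IsSol.pd_pd_div l1 (l6.mono fun _ h => h a) l2 l3.ne' (l5 a) l4 i j

end Split

/-! ### Warped products with fibre of constant curvature are conformally flat -/

/-- The fibre has sectional curvature κ/2 and mixed planes have curvature 0. The values −κ/4 on the
line and κ/4 on the fibre are the ones whose pairwise sums are 0 and κ/2. -/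
theorem isSplitAt_block {a : ℝ → ℝ} {h : EuclideanSpace ℝ (Fin 3) → Matrix (Fin 3) (Fin 3) ℝ} {κ : ℝ}
    {z : EuclideanSpace ℝ (Fin 4)} (H : ∀ᶠ w in 𝓝 z, IsBlockAt (n := 3) a (fun _ => 1) h w)
    (hm : ∀ᶠ y in 𝓝 (tail z), IsMetricAt h y) (hρ : ∀ i j, ricci h i j (tail z) = κ * h (tail z) i j) :
    IsSplitAt (Fin.cons (-(κ / 4)) fun _ => κ / 4) (block (n := 3) a (fun _ => 1) h) z := by
  have H0 := H.self_of_nhds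
  refine ⟨H0.isMetricAt, fun i j => ?_, fun i j k => ?_, fun i j k l => ?_⟩
  · refine Fin.cases ?_ (fun i => ?_) i <;> refine Fin.cases ?_ (fun j => ?_) j <;> simp
  · refine Fin.cases ?_ (fun i => ?_) i <;> refine Fin.cases ?_ (fun j => ?_) j <;>
      refine Fin.cases ?_ (fun k => ?_) k <;>
      simp [H0.christoffel_0i0, H0.christoffel_i00, H0.christoffel_0ij, H0.christoffel_i0j]
  · rw [IsBlockAt.curvOp_product H]
    refine Fin.cases ?_ (fun i => ?_) i <;> refine Fin.cases ?_ (fun j => ?_) j <;>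
      refine Fin.cases ?_ (fun k => ?_) k <;> refine Fin.cases ?_ (fun l => ?_) l <;>
      simp [Fin.succ_ne_zero, (Fin.succ_ne_zero _).symm, curvOp_of_ricci hm hρ]
    ring_nf
    simp

/-- Dividing g by φ² leaves the product (ε/φ²) dt² + h, which is flattened by a further factor w⁻².
Both together are e^(2σ) with σ = −log(φ w). -/
theorem exists_flat_factor {r ε κ : ℝ} {φ : ℝ → ℝ}
    {h : EuclideanSpace ℝ (Fin 3) → Matrix (Fin 3) (Fin 3) ℝ}
    {G : EuclideanSpace ℝ (Fin 4) → Matrix (Fin 4) (Fin 4) ℝ} (hr : 0 < r) (hε : ε ≠ 0)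
    (hφ : ContDiffOn ℝ ∞ φ (Ioo (-r) r)) (hφ0 : ∀ t, 0 < φ t)
    (hG : ∀ z ∈ box r, G z = block (fun _ => ε) (fun t => φ t ^ 2) h z)
    (hh : ∀ y ∈ Metric.ball 0 r, IsMetricAt h y ∧ ∀ i j, ricci h i j y = κ * h y i j) :
    ∃ σ : EuclideanSpace ℝ (Fin 4) → ℝ, ∀ᶠ z in 𝓝 0, ContDiffAt ℝ ∞ σ z ∧
      ∀ i j k l, riemann (fun y => Real.exp (2 * σ y) • G y) i j k l z = 0 := by
  have ho : IsOpen (box (n := 3) r) := isOpen_box r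
  have hφs : ∀ z ∈ box (n := 3) r, ContDiffAt ℝ ∞ φ (z 0) := fun z hz =>
    hφ.contDiffAt (isOpen_Ioo.mem_nhds hz.1)
  have hb : ∀ z ∈ box r, IsBlockAt (n := 3) (fun t => ε / φ t ^ 2) (fun _ => 1) h z := fun z hz =>
    ⟨contDiffAt_const.div ((hφs z hz).pow 2) (pow_ne_zero 2 (hφ0 _).ne'), contDiffAt_const,
      div_ne_zero hε (pow_ne_zero 2 (hφ0 _).ne'), one_ne_zero, (hh _ hz.2).1⟩
  obtain ⟨w, hw⟩ := exists_conformal_factor ho (fun z hz => isSplitAt_block (κ := κ)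
    ((ho.eventually_mem hz).mono hb) ((Metric.isOpen_ball.eventually_mem hz.2).mono fun y hy =>
      (hh y hy).1) (hh _ hz.2).2) (zero_mem_box hr)
  refine ⟨fun z => -Real.log (φ (z 0) * w z), ?_⟩
  filter_upwards [hw.eventually_nhds, ho.eventually_mem (zero_mem_box hr)] with z hwz hz
  obtain ⟨h1, h2, h3⟩ := hwz.self_of_nhds
  have h4 : ContDiffAt ℝ ∞ (fun z : EuclideanSpace ℝ (Fin 4) => φ (z 0)) z :=
    ContDiffAt.comp z (g := φ) (f := fun z : EuclideanSpace ℝ (Fin 4) => z 0) (hφs z hz)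
      (contDiff_coordinate 0).contDiffAt
  refine ⟨((h4.mul h1).log (mul_pos (hφ0 _) h2).ne').neg, fun i j k l => ?_⟩
  have h5 : (fun y => Real.exp (2 * -Real.log (φ (y 0) * w y)) • G y) =ᶠ[𝓝 z]
      fun y => (w y ^ 2)⁻¹ • block (n := 3) (fun t => ε / φ t ^ 2) (fun _ => 1) h y := by
    filter_upwards [hwz, ho.eventually_mem hz] with y hy hy'
    have hp := mul_pos (hφ0 (y 0)) hy.2.1
    have h6 : Real.exp (2 * -Real.log (φ (y 0) * w y)) = ((φ (y 0) * w y) ^ 2)⁻¹ := by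
      rw [show 2 * -Real.log (φ (y 0) * w y) = -((2 : ℕ) * Real.log (φ (y 0) * w y)) by push_cast; ring,
        Real.exp_neg, Real.exp_nat_mul, Real.exp_log hp]
    have hp1 := (hφ0 (y 0)).ne'
    have hp2 := hy.2.1.ne'
    rw [h6, hG y hy']
    ext i j
    refine Fin.cases ?_ (fun i => ?_) i <;> refine Fin.cases ?_ (fun j => ?_) j <;>
      simp only [Matrix.smul_apply, smul_eq_mul, block_zero_zero, block_zero_succ, block_succ_zero,
        block_succ_succ, mul_zero] <;> field_simp
  rw [riemann_congr h5, riemann]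
  simp [h3]

/-! ### From manifolds to coordinates -/

section Congr

variable {G G' : EuclideanSpace ℝ (Fin 4) → Matrix (Fin 4) (Fin 4) ℝ} {x : EuclideanSpace ℝ (Fin 4)}

theorem IsMetricAt.congr (h : IsMetricAt G x) (hG : G =ᶠ[𝓝 x] G') : IsMetricAt G' x where
  smooth i j := (h.smooth i j).congr_of_eventuallyEq (hG.mono fun y hy => by
    change G' y i j = G y i j
    rw [← hy])
  symm := by
    filter_upwards [h.symm, hG] with y h1 h2
    rwa [← h2]
  nondeg := by
    rw [← hG.self_of_nhds]
    exact h.nondeg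

theorem IsQEAt.congr {μ : ℝ} {F L : EuclideanSpace ℝ (Fin 4) → ℝ} (h : IsQEAt μ G F L x)
    (hG : G =ᶠ[𝓝 x] G') : IsQEAt μ G' F L x where
  metric := by
    filter_upwards [h.metric, hG.eventually_nhds] with y h1 h2
    exact h1.congr h2
  smooth := h.smooth
  smooth' := h.smooth'
  eq := by
    filter_upwards [h.eq, hG.eventually_nhds] with y h1 h2 i j
    have h3 : ∀ k, christoffel G' i j k y = christoffel G i j k y :=
      fun k => (christoffel_congr (h2 : G =ᶠ[𝓝 y] G') i j k).self_of_nhds.symm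
    rw [← ricci_congr h2, ← h2.self_of_nhds, ← h1 i j, hessian, hessian]
    simp only [h3]
  gradNormSq_ne := by
    have := h.gradNormSq_ne
    rwa [gradNormSq, hG.self_of_nhds] at this

theorem IsHalfFlatAt.congr {s : ℝ} (h : IsHalfFlatAt s G x) (hG : G =ᶠ[𝓝 x] G') :
    IsHalfFlatAt s G' x := by
  filter_upwards [h, hG.eventually_nhds] with y h1 h2 i j k l
  have h3 : ∀ i j k l, weyl G i j k l y = weyl G' i j k l y := fun i j k l => by
    simp only [weyl, scalar, ricci_congr h2, riemann_congr h2, h2.self_of_nhds]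
  have h4 := h1 i j k l
  simp only [h3, hodge, h2.self_of_nhds] at h4
  exact h4

end Congr

section Coordinates

theorem mdifferentiable_of_mem_maximalAtlas {n : ℕ} {M : Type*} [TopologicalSpace M]
    [ChartedSpace (EuclideanSpace ℝ (Fin n)) M] {e : OpenPartialHomeomorph M (EuclideanSpace ℝ (Fin n))}
    (he : e ∈ IsManifold.maximalAtlas (𝓡 n) ∞ M) :
    e.MDifferentiable (𝓡 n) (𝓡 n) :=
  ⟨(contMDiffOn_of_mem_maximalAtlas he).mdifferentiableOn (by simp),
    (contMDiffOn_symm_of_mem_maximalAtlas he).mdifferentiableOn (by simp)⟩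

variable {n : ℕ} {M : Type*} [TopologicalSpace M] [ChartedSpace (EuclideanSpace ℝ (Fin n)) M]
  [IsManifold (𝓡 n) ∞ M] {e : OpenPartialHomeomorph M (EuclideanSpace ℝ (Fin n))}
  {x : EuclideanSpace ℝ (Fin n)}

/-- The field is the tangent map of the inverse chart applied to a constant section, so it is smooth
as a section of the tangent bundle. -/
theorem contMDiffAt_coordField (he : e ∈ IsManifold.maximalAtlas (𝓡 n) ∞ M) (hx : x ∈ e.target)
    (c : EuclideanSpace ℝ (Fin n)) :
    ContMDiffAt (𝓡 n) ((𝓡 n).prod (𝓡 n)) ∞ (fun y => Bundle.TotalSpace.mk' (EuclideanSpace ℝ (Fin n))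
      (E := fun p : M => TangentSpace (𝓡 n) p) (e.symm y) (mfderiv (𝓡 n) (𝓡 n) e.symm y c)) x := by
  have h1 := (contMDiffOn_symm_of_mem_maximalAtlas he).contMDiffOn_tangentMapWithin (m := ∞)
    (by simp) e.open_target.uniqueMDiffOn
  have h2 : ContMDiffAt (𝓡 n) ((𝓡 n).prod (𝓡 n)) ∞ (fun y : EuclideanSpace ℝ (Fin n) =>
      Bundle.TotalSpace.mk' (EuclideanSpace ℝ (Fin n))
        (E := fun p : EuclideanSpace ℝ (Fin n) => TangentSpace (𝓡 n) p) y c) x := by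
    rw [Bundle.contMDiffAt_totalSpace]
    refine ⟨contMDiffAt_id, ?_⟩
    simpa using contMDiffAt_const
  have h3 : ContMDiffAt (𝓡 n) ((𝓡 n).prod (𝓡 n)) ∞ (fun y => tangentMapWithin (𝓡 n) (𝓡 n) e.symm e.target
      (Bundle.TotalSpace.mk' (EuclideanSpace ℝ (Fin n))
        (E := fun p : EuclideanSpace ℝ (Fin n) => TangentSpace (𝓡 n) p) y c)) x :=
    ContMDiffAt.comp x (h1.contMDiffAt ((e.open_target.preimage
      (FiberBundle.continuous_proj (EuclideanSpace ℝ (Fin n)) _)).mem_nhds hx)) h2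
  refine h3.congr_of_eventuallyEq ?_
  filter_upwards [e.open_target.mem_nhds hx] with y hy
  rw [tangentMapWithin, mfderivWithin_of_isOpen e.open_target hy]

theorem Metric.contDiffAt_coeff (g : Metric n M) (he : e ∈ IsManifold.maximalAtlas (𝓡 n) ∞ M)
    (hx : x ∈ e.target) (i j : Fin n) : ContDiffAt ℝ ∞ (fun y => g.coeff e y i j) x := by
  have h1 : ContMDiffAt (𝓡 n) ((𝓡 n).prod 𝓘(ℝ, ℝ)) ∞ (fun y => Bundle.TotalSpace.mk' ℝ
      (E := Bundle.Trivial M ℝ) (e.symm y) (g.coeff e y i j)) x := by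
    refine ContMDiffAt.clm_bundle_apply₂ (F₁ := EuclideanSpace ℝ (Fin n))
      (F₂ := EuclideanSpace ℝ (Fin n)) ?_ (contMDiffAt_coordField he hx _)
      (contMDiffAt_coordField he hx _)
    exact ContMDiffAt.comp x (g.contMDiff.contMDiffAt) (contMDiffAt_symm_of_mem_maximalAtlas he hx)
  rw [Bundle.contMDiffAt_totalSpace] at h1
  exact h1.2.contDiffAt

theorem Metric.inner_mfderiv_symm (g : Metric n M)
    (e : OpenPartialHomeomorph M (EuclideanSpace ℝ (Fin n))) (x v w : EuclideanSpace ℝ (Fin n)) :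
    g.inner (e.symm x) (mfderiv (𝓡 n) (𝓡 n) e.symm x v) (mfderiv (𝓡 n) (𝓡 n) e.symm x w) =
      ∑ i, ∑ j, v i * w j * g.coeff e x i j := by
  have hv : ∀ v : EuclideanSpace ℝ (Fin n), mfderiv (𝓡 n) (𝓡 n) e.symm x v =
      ∑ i, v i • mfderiv (𝓡 n) (𝓡 n) e.symm x (EuclideanSpace.single i (1 : ℝ)) := by
    intro v
    have h1 : v = ∑ i, v i • EuclideanSpace.single i (1 : ℝ) := by
      ext j
      simp [Finset.sum_apply, Pi.single_apply]
    conv_lhs => rw [h1]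
    exact (map_sum (mfderiv (𝓡 n) (𝓡 n) e.symm x) _ _).trans
      (Finset.sum_congr rfl fun i _ => map_smul _ _ _)
  rw [hv v, hv w]
  simp only [map_sum, map_smul, sum_apply, smul_apply, smul_eq_mul, Finset.mul_sum, mul_assoc]
  rw [Finset.sum_comm]
  exact Finset.sum_congr rfl fun i _ => Finset.sum_congr rfl fun j _ => mul_left_comm _ _ _

theorem Metric.isMetricOn_coeff (g : Metric n M) (he : e ∈ IsManifold.maximalAtlas (𝓡 n) ∞ M) :
    IsMetricOn (g.coeff e) e.target where
  smooth i j x hx := (g.contDiffAt_coeff he hx i j).contDiffWithinAt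
  symm x hx := Matrix.IsSymm.ext fun i j => g.symm _ _ _
  nondeg x hx h0 := by
    obtain ⟨v, hv, hv0⟩ := Matrix.exists_mulVec_eq_zero_iff.2 h0
    have hd := (mdifferentiable_of_mem_maximalAtlas he).symm
    refine hv ?_
    have h1 : mfderiv (𝓡 n) (𝓡 n) e.symm x (WithLp.toLp 2 v) = 0 := by
      refine g.nondeg _ _ fun w => ?_
      obtain ⟨u, rfl⟩ := hd.mfderiv_surjective hx w
      rw [g.symm]
      refine (g.inner_mfderiv_symm e x u (WithLp.toLp 2 v)).trans ?_
      refine Finset.sum_eq_zero fun i _ => ?_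
      have h2 := congrFun hv0 i
      set u' : EuclideanSpace ℝ (Fin n) := u
      simp only [Matrix.mulVec, dotProduct, Pi.zero_apply] at h2
      calc ∑ j, u' i * v j * g.coeff e x i j = u' i * ∑ j, g.coeff e x i j * v j := by
            rw [Finset.mul_sum]
            exact Finset.sum_congr rfl fun j _ => by ring
        _ = 0 := by rw [h2, mul_zero]
    have h2 := hd.mfderiv_injective hx (h1.trans (map_zero (mfderiv (𝓡 n) (𝓡 n) e.symm x)).symm)
    have h3 : WithLp.toLp 2 v = (0 : EuclideanSpace ℝ (Fin n)) := h2
    funext i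
    exact congrArg (fun u : EuclideanSpace ℝ (Fin n) => u i) h3

/-! ### Changes of coordinates -/

variable {ψ : OpenPartialHomeomorph (EuclideanSpace ℝ (Fin n)) (EuclideanSpace ℝ (Fin n))}

theorem trans_symm_mem_maximalAtlas (he : e ∈ IsManifold.maximalAtlas (𝓡 n) ∞ M) (hψ : IsDiffeo ψ) :
    e.trans ψ.symm ∈ IsManifold.maximalAtlas (𝓡 n) ∞ M := by
  refine OpenPartialHomeomorph.mem_maximalAtlas_of_contMDiffOn _ ?_ ?_
  · intro p hp
    have h1 : ContMDiffAt (𝓡 n) (𝓡 n) ∞ ψ.symm (e p) :=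
      (hψ.smooth_symm _ hp.2).contMDiffAt
    exact (h1.comp p (contMDiffAt_of_mem_maximalAtlas he hp.1)).contMDiffWithinAt
  · intro y hy
    have h1 : ContMDiffAt (𝓡 n) (𝓡 n) ∞ ψ y := (hψ.smooth _ hy.1).contMDiffAt
    exact (ContMDiffAt.comp y (contMDiffAt_symm_of_mem_maximalAtlas he hy.2) h1).contMDiffWithinAt

theorem isDiffeo_ofSet {S : Set (EuclideanSpace ℝ (Fin n))} (hS : IsOpen S) :
    IsDiffeo (OpenPartialHomeomorph.ofSet S hS) := by
  refine ⟨fun y _ => contDiffAt_id, fun y _ => contDiffAt_id, fun y _ => ?_⟩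
  have h1 : fderiv ℝ (OpenPartialHomeomorph.ofSet S hS) y = ContinuousLinearMap.id ℝ _ := fderiv_id
  rw [← det_fderiv (φ := OpenPartialHomeomorph.ofSet S hS) differentiableAt_id, h1]
  have h2 : (ContinuousLinearMap.id ℝ (EuclideanSpace ℝ (Fin n))).det = 1 := LinearMap.det_id
  rw [h2]
  exact one_ne_zero

theorem target_trans_symm {X : Type*} [TopologicalSpace X]
    {e : OpenPartialHomeomorph X (EuclideanSpace ℝ (Fin n))} (hψ : ψ.target ⊆ e.target) : (e.trans ψ.symm).target = ψ.source := by
  ext y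
  refine ⟨fun h => h.1, fun h => ⟨h, hψ (ψ.map_source h)⟩⟩

theorem Metric.coeff_trans_symm (g : Metric n M) (he : e ∈ IsManifold.maximalAtlas (𝓡 n) ∞ M)
    (hψ : IsDiffeo ψ) (hV : ψ.target ⊆ e.target) {y : EuclideanSpace ℝ (Fin n)} (hy : y ∈ ψ.source) :
    g.coeff (e.trans ψ.symm) y = pullback ψ (g.coeff e) y := by
  have hs := (hψ.smooth y hy).diff
  have h1 : ∀ i, mfderiv (𝓡 n) (𝓡 n) (e.trans ψ.symm).symm y (EuclideanSpace.single i (1 : ℝ)) =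
      mfderiv (𝓡 n) (𝓡 n) e.symm (ψ y) (fderiv ℝ ψ y (EuclideanSpace.single i (1 : ℝ))) := by
    intro i
    have h2 := mfderiv_comp y ((contMDiffAt_symm_of_mem_maximalAtlas he
      (hV (ψ.map_source hy))).mdifferentiableAt (by simp)) hs.mdifferentiableAt
    rw [mfderiv_eq_fderiv] at h2
    exact congrArg (fun T => T (EuclideanSpace.single i (1 : ℝ))) h2
  ext i j
  rw [pullback_apply]
  change g.inner (e.symm (ψ y)) _ _ = _
  rw [h1 i, h1 j]
  refine (g.inner_mfderiv_symm e (ψ y) _ _).trans ?_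
  simp only [jac_apply_eq_fderiv hs]

theorem IsPositiveChart.trans_symm {A : Set (OpenPartialHomeomorph M (EuclideanSpace ℝ (Fin n)))}
    (hA : IsOrientedAtlas A) (he : IsPositiveChart A e) (hψ : IsDiffeo ψ)
    (hpos : ∀ y ∈ ψ.source, 0 < (jac ψ y).det) : IsPositiveChart A (e.trans ψ.symm) := by
  refine ⟨trans_symm_mem_maximalAtlas he.1 hψ, fun e' he' y hy => ?_⟩
  have hy1 : y ∈ ψ.source := hy.1.1
  have hy2 : ψ y ∈ e.target := hy.1.2
  have hy3 : e.symm (ψ y) ∈ e'.source := hy.2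
  have h1 : ContMDiffAt (𝓡 n) (𝓡 n) ∞ (e.symm.trans e') (ψ y) :=
    ContMDiffAt.comp (ψ y) (g := e') (f := e.symm) (contMDiffAt_of_mem_maximalAtlas (hA.subset he') hy3)
      (contMDiffAt_symm_of_mem_maximalAtlas he.1 hy2)
  have hs := (hψ.smooth y hy1).diff
  have h2 := fderiv_comp y h1.contDiffAt.diff hs
  have h3 : fderiv ℝ ((e.trans ψ.symm).symm.trans e') y =
    (fderiv ℝ (e.symm.trans e') (ψ y)).comp (fderiv ℝ ψ y) := h2
  have h4 : ((fderiv ℝ (e.symm.trans e') (ψ y)).comp (fderiv ℝ ψ y)).det =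
    (fderiv ℝ (e.symm.trans e') (ψ y)).det * (fderiv ℝ ψ y).det := LinearMap.det_comp _ _
  rw [h3, h4, det_fderiv hs]
  exact mul_pos (he.2 e' he' (ψ y) ⟨hy2, hy3⟩) (hpos y hy1)

end Coordinates

section Four

variable {M : Type*} [TopologicalSpace M] [ChartedSpace (EuclideanSpace ℝ (Fin 4)) M]
  [IsManifold (𝓡 4) ∞ M] {e : OpenPartialHomeomorph M (EuclideanSpace ℝ (Fin 4))}
  {g : Metric 4 M} {f lam : M → ℝ} {μ s : ℝ}
  {A : Set (OpenPartialHomeomorph M (EuclideanSpace ℝ (Fin 4)))}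

theorem isQEAt_coeff (hf : ContMDiff (𝓡 4) 𝓘(ℝ, ℝ) ∞ f) (hlam : ContMDiff (𝓡 4) 𝓘(ℝ, ℝ) ∞ lam)
    (hqe : ∀ e ∈ IsManifold.maximalAtlas (𝓡 4) ∞ M, ∀ x ∈ e.target, ∀ i j,
      hessian (g.coeff e) (f ∘ e.symm) i j x + ricci (g.coeff e) i j x
        - μ * (pd i (f ∘ e.symm) x * pd j (f ∘ e.symm) x) = lam (e.symm x) * g.coeff e x i j)
    (hgrad : g.IsNonIsotropic f) (he : e ∈ IsManifold.maximalAtlas (𝓡 4) ∞ M)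
    {x : EuclideanSpace ℝ (Fin 4)} (hx : x ∈ e.target) :
    IsQEAt μ (g.coeff e) (f ∘ e.symm) (lam ∘ e.symm) x := by
  have hn := e.open_target.eventually_mem hx
  have hs : ∀ {f : M → ℝ}, ContMDiff (𝓡 4) 𝓘(ℝ, ℝ) ∞ f → ∀ y ∈ e.target,
      ContDiffAt ℝ ∞ (f ∘ e.symm) y := fun hf y hy =>
    (ContMDiffAt.comp y hf.contMDiffAt (contMDiffAt_symm_of_mem_maximalAtlas he hy)).contDiffAt
  exact ⟨hn.mono fun y hy => (g.isMetricOn_coeff he).isMetricAt e.open_target hy,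
    hn.mono fun y hy => hs hf y hy, hs hlam x hx, hn.mono fun y hy => hqe e he y hy,
    hgrad e he x hx⟩

/-- The hypotheses hold in every chart, respectively in every positively oriented one. Composing
with a local diffeomorphism of ℝ⁴ gives another such chart, whose metric coefficients are the
pullback, so all changes of coordinates come for free. -/
theorem isQEOn_coeff (hf : ContMDiff (𝓡 4) 𝓘(ℝ, ℝ) ∞ f) (hlam : ContMDiff (𝓡 4) 𝓘(ℝ, ℝ) ∞ lam)
    (hqe : ∀ e ∈ IsManifold.maximalAtlas (𝓡 4) ∞ M, ∀ x ∈ e.target, ∀ i j,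
      hessian (g.coeff e) (f ∘ e.symm) i j x + ricci (g.coeff e) i j x
        - μ * (pd i (f ∘ e.symm) x * pd j (f ∘ e.symm) x) = lam (e.symm x) * g.coeff e x i j)
    (hgrad : g.IsNonIsotropic f) (hA : IsOrientedAtlas A)
    (hW : ∀ e, IsPositiveChart A e → ∀ x ∈ e.target, ∀ i j k l, weyl (g.coeff e) i j k l x =
      s * hodge (g.coeff e) x (fun a b => weyl (g.coeff e) a b k l x) i j)
    (he : IsPositiveChart A e) :
    IsQEOn μ s (g.coeff e) (f ∘ e.symm) (lam ∘ e.symm) e.target where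
  isOpen := e.open_target
  qe x hx := isQEAt_coeff hf hlam hqe hgrad he.1 hx
  pullback_qe ψ hψ hV y hy := by
    have h1 := isQEAt_coeff hf hlam hqe hgrad (trans_symm_mem_maximalAtlas he.1 hψ)
      ((target_trans_symm hV).symm ▸ hy)
    exact h1.congr ((ψ.open_source.eventually_mem hy).mono fun z hz =>
      g.coeff_trans_symm he.1 hψ hV hz)
  pullback_halfFlat ψ hψ hV hpos y hy := by
    have h1 : IsHalfFlatAt s (g.coeff (e.trans ψ.symm)) y :=
      (ψ.open_source.eventually_mem hy).mono fun z hz => hW _ (he.trans_symm hA hψ hpos) z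
        ((target_trans_symm hV).symm ▸ hz)
    exact h1.congr ((ψ.open_source.eventually_mem hy).mono fun z hz =>
      g.coeff_trans_symm he.1 hψ hV hz)

/-- Every point has warped product coordinates on a box, centred at the point. -/
theorem exists_warped_chart (hf : ContMDiff (𝓡 4) 𝓘(ℝ, ℝ) ∞ f) (hμ : μ ≠ -1 / 2)
    (hqe : g.IsGenQuasiEinstein f μ) (hhcf : g.IsHalfConformallyFlat) (hgrad : g.IsNonIsotropic f)
    (p : M) : ∃ e ∈ IsManifold.maximalAtlas (𝓡 4) ∞ M,
      ∃ (ε r κ : ℝ) (φ : ℝ → ℝ) (h : EuclideanSpace ℝ (Fin 3) → Matrix (Fin 3) (Fin 3) ℝ),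
        p ∈ e.source ∧ e p = 0 ∧ e.target = box r ∧ 0 < r ∧ (ε = 1 ∨ ε = -1) ∧
        ContDiffOn ℝ ∞ φ (Ioo (-r) r) ∧ (∀ t, 0 < φ t) ∧
        (∀ z ∈ box r, g.coeff e z = block (fun _ => ε) (fun t => φ t ^ 2) h z) ∧
        ∀ y ∈ Metric.ball 0 r, IsMetricAt h y ∧ ∀ i j, ricci h i j y = κ * h y i j := by
  obtain ⟨lam, hlam, hqe⟩ := hqe
  obtain ⟨A, hA, hW⟩ := hhcf
  -- Both dualities are written as W = s ⋆W with s = 1 or s = −1, so the two cases share one proof.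
  obtain ⟨s, hW⟩ : ∃ s : ℝ, ∀ e, IsPositiveChart A e → ∀ x ∈ e.target, ∀ i j k l,
      weyl (g.coeff e) i j k l x =
        s * hodge (g.coeff e) x (fun a b => weyl (g.coeff e) a b k l x) i j := by
    rcases hW with h | h
    · refine ⟨1, fun e he x hx i j k l => ?_⟩
      have := h e he x hx i j k l
      rw [weylMinus] at this
      linarith
    · refine ⟨-1, fun e he x hx i j k l => ?_⟩
      have := h e he x hx i j k l
      rw [weylPlus] at this
      linarith
  obtain ⟨e, heA, hpe⟩ := hA.cover p
  have he : IsPositiveChart A e := ⟨hA.subset heA, fun e' he' => hA.compatible e heA e' he'⟩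
  have hQ := isQEOn_coeff hf hlam hqe hgrad hA hW he
  obtain ⟨ε, r, ψ, hψ, hV⟩ := hQ.exists_gauss_chart hμ (e.map_source hpe)
  have hr := hψ.pos
  have h0 : (0 : EuclideanSpace ℝ (Fin 4)) ∈ ψ.source := by
    rw [hψ.source_eq]; exact zero_mem_box hr
  obtain ⟨φ, h, κ, h1, h2, h3, h4⟩ := exists_warped hr hψ.sign_mul_self fun z hz =>
    hQ.isGaussAt hμ hψ hV (by rw [hψ.source_eq]; exact hz)
  refine ⟨e.trans ψ.symm, trans_symm_mem_maximalAtlas he.1 hψ.isDiffeo, ε, r, κ, φ, h, ⟨hpe, ?_⟩, ?_,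
    by rw [target_trans_symm hV, hψ.source_eq], hr, hψ.sign, h1, h2, fun z hz => ?_, h4⟩
  · change e p ∈ ψ.target
    rw [← hψ.zero]
    exact ψ.map_source h0
  · change ψ.symm (e p) = 0
    rw [← hψ.zero, ψ.left_inv h0]
  · rw [g.coeff_trans_symm he.1 hψ.isDiffeo hV (by rw [hψ.source_eq]; exact hz)]
    exact h3 z hz

end Four

end PseudoRiem

end

/-! ### The main theorem -/

theorem theorem1p1 {M : Type*} [TopologicalSpace M] [ChartedSpace (EuclideanSpace ℝ (Fin 4)) M]
    [IsManifold (𝓡 4) ∞ M] (g : PseudoRiem.Metric 4 M) (hg : g.IsNeutral)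
    (f : M → ℝ) (hf : ContMDiff (𝓡 4) 𝓘(ℝ, ℝ) ∞ f) (μ : ℝ) (hμ : μ ≠ -1 / 2)
    (hqe : g.IsGenQuasiEinstein f μ) (hhcf : g.IsHalfConformallyFlat)
    (hgrad : g.IsNonIsotropic f) :
    g.IsLocallyConformallyFlat ∧ g.IsLocallyWarpedConstCurv := by
  open PseudoRiem Set Filter Topology in
  refine ⟨fun p => ?_, fun p => ?_⟩
  · obtain ⟨e, he, ε, r, κ, φ, h, hp, h0, ht, hr, hε, hφ, hφ0, hG, hh⟩ :=
      exists_warped_chart hf hμ hqe hhcf hgrad p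
    obtain ⟨σ, hσ⟩ := exists_flat_factor hr (by rcases hε with h | h <;> rw [h] <;> norm_num) hφ hφ0
      hG hh
    -- The conformal factor flattens the metric only near the origin, so the warped chart is cut
    -- down to a neighbourhood on which it does.
    obtain ⟨S, hS, hSo, hS0⟩ := eventually_nhds_iff.1 hσ
    have hT : IsOpen (S ∩ e.target) := hSo.inter e.open_target
    have hψ : IsDiffeo (OpenPartialHomeomorph.ofSet _ hT) := isDiffeo_ofSet hT
    have h0t : (0 : EuclideanSpace ℝ (Fin 4)) ∈ S ∩ e.target := ⟨hS0, ht ▸ zero_mem_box hr⟩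
    refine ⟨_, trans_symm_mem_maximalAtlas he hψ, ⟨hp, ?_⟩, σ, ?_, ?_⟩
    · change e p ∈ S ∩ e.target
      rwa [h0]
    · intro x hx
      exact (hS x hx.1.1).1.contDiffWithinAt
    · intro x hx i j k l
      exact (hS x hx.1.1).2 i j k l
  · obtain ⟨e, he, ε, r, κ, φ, h, hp, -, ht, hr, hε, hφ, hφ0, hG, hh⟩ :=
      exists_warped_chart hf hμ hqe hhcf hgrad p
    refine ⟨e, he, hp, -r, r, Metric.ball 0 r, ε, φ, h, Metric.isOpen_ball,
      Metric.isConnected_ball hr, ⟨fun i j y hy => ((hh y hy).1.smooth i j).contDiffWithinAt,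
        fun y hy => (hh y hy).1.symm.self_of_nhds, fun y hy => (hh y hy).1.nondeg⟩,
      ⟨κ / 2, fun y hy v w hvw => sectional_of_ricci ((Metric.isOpen_ball.eventually_mem hy).mono
        fun z hz => (hh z hz).1) (hh y hy).2 hvw⟩, hε, hφ, fun t _ => hφ0 t, ht, fun x hx => ?_⟩
    rw [hG x (ht ▸ hx)]
    rfl
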